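/- **Setting.** A *linkage function* $d$ on $\mathbb{R}^k$ assigns to any two finite nonempty sets (clusters) $A,B\subseteq\mathbb{R}^k$ a real number $d(A,B)=d(B,A)\ge 0$; write $d(u,v):=d(\{u\},\{v\})$ for points. For a constant $K\in\mathbb{N}$ call $d$ *well-behaved with constant $K$* if, for all finite nonempty subsets $A,B,C$ of $\mathbb{R}^k$: 1. (packability) for every finite $P\subseteq\mathbb{R}^k$ with $n=|P|$, every family $\mathcal{C}$ of nonempty subsets of $P$, every nonempty $A\subseteq P$ and all $0<r\le R$: if $d(B,C)\ge r$ for all distinct $B,C\in\mathcal{C}$, then $|\{C\in\mathcal{C}:d(A,C)\le R\}|\le K(1+\log_2 n)^K(2R/r)^{Kk}$; 2. (approximate triangle inequality) $d(A,C)\le K\,(d(A,B)+d(B,C))$ whenever $|B|\ge\min(|A|,|C|)$; 3. (weight-stability) $d(A\cup B,A)\le\frac{|B|}{|A|+|B|}\,d(A,B)$ whenever $A\cap B=\emptyset$; 4. (average-reducibility) $d(A\cup B,C)\ge\frac{d(A,C)+d(B,C)}{2}-d(A,B)$ whenever $A\cap B=\emptyset$ and $|C|\ge|A|+|B|$; 5.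 (poly-bounded diameter) if $P\subseteq\mathbb{R}^k$ is finite and $d(u,v)\le\Delta$ for all $u,v\in P$, then $d(A,B)\le K(1+\Delta|P|)^K$ for all disjoint nonempty $A,B\subseteq P$. For $c\ge 1$, a *$c$-approximate HAC* of a set $P$ of $n$ points starts from the clustering $\{\{p\}:p\in P\}$ and performs $n-1$ merges; each merge replaces two distinct current clusters $A,B$ by $A\cup B$, where $d(A,B)\le c\cdot d(C,D)$ for all distinct current clusters $C,D$. The *aspect ratio* of $P$ is $\max_{u\ne v}d(u,v)/\min_{u\ne v}d(u,v)$ over $u,v\in P$, where the minimum is required to be positive. Algorithms are fixed deterministic programs in the work-depth model (nested parallel loops over a shared memory; work is the total number of steps of all threads, depth is the length of the longest chain of sequential steps, and forking $m$ threads costs work $m$ and depth $\lceil\log_2 m\rceil$). The unit-cost operations are: adding, subtracting, halving and comparing natural numbers; the field operations and comparisons on reals; forming the union of two clusters; and evaluating the linkage function at two clusters. The input consists of $n$, $k$ and the $n$ singleton clusters; the output is the sequence of the $n-1$ merges. **Theorem.** Let $K,a\in\mathbb{N}$ and $\epsilon>0$. There are a parallel algorithm and a constant $C\in\mathbb{N}$,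 both depending only on $K$, $a$ and $\epsilon$, such that for every $k$, every $n\ge 2$, every linkage function $d$ on $\mathbb{R}^k$ that is well-behaved with constant $K$, and every set of $n$ points of $\mathbb{R}^k$ (given in any order) with aspect ratio at most $n^a$, the algorithm outputs a $(1+\epsilon)$-approximate HAC of these points with $$\text{work}\le C\cdot n^2\,k^{Ck^2}\,(\log_2 n)^{Ck}\cdot(\log_2 n)^C,\qquad \text{depth}\le C\cdot k^{Ck^2}\,(\log_2 n)^{Ck}\cdot(\log_2 n)^C,$$ that is, $\tilde O(n^2k^{O(k^2)}\log^{O(k)}n)$ work and $\tilde O(k^{O(k^2)}\log^{O(k)}n)$ depth. In particular this holds for any family $d=(d_k)_k$ of linkage functions on $\mathbb{R}^k$ that is well-behaved with constants independent of $k$. -/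

import Mathlib

/-! ## Linkage functions -/

/-- Points of `ℝ^k` with the Euclidean norm. -/
abbrev Pt (k : ℕ) : Type := EuclideanSpace ℝ (Fin k)

/-- A linkage function on `ℝ^k`: a symmetric, nonnegative function of two clusters
(finite point sets).  Only its values at nonempty clusters are ever relevant. -/
structure Linkage (k : ℕ) where
  dist : Finset (Pt k) → Finset (Pt k) → ℝ
  nonneg : ∀ A B, 0 ≤ dist A B
  symm : ∀ A B, dist A B = dist B A

namespace Linkage

variable {k : ℕ}

/-- The linkage value of two points is that of their singleton clusters. -/
def pt (d : Linkage k) (u v : Pt k) : ℝ := d.dist {u} {v}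

/-- The ball `B_d^𝒞(A, R)` of the clusters of `𝒞` at linkage value at most `R` from `A`. -/
noncomputable def ball (d : Linkage k) (𝒞 : Finset (Finset (Pt k))) (A : Finset (Pt k)) (R : ℝ) :
    Finset (Finset (Pt k)) :=
  𝒞.filter fun C => d.dist A C ≤ R

/-- `α`-packability with `α = Õ(1)`: clusters of `n` points that are pairwise at least `r` apart
have at most `K (1 + log₂ n)^K (2R/r)^{Kk}` members in any ball of radius `R ≥ r`.
The expression `(R/r)^{O(k)}` is read with a base bounded away from `1`, so that a factor
`2^{O(k)}` is allowed (it is needed already for points of `ℝ^k` and `R = r`). -/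
def Packable (K : ℕ) (d : Linkage k) : Prop :=
  ∀ (P : Finset (Pt k)) (𝒞 : Finset (Finset (Pt k))) (r R : ℝ), 0 < r → r ≤ R →
    (∀ C ∈ 𝒞, C.Nonempty ∧ C ⊆ P) →
    (∀ B ∈ 𝒞, ∀ C ∈ 𝒞, B ≠ C → r ≤ d.dist B C) →
    ∀ A : Finset (Pt k), A.Nonempty → A ⊆ P →
      ((d.ball 𝒞 A R).card : ℝ) ≤
        K * (1 + Real.logb 2 (P.card : ℝ)) ^ K * (2 * (R / r)) ^ (K * k)

/-- The approximate triangle inequality with constant `K`. -/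
def ApproxTriangle (K : ℕ) (d : Linkage k) : Prop :=
  ∀ A B C : Finset (Pt k), A.Nonempty → B.Nonempty → C.Nonempty →
    min A.card C.card ≤ B.card → d.dist A C ≤ K * (d.dist A B + d.dist B C)

open scoped Classical in
/-- Weight-stability.  Merged clusters are disjoint. -/
def WeightStable (d : Linkage k) : Prop :=
  ∀ A B : Finset (Pt k), A.Nonempty → B.Nonempty → Disjoint A B →
    d.dist (A ∪ B) A ≤ (B.card : ℝ) / ((A.card : ℝ) + B.card) * d.dist A B

open scoped Classical in
/-- Average-reducibility.  Merged clusters are disjoint; `C` is arbitrary. -/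
def AverageReducible (d : Linkage k) : Prop :=
  ∀ A B C : Finset (Pt k), A.Nonempty → B.Nonempty → C.Nonempty → Disjoint A B →
    A.card + B.card ≤ C.card →
      (d.dist A C + d.dist B C) / 2 - d.dist A B ≤ d.dist (A ∪ B) C

/-- Poly-bounded diameter: `d(A, B) ≤ poly(Δ · |P|)` for disjoint `A, B ⊆ P`, where `Δ` bounds the
linkage values of the points of `P`. -/
def PolyBoundedDiameter (K : ℕ) (d : Linkage k) : Prop :=
  ∀ (P : Finset (Pt k)) (Δ : ℝ), (∀ u ∈ P, ∀ v ∈ P, d.pt u v ≤ Δ) →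
    ∀ A B : Finset (Pt k), A.Nonempty → B.Nonempty → A ⊆ P → B ⊆ P → Disjoint A B →
      d.dist A B ≤ K * (1 + Δ * P.card) ^ K

/-- `d` is well-behaved, and `K` bounds all the constants implicit in this notion.
Each condition that involves `K` becomes weaker as `K` grows. -/
structure WellBehaved (K : ℕ) (d : Linkage k) : Prop where
  packable : d.Packable K
  approxTriangle : d.ApproxTriangle K
  weightStable : d.WeightStable
  averageReducible : d.AverageReducible
  polyBoundedDiameter : d.PolyBoundedDiameter K

/-- The ratio of the largest to the smallest linkage value of two distinct points `p i`, `p j` is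
at most `ρ`, the smallest value being positive. -/
def AspectRatioLE {n : ℕ} (d : Linkage k) (p : Fin n → Pt k) (ρ : ℝ) : Prop :=
  ∀ i j i' j' : Fin n, i ≠ j → i' ≠ j' →
    0 < d.pt (p i') (p j') ∧ d.pt (p i) (p j) / d.pt (p i') (p j') ≤ ρ

end Linkage

/-! ## Hierarchical agglomerative clustering -/

open scoped Classical in
/-- `ApproxHACFrom d c 𝒞 L`: the list of merges `L` is a `c`-approximate HAC started from the
clustering `𝒞`.  Each merge joins two distinct current clusters whose linkage value is at most `c`
times that of any two distinct current clusters, until a single cluster is left. -/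
inductive ApproxHACFrom {k : ℕ} (d : Linkage k) (c : ℝ) :
    Finset (Finset (Pt k)) → List (Finset (Pt k) × Finset (Pt k)) → Prop
  | done (P : Finset (Pt k)) : ApproxHACFrom d c {P} []
  | merge (𝒞 : Finset (Finset (Pt k))) (A B : Finset (Pt k))
      (L : List (Finset (Pt k) × Finset (Pt k))) :
      A ∈ 𝒞 → B ∈ 𝒞 → A ≠ B →
      (∀ C ∈ 𝒞, ∀ D ∈ 𝒞, C ≠ D → d.dist A B ≤ c * d.dist C D) →
      ApproxHACFrom d c (insert (A ∪ B) ((𝒞.erase A).erase B)) L →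
      ApproxHACFrom d c 𝒞 ((A, B) :: L)

open scoped Classical in
/-- A `c`-approximate HAC of the points `p 0, …, p (n-1)` starts from the singleton clusters. -/
def IsApproxHAC {k n : ℕ} (d : Linkage k) (c : ℝ) (p : Fin n → Pt k)
    (L : List (Finset (Pt k) × Finset (Pt k))) : Prop :=
  ApproxHACFrom d c (Finset.univ.image fun i => {p i}) L

/-! ## The work-depth model

A fixed finite program runs on a shared random-access memory that consists of natural-number cells,
real-number cells and cluster cells.  Every elementary command takes one step.  On naturals it may
use addition, truncated subtraction and halving (so a step lengthens a number by at most one bit),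
on reals the field operations and comparisons of a real RAM (no rounding; the only constants of a
program are natural numbers), and on clusters it may form the union of two clusters and ask for the
linkage value of two clusters.  Threads are forked by a (nestable) parallel loop: work adds up over
the threads, depth is the maximum over the threads. -/

/-- Addresses: the number of an array, a row and a column. -/
abbrev Addr : Type := ℕ × ℕ × ℕ

/-- The memory. -/
structure Store (k : ℕ) where
  nat : Addr → ℕ
  real : Addr → ℝ
  clu : Addr → Finset (Pt k)

/-- Expressions for natural numbers; `get a i j` reads a cell of the array `a`. -/
inductive NatExp
  | lit (c : ℕ)
  | get (a : ℕ) (i j : NatExp)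
  | add (e f : NatExp)
  | sub (e f : NatExp)
  | half (e : NatExp)

def NatExp.eval {k : ℕ} (σ : Store k) : NatExp → ℕ
  | lit c => c
  | get a i j => σ.nat (a, i.eval σ, j.eval σ)
  | add e f => e.eval σ + f.eval σ
  | sub e f => e.eval σ - f.eval σ
  | half e => e.eval σ / 2

/-- A cell of an array, with computed row and column. -/
structure Cell where
  arr : ℕ
  row : NatExp
  col : NatExp

def Cell.addr {k : ℕ} (σ : Store k) (x : Cell) : Addr := (x.arr, x.row.eval σ, x.col.eval σ)

/-- Expressions for real numbers. -/
inductive RealExp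
  | ofNat (e : NatExp)
  | get (x : Cell)
  | add (e f : RealExp)
  | sub (e f : RealExp)
  | mul (e f : RealExp)
  | div (e f : RealExp)

noncomputable def RealExp.eval {k : ℕ} (σ : Store k) : RealExp → ℝ
  | ofNat e => (e.eval σ : ℝ)
  | get x => σ.real (x.addr σ)
  | add e f => e.eval σ + f.eval σ
  | sub e f => e.eval σ - f.eval σ
  | mul e f => e.eval σ * f.eval σ
  | div e f => e.eval σ / f.eval σ

/-- Tests. -/
inductive Cond
  | natLe (e f : NatExp)
  | realLe (e f : RealExp)
  | not (b : Cond)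

def Cond.holds {k : ℕ} (σ : Store k) : Cond → Prop
  | natLe e f => e.eval σ ≤ f.eval σ
  | realLe e f => e.eval σ ≤ f.eval σ
  | not b => ¬ b.holds σ

/-- Programs. -/
inductive Cmd
  /-- `x := e` for a natural-number cell `x` -/
  | setNat (x : Cell) (e : NatExp)
  /-- `x := e` for a real-number cell `x` -/
  | setReal (x : Cell) (e : RealExp)
  /-- `x := y ∪ z` for cluster cells -/
  | union (x y z : Cell)
  /-- `x := d(y, z)` for a real-number cell `x` and cluster cells `y`, `z` -/
  | linkage (x y z : Cell)
  | seq (p q : Cmd)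
  | ite (b : Cond) (p q : Cmd)
  | loop (b : Cond) (p : Cmd)
  /-- for all `i < m` in parallel, run `p` with `i` in the natural-number cell `(a, 0, 0)` -/
  | par (a : ℕ) (m : NatExp) (p : Cmd)

/-- The store in which thread `i` of a parallel loop starts. -/
def Store.thread {k : ℕ} (σ : Store k) (a i : ℕ) : Store k :=
  { σ with nat := Function.update σ.nat (a, 0, 0) i }

open scoped Classical in
/-- Priority rule for a cell with content `x` before the fork and content `y i` at the end of
thread `i < m`: the first thread that changed the cell determines it. -/
noncomputable def priority {α : Type} (m : ℕ) (x : α) (y : ℕ → α) : α :=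
  if h : ∃ i, i < m ∧ y i ≠ x then y (Nat.find h) else x

/-- The store after a parallel loop whose threads `i < m` ended in `τ i`; the loop variable
`(a, 0, 0)` gets its former content back. -/
noncomputable def Store.join {k : ℕ} (σ : Store k) (a m : ℕ) (τ : ℕ → Store k) : Store k where
  nat := Function.update (fun x => priority m (σ.nat x) fun i => (τ i).nat x) (a, 0, 0)
    (σ.nat (a, 0, 0))
  real x := priority m (σ.real x) fun i => (τ i).real x
  clu x := priority m (σ.clu x) fun i => (τ i).clu x

open scoped Classical in
/-- `Exec d p σ σ' w t`: with linkage function `d`, the program `p` started in the store `σ` halts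
in the store `σ'`, with work `w` and depth `t`.  The threads of a parallel loop work on copies of
the store, which are joined by the priority rule when all of them have halted. Forking `m` threads
takes work `m` and depth `⌈log₂ m⌉`. -/
inductive Exec {k : ℕ} (d : Linkage k) : Cmd → Store k → Store k → ℕ → ℕ → Prop
  | setNat (σ : Store k) (x : Cell) (e : NatExp) :
      Exec d (.setNat x e) σ
        { σ with nat := Function.update σ.nat (x.addr σ) (e.eval σ) } 1 1
  | setReal (σ : Store k) (x : Cell) (e : RealExp) :
      Exec d (.setReal x e) σ
        { σ with real := Function.update σ.real (x.addr σ) (e.eval σ) } 1 1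
  | union (σ : Store k) (x y z : Cell) :
      Exec d (.union x y z) σ
        { σ with clu := Function.update σ.clu (x.addr σ)
                          (σ.clu (y.addr σ) ∪ σ.clu (z.addr σ)) } 1 1
  | linkage (σ : Store k) (x y z : Cell) :
      Exec d (.linkage x y z) σ
        { σ with real := Function.update σ.real (x.addr σ)
                          (d.dist (σ.clu (y.addr σ)) (σ.clu (z.addr σ))) } 1 1
  | seq {p q : Cmd} {σ σ₁ σ₂ : Store k} {w₁ t₁ w₂ t₂ : ℕ} :
      Exec d p σ σ₁ w₁ t₁ → Exec d q σ₁ σ₂ w₂ t₂ →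
      Exec d (.seq p q) σ σ₂ (w₁ + w₂) (t₁ + t₂)
  | iteTrue {b : Cond} {p q : Cmd} {σ σ' : Store k} {w t : ℕ} :
      b.holds σ → Exec d p σ σ' w t → Exec d (.ite b p q) σ σ' (1 + w) (1 + t)
  | iteFalse {b : Cond} {p q : Cmd} {σ σ' : Store k} {w t : ℕ} :
      ¬ b.holds σ → Exec d q σ σ' w t → Exec d (.ite b p q) σ σ' (1 + w) (1 + t)
  | loopDone {b : Cond} {p : Cmd} {σ : Store k} :
      ¬ b.holds σ → Exec d (.loop b p) σ σ 1 1
  | loopStep {b : Cond} {p : Cmd} {σ σ₁ σ₂ : Store k} {w₁ t₁ w₂ t₂ : ℕ} :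
      b.holds σ → Exec d p σ σ₁ w₁ t₁ → Exec d (.loop b p) σ₁ σ₂ w₂ t₂ →
      Exec d (.loop b p) σ σ₂ (1 + w₁ + w₂) (1 + t₁ + t₂)
  | par {a : ℕ} {m : NatExp} {p : Cmd} {σ : Store k} (τ : ℕ → Store k) (w t : ℕ → ℕ) :
      (∀ i, i < m.eval σ → Exec d p (σ.thread a i) (τ i) (w i) (t i)) →
      Exec d (.par a m p) σ (σ.join a (m.eval σ) τ)
        (1 + ∑ i ∈ Finset.range (m.eval σ), (1 + w i))
        (1 + Nat.clog 2 (m.eval σ) + (Finset.range (m.eval σ)).sup t)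

theorem priority_congr {α : Type} {m : ℕ} {x : α} {y z : ℕ → α} (h : ∀ i < m, y i = z i) :
    priority m x y = priority m x z := by
  classical
  have hp : ∀ i, (i < m ∧ y i ≠ x) ↔ (i < m ∧ z i ≠ x) := fun i =>
    and_congr_right fun hi => by rw [h i hi]
  unfold priority
  by_cases hy : ∃ i, i < m ∧ y i ≠ x
  · have hz : ∃ i, i < m ∧ z i ≠ x := hy.imp fun i => (hp i).1
    rw [dif_pos hy, dif_pos hz]
    have e : Nat.find hy = Nat.find hz := Nat.find_congr' fun {i} => hp i
    rw [h _ (Nat.find_spec hy).1, e]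
  · have hz : ¬ ∃ i, i < m ∧ z i ≠ x := fun hz => hy (hz.imp fun i => (hp i).2)
    rw [dif_neg hy, dif_neg hz]

theorem Store.join_congr {k : ℕ} {σ : Store k} {a m : ℕ} {τ τ' : ℕ → Store k}
    (h : ∀ i < m, τ i = τ' i) : σ.join a m τ = σ.join a m τ' := by
  unfold Store.join
  congr 1
  · congr 1
    funext x
    exact priority_congr fun i hi => by rw [h i hi]
  · funext x
    exact priority_congr fun i hi => by rw [h i hi]
  · funext x
    exact priority_congr fun i hi => by rw [h i hi]

/-- The model is deterministic: a program has at most one run from a given store. -/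
theorem Exec.deterministic {k : ℕ} {d : Linkage k} {p : Cmd} {σ σ₁ σ₂ : Store k}
    {w₁ t₁ w₂ t₂ : ℕ} (h₁ : Exec d p σ σ₁ w₁ t₁) (h₂ : Exec d p σ σ₂ w₂ t₂) :
    σ₁ = σ₂ ∧ w₁ = w₂ ∧ t₁ = t₂ := by
  induction h₁ generalizing σ₂ w₂ t₂ with
  | setNat | setReal | union | linkage => cases h₂; exact ⟨rfl, rfl, rfl⟩
  | seq _ _ ih ih' =>
    cases h₂ with
    | seq hp hq =>
      obtain ⟨rfl, rfl, rfl⟩ := ih hp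
      obtain ⟨rfl, rfl, rfl⟩ := ih' hq
      exact ⟨rfl, rfl, rfl⟩
  | iteTrue hb _ ih =>
    cases h₂ with
    | iteTrue _ hp => obtain ⟨rfl, rfl, rfl⟩ := ih hp; exact ⟨rfl, rfl, rfl⟩
    | iteFalse hb' _ => exact absurd hb hb'
  | iteFalse hb _ ih =>
    cases h₂ with
    | iteTrue hb' _ => exact absurd hb' hb
    | iteFalse _ hp => obtain ⟨rfl, rfl, rfl⟩ := ih hp; exact ⟨rfl, rfl, rfl⟩
  | loopDone hb =>
    cases h₂ with
    | loopDone => exact ⟨rfl, rfl, rfl⟩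
    | loopStep hb' => exact absurd hb' hb
  | loopStep hb _ _ ih ih' =>
    cases h₂ with
    | loopDone hb' => exact absurd hb hb'
    | loopStep _ hp hq =>
      obtain ⟨rfl, rfl, rfl⟩ := ih hp
      obtain ⟨rfl, rfl, rfl⟩ := ih' hq
      exact ⟨rfl, rfl, rfl⟩
  | par τ w t _ ih =>
    cases h₂ with
    | par τ' w' t' h' =>
      have e := fun i hi => ih i hi (h' i hi)
      refine ⟨Store.join_congr fun i hi => (e i hi).1, ?_, ?_⟩
      · congr 1
        exact Finset.sum_congr rfl fun i hi => by rw [(e i (Finset.mem_range.1 hi)).2.1]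
      · congr 1
        exact Finset.sup_congr rfl fun i hi => (e i (Finset.mem_range.1 hi)).2.2

/-- Input convention: the natural-number cells `(0, 0, 0)` and `(1, 0, 0)` hold `n` and `k`, the
cluster cells `(0, i, 0)`, `i < n`, hold the singletons `{p i}`, and all other cells are empty.
The coordinates of the points are accessible only through the linkage function. -/
def Store.input {k n : ℕ} (p : Fin n → Pt k) : Store k where
  nat x := if x = (0, 0, 0) then n else if x = (1, 0, 0) then k else 0
  real _ := 0
  clu x := if h : x.2.1 < n then (if x.1 = 0 ∧ x.2.2 = 0 then {p ⟨x.2.1, h⟩} else ∅) else ∅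

open scoped Classical in
/-- Output convention: the merge sequence is written as node numbers.  Node `i < n` is the
singleton `{p i}`, and node `n + i` is the cluster formed by the `i`-th merge, `i < n - 1`, which
joins the nodes whose numbers are in the natural-number cells `(2, i, 0)` and `(2, i, 1)`. -/
def Store.OutputsApproxHAC {k n : ℕ} (σ : Store k) (d : Linkage k) (c : ℝ) (p : Fin n → Pt k) :
    Prop :=
  ∃ node : ℕ → Finset (Pt k),
    (∀ i : Fin n, node i = {p i}) ∧
    (∀ i < n - 1, σ.nat (2, i, 0) < n + i ∧ σ.nat (2, i, 1) < n + i ∧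
      node (n + i) = node (σ.nat (2, i, 0)) ∪ node (σ.nat (2, i, 1))) ∧
    IsApproxHAC d c p
      ((List.range (n - 1)).map fun i => (node (σ.nat (2, i, 0)), node (σ.nat (2, i, 1))))

/-!
Approximate hierarchical agglomerative clustering is done at geometrically increasing scales `L`.
At the beginning of a phase all clusters are at least `L` apart; at its end they are at least
`L (1 + 1 / q)` apart, where `1 / q ≤ ε`. As long as all pairs are at least `L` apart, any merge of
clusters within `thr = L (1 + 1 / q)` is `(1 + ε)`-approximate.

*Cascades.* A cluster is processed by a cascade: it is merged with a nearest cluster until nothing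
is left within `thr`. During the cascade all other clusters stay as they are. If the growing cluster
does not become larger by a factor `1 + 1 / polylog` in a run of merges, weight-stability makes its
moves so short that all clusters absorbed in the run are near one place, and by packability there
are few of them (`Linkage.Cascade.growth`). Hence a cascade has polylogarithmic length
(`Linkage.Cascade.length_lt`) and, by the approximate triangle inequality along the chain of the
growing clusters, it moves its cluster by at most a polylogarithmic multiple of `L`
(`Linkage.Cascade.off_le`); here the dimension is regarded as a constant, and in fact all these
quantities are powers of `2 ^ k * log n` with exponents that depend only on `K`.

*Stages.* Cascades whose seeds have no cluster near both of them therefore do not interact: they can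
run in parallel, afterwards all clusters are still at least `L` apart
(`Linkage.Stage.clustering_after`), each grown cluster is farther than `thr` from all others
(`Linkage.Stage.lt_dist_after`), and the merges form a valid sequence if the cascades are written
one after the other (`Linkage.Stage.reach`). A cluster once processed needs no further processing in
the phase.

*Symmetry breaking.* By packability each cluster has a bounded number of rivals that may compete
with it for a neighbor in the course of a phase (`Linkage.Clustering.card_rivals_le`). For some
small modulus `m`, its slot number differs modulo `m` from those of all rivals
(`exists_separating_modulus`, by a divisibility of a central binomial coefficient). So a phase runs
through all small moduli `m` and all residues `r` modulo `m`, and in each stage it takes as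
candidates the clusters not yet processed with slot numbers of residue `r`. A candidate without
competition is always selected (`select_runs`), and so every cluster is processed or absorbed
(`phase_runs`).

*Number of phases.* The linkage values of disjoint clusters exceed those of points by at most a
quasipolynomial factor (`Linkage.WellBehaved.dist_le`); together with the bound for the aspect ratio
this leaves polylogarithmically many phases (`HacInv.scale_le`, `hac_runs`).

All bounds are of the form `n ^ j * (2 ^ k * log n) ^ O(k)`, with `j = 2` for the work and `j = 0`
for the depth; the predicate `Growth` collects the closure properties that are needed.

The program uses the following arrays. A slot is the number of an input point; the clusters are
kept in some of the slots, and a merge empties one of them. The nodes `0, …, n - 1` are the points,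
and node `n + t` is the result of merge `t`.

* natural numbers: `0` the number `n`; `1` the dimension `k`; `2` the output; `3` nonzero for slots
  that contain a cluster; `4` the node of a slot; `5` nonzero for slots not yet processed in the
  phase; `6` the slots absorbed by each cascade; `7` the lengths of the cascades; `8` entries that
  are combined by doubling; `9` the candidate chosen by each cluster; `10` nonzero for the selected
  candidates; `11` the number of merges written; `12`, `13` the modulus and the residue; `14` the
  flag of the loop of a phase; `15` step width or output position; `16` the relation of being near;
  `17` flag or counter of an inner loop; `18` the number `lg n`; `19` a power of two; `20`, `21`,
  `22` loop variables;
* real numbers: `0` the scale `L`; `2` the radius, as a multiple of `L`; `3` the linkage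
  values to the cluster of a cascade; `4` a linkage value; `5` a power with exponent `k`;
* clusters: `0` the clusters of the nodes; `1` the clusters of the slots.
-/

/-! ### Logarithms -/

/-- `⌈log₂ n⌉ + 1`, the logarithm in which all bounds are expressed. -/
def lg (n : ℕ) : ℕ := Nat.clog 2 n + 1

theorem le_two_pow_clog (n : ℕ) : n ≤ 2 ^ Nat.clog 2 n := Nat.le_pow_clog one_lt_two n

theorem one_add_logb_le_lg {n : ℕ} (hn : 1 ≤ n) : 1 + Real.logb 2 n ≤ lg n := by
  have h : Real.logb 2 n ≤ Nat.clog 2 n := by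
    rw [Real.logb_le_iff_le_rpow one_lt_two (by exact_mod_cast hn), Real.rpow_natCast]
    exact_mod_cast le_two_pow_clog n
  rw [lg]; push_cast; linarith

theorem two_pow_clog_le {n : ℕ} (hn : 1 ≤ n) : 2 ^ Nat.clog 2 n ≤ 2 * n := by
  rcases Nat.lt_or_ge 1 n with h | h
  · have h1 : Nat.clog 2 n ≠ 0 := (Nat.clog_pos one_lt_two h).ne'
    obtain ⟨c, hc⟩ := Nat.exists_eq_succ_of_ne_zero h1
    have : 2 ^ c < n := Nat.pow_lt_of_lt_clog (by omega)
    rw [hc, pow_succ]; omega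
  · have : n = 1 := by omega
    subst this; simp

/-! ### Linkage values with zero diagonal, and packing -/

namespace Linkage

variable {k : ℕ}

open scoped Classical in
/-- The linkage function with its diagonal set to zero. The values `d A A` are arbitrary nonnegative
numbers; without them the approximate triangle inequality can be iterated also along chains with
repetitions. -/
noncomputable def off (d : Linkage k) (A B : Finset (Pt k)) : ℝ :=
  if A = B then 0 else d.dist A B

theorem off_self (d : Linkage k) (A : Finset (Pt k)) : d.off A A = 0 := if_pos rfl

theorem off_of_ne (d : Linkage k) {A B : Finset (Pt k)} (h : A ≠ B) : d.off A B = d.dist A B :=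
  if_neg h

theorem off_nonneg (d : Linkage k) (A B : Finset (Pt k)) : 0 ≤ d.off A B := by
  unfold off; split_ifs; exacts [le_rfl, d.nonneg A B]

theorem off_le_dist (d : Linkage k) (A B : Finset (Pt k)) : d.off A B ≤ d.dist A B := by
  unfold off; split_ifs; exacts [d.nonneg A B, le_rfl]

theorem off_comm (d : Linkage k) (A B : Finset (Pt k)) : d.off A B = d.off B A := by
  unfold off; simp only [eq_comm (a := A), d.symm A B]

theorem off_triangle {d : Linkage k} {K : ℕ} (hK : 1 ≤ K) (h : d.ApproxTriangle K)
    {A B C : Finset (Pt k)} (hA : A.Nonempty) (hB : B.Nonempty) (hC : C.Nonempty)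
    (hc : min A.card C.card ≤ B.card) : d.off A C ≤ K * (d.off A B + d.off B C) := by
  have hK' : (1 : ℝ) ≤ K := by exact_mod_cast hK
  have h1 := d.off_nonneg A B
  have h2 := d.off_nonneg B C
  by_cases hAC : A = C
  · subst hAC; rw [off_self]; positivity
  by_cases hAB : A = B
  · subst hAB; rw [off_self, zero_add]; nlinarith
  by_cases hBC : B = C
  · subst hBC; rw [off_self, add_zero]; nlinarith
  rw [off_of_ne d hAC, off_of_ne d hAB, off_of_ne d hBC]
  exact h A B C hA hB hC hc

/-- Along a chain of clusters of nondecreasing sizes, halving the chain repeatedly loses one factor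
`2 K` for each halving. -/
theorem off_chain {d : Linkage k} {K : ℕ} (hK : 1 ≤ K) (h : d.ApproxTriangle K)
    {Y : ℕ → Finset (Pt k)} {l N : ℕ} {e : ℝ} (he : 0 ≤ e)
    (hne : ∀ s, (Y s).Nonempty) (hmono : ∀ s t, s ≤ t → (Y s).card ≤ (Y t).card)
    (step : ∀ s, l ≤ s → s < N → d.off (Y s) (Y (s + 1)) ≤ e) (j : ℕ) :
    ∀ a b, l ≤ a → a ≤ b → b ≤ N → b ≤ a + 2 ^ j → d.off (Y a) (Y b) ≤ (2 * K) ^ j * e := by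
  induction j with
  | zero =>
    intro a b hl hab hbN hb
    rw [pow_zero, one_mul]
    rcases Nat.lt_or_ge a b with h1 | h1
    · have : b = a + 1 := by simp at hb; omega
      subst this; exact step a hl (by omega)
    · have : b = a := by omega
      subst this; rwa [off_self]
  | succ j ih =>
    intro a b hl hab hbN hb
    have hp : 2 ^ (j + 1) = 2 ^ j + 2 ^ j := by ring
    have h1 := ih a (min b (a + 2 ^ j)) hl (by omega) (by omega) (by omega)
    have h2 := ih (min b (a + 2 ^ j)) b (by omega) (by omega) hbN (by omega)
    have h3 := off_triangle hK h (hne a) (hne (min b (a + 2 ^ j))) (hne b)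
      ((min_le_left _ _).trans (hmono _ _ (by omega)))
    have hK0 : (0 : ℝ) ≤ K := by positivity
    calc d.off (Y a) (Y b) ≤ K * ((2 * K) ^ j * e + (2 * K) ^ j * e) :=
          h3.trans (by gcongr)
      _ = (2 * K) ^ (j + 1) * e := by ring

theorem two_mul_pow_clog_le {K N : ℕ} (hN : 1 ≤ N) :
    (2 * K) ^ Nat.clog 2 N ≤ (2 * N) ^ (2 * K) := by
  calc (2 * K) ^ Nat.clog 2 N ≤ (2 ^ (2 * K)) ^ Nat.clog 2 N :=
        Nat.pow_le_pow_left Nat.lt_two_pow_self.le _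
    _ = (2 ^ Nat.clog 2 N) ^ (2 * K) := by rw [← pow_mul, ← pow_mul, mul_comm]
    _ ≤ _ := Nat.pow_le_pow_left (two_pow_clog_le hN) _

/-- A chain of `N` steps of length `e` spans at most a polynomial in `N` times `e`, by `off_chain`
with `⌈log₂ N⌉` halvings. -/
theorem off_chain_le {d : Linkage k} {K : ℕ} (hK : 1 ≤ K) (h : d.ApproxTriangle K)
    {Y : ℕ → Finset (Pt k)} {l N n : ℕ} {e : ℝ} (he : 0 ≤ e) (hN : 1 ≤ N)
    (hne : ∀ s, (Y s).Nonempty) (hmono : ∀ s t, s ≤ t → (Y s).card ≤ (Y t).card)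
    (step : ∀ s, l ≤ s → s < n → d.off (Y s) (Y (s + 1)) ≤ e)
    {a b : ℕ} (hl : l ≤ a) (hab : a ≤ b) (hb : b ≤ n) (hbN : b ≤ a + N) :
    d.off (Y a) (Y b) ≤ ((2 * N) ^ (2 * K) : ℕ) * e := by
  refine (off_chain hK h he hne hmono step (Nat.clog 2 N) a b hl hab hb
    (hbN.trans (by gcongr; exact le_two_pow_clog N))).trans ?_
  gcongr
  exact_mod_cast two_mul_pow_clog_le hN

/-- For `K = 0` packability would bound the size of a ball by zero, but a large ball around a
singleton contains that singleton. -/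
theorem WellBehaved.one_le {d : Linkage k} {K : ℕ} (hd : d.WellBehaved K) : 1 ≤ K := by
  rcases Nat.eq_zero_or_pos K with h | h
  · exfalso
    subst h
    let A : Finset (Pt k) := {0}
    have h1 := hd.packable A {A} (d.dist A A + 1) (d.dist A A + 1)
      (by have := d.nonneg A A; linarith) le_rfl
      (by intro C hC; rw [Finset.mem_singleton] at hC; subst hC
          exact ⟨Finset.singleton_nonempty _, subset_rfl⟩)
      (by intro B hB C hC hne
          rw [Finset.mem_singleton] at hB hC
          exact absurd (hB.trans hC.symm) hne)
      A (Finset.singleton_nonempty _) subset_rfl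
    have h2 : A ∈ d.ball {A} A (d.dist A A + 1) := by simp [ball]
    have h3 : 0 < (d.ball {A} A (d.dist A A + 1)).card := Finset.card_pos.2 ⟨A, h2⟩
    have h4 : (0 : ℝ) < (d.ball {A} A (d.dist A A + 1)).card := by exact_mod_cast h3
    simp at h1
    rw [h1] at h3
    simp at h3
  · exact h

/-- A clustering of points of `P`: the clusters `X i`, `i ∈ S`, are nonempty, pairwise disjoint, and
any two of them have linkage value at least `L`. The index set `S` consists of slots, which keep
their numbers when clusters are merged; the value of `X` at other slots is irrelevant. -/
structure Clustering (d : Linkage k) (P : Finset (Pt k)) (L : ℝ) (S : Finset ℕ)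
    (X : ℕ → Finset (Pt k)) : Prop where
  nonempty : ∀ i ∈ S, (X i).Nonempty
  subset : ∀ i ∈ S, X i ⊆ P
  disjoint : ∀ i ∈ S, ∀ j ∈ S, i ≠ j → Disjoint (X i) (X j)
  le_dist : ∀ i ∈ S, ∀ j ∈ S, i ≠ j → L ≤ d.dist (X i) (X j)

theorem Clustering.ne {d : Linkage k} {P : Finset (Pt k)} {L : ℝ} {S : Finset ℕ}
    {X : ℕ → Finset (Pt k)} (h : d.Clustering P L S X) {i j : ℕ} (hi : i ∈ S) (hj : j ∈ S)
    (hij : i ≠ j) : X i ≠ X j := fun e => by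
  have h1 := h.disjoint i hi j hj hij
  rw [← e, Finset.disjoint_self_iff_empty] at h1
  exact (h.nonempty i hi).ne_empty h1

/-- At most this many clusters that are pairwise at least `L` apart are within `q L` of a
cluster. -/
def packNum (K k l q : ℕ) : ℕ := K * l ^ K * (2 * q) ^ (K * k)

/-- Packability, with `r = L` and `R = q L`, in terms of natural numbers. -/
theorem Clustering.card_le {d : Linkage k} {K : ℕ} (hd : d.WellBehaved K) {P : Finset (Pt k)}
    {L : ℝ} (hL : 0 < L) {S : Finset ℕ} {X : ℕ → Finset (Pt k)} (h : d.Clustering P L S X)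
    {A : Finset (Pt k)} (hA : A.Nonempty) (hAP : A ⊆ P) {q : ℕ} (hq : 1 ≤ q)
    (hS : ∀ i ∈ S, d.dist A (X i) ≤ q * L) : S.card ≤ packNum K k (lg P.card) q := by
  classical
  have hq' : (1 : ℝ) ≤ q := by exact_mod_cast hq
  have h1 := hd.packable P (S.image X) L (q * L) hL (by nlinarith)
    (by simp only [Finset.mem_image, forall_exists_index, and_imp]
        rintro _ i hi rfl; exact ⟨h.nonempty i hi, h.subset i hi⟩)
    (by simp only [Finset.mem_image, forall_exists_index, and_imp]
        rintro _ i hi rfl _ j hj rfl hne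
        exact h.le_dist i hi j hj (fun e => hne (by rw [e])))
    A hA hAP
  have h2 : d.ball (S.image X) A (q * L) = S.image X := by
    rw [ball, Finset.filter_true_of_mem]
    simp only [Finset.mem_image, forall_exists_index, and_imp]
    rintro _ i hi rfl; exact hS i hi
  rw [h2, Finset.card_image_of_injOn] at h1
  · have h3 : q * L / L = q := by field_simp
    rw [h3] at h1
    have hP : 1 ≤ P.card := (hA.card_pos).trans_le (Finset.card_le_card hAP)
    have h4 := one_add_logb_le_lg hP
    have h5 : 0 ≤ Real.logb 2 P.card := Real.logb_nonneg one_lt_two (by exact_mod_cast hP)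
    have h6 : (S.card : ℝ) ≤ (packNum K k (lg P.card) q : ℕ) := by
      refine h1.trans ?_
      unfold packNum; push_cast
      gcongr
    exact_mod_cast h6
  · intro i hi j hj e
    by_contra hij
    exact h.ne hi hj hij e

theorem Clustering.mono {d : Linkage k} {P : Finset (Pt k)} {L : ℝ} {S S' : Finset ℕ}
    {X : ℕ → Finset (Pt k)} (h : d.Clustering P L S X) (hS : S' ⊆ S) : d.Clustering P L S' X :=
  ⟨fun i hi => h.nonempty i (hS hi), fun i hi => h.subset i (hS hi),
    fun i hi j hj => h.disjoint i (hS hi) j (hS hj),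
    fun i hi j hj => h.le_dist i (hS hi) j (hS hj)⟩

/-- The same bound for the linkage function with zero diagonal, which may admit one more cluster. -/
theorem Clustering.card_le_off {d : Linkage k} {K : ℕ} (hd : d.WellBehaved K)
    {P : Finset (Pt k)} {L : ℝ} (hL : 0 < L) {S : Finset ℕ} {X : ℕ → Finset (Pt k)}
    (h : d.Clustering P L S X) {A : Finset (Pt k)} (hA : A.Nonempty) (hAP : A ⊆ P) {q : ℕ}
    (hq : 1 ≤ q) (hS : ∀ i ∈ S, d.off A (X i) ≤ q * L) :
    S.card ≤ packNum K k (lg P.card) q + 1 := by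
  classical
  have h1 := (h.mono (Finset.filter_subset (fun i => X i ≠ A) S)).card_le hd hL hA hAP hq (by
    intro i hi
    rw [Finset.mem_filter] at hi
    rw [← d.off_of_ne (Ne.symm hi.2)]; exact hS i hi.1)
  have h2 : (S.filter fun i => ¬ X i ≠ A).card ≤ 1 := by
    rw [Finset.card_le_one]
    intro i hi j hj
    simp only [Finset.mem_filter, not_not] at hi hj
    by_contra hij
    exact h.ne hi.1 hj.1 hij (hi.2.trans hj.2.symm)
  have h3 := Finset.card_filter_add_card_filter_not (s := S) (fun i => X i ≠ A)
  omega

end Linkage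

/-! ### Lengths and displacements of cascades -/

namespace Linkage

variable {k : ℕ}

open scoped Classical in
/-- The cluster of slot `i` after it has been merged with the slots `b 0, …, b (s - 1)`. -/
noncomputable def grow (X : ℕ → Finset (Pt k)) (i : ℕ) (b : ℕ → ℕ) : ℕ → Finset (Pt k)
  | 0 => X i
  | s + 1 => grow X i b s ∪ X (b s)

theorem grow_congr {X : ℕ → Finset (Pt k)} {i : ℕ} {b b' : ℕ → ℕ} {s : ℕ}
    (h : ∀ t < s, b t = b' t) : grow X i b s = grow X i b' s := by
  induction s with
  | zero => rfl
  | succ s ih => rw [grow, grow, ih fun t ht => h t (by omega), h s (by omega)]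

theorem grow_mono {X : ℕ → Finset (Pt k)} {i : ℕ} {b : ℕ → ℕ} {s t : ℕ} (h : s ≤ t) :
    grow X i b s ⊆ grow X i b t := by
  induction t with
  | zero => rw [Nat.le_zero.1 h]
  | succ t ih =>
    rcases Nat.lt_or_ge t s with h1 | h1
    · rw [show s = t + 1 by omega]
    · exact (ih h1).trans (by rw [grow]; exact Finset.subset_union_left)

theorem mem_grow {X : ℕ → Finset (Pt k)} {i : ℕ} {b : ℕ → ℕ} {s : ℕ} {u : Pt k} :
    u ∈ grow X i b s ↔ u ∈ X i ∨ ∃ t < s, u ∈ X (b t) := by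
  induction s with
  | zero => simp [grow]
  | succ s ih =>
    rw [grow, Finset.mem_union, ih]
    constructor
    · rintro ((h | ⟨t, ht, h⟩) | h)
      exacts [Or.inl h, Or.inr ⟨t, by omega, h⟩, Or.inr ⟨s, by omega, h⟩]
    · rintro (h | ⟨t, ht, h⟩)
      · exact Or.inl (Or.inl h)
      · rcases Nat.lt_or_ge t s with h1 | h1
        · exact Or.inl (Or.inr ⟨t, h1, h⟩)
        · rw [show t = s by omega] at h; exact Or.inr h

/-- `b 0, …, b (h - 1)` is a run of a cascade of slot `i`: the cluster of slot `i` is merged `h`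
times with a nearest cluster, as long as that one is within `thr`; all other clusters stay as they
are in the clustering `X i`, `i ∈ S`. -/
structure Cascade (d : Linkage k) (thr : ℝ) (S : Finset ℕ) (X : ℕ → Finset (Pt k)) (i : ℕ)
    (b : ℕ → ℕ) (h : ℕ) : Prop where
  mem : ∀ s < h, b s ∈ S
  ne : ∀ s < h, b s ≠ i
  inj : ∀ s < h, ∀ t < s, b t ≠ b s
  le_thr : ∀ s < h, d.dist (grow X i b s) (X (b s)) ≤ thr
  nearest : ∀ s < h, ∀ j ∈ S, j ≠ i → (∀ t < s, b t ≠ j) →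
    d.dist (grow X i b s) (X (b s)) ≤ d.dist (grow X i b s) (X j)

/-- A cascade is complete when no cluster is left within `thr`. -/
def CascadeDone (d : Linkage k) (thr : ℝ) (S : Finset ℕ) (X : ℕ → Finset (Pt k)) (i : ℕ)
    (b : ℕ → ℕ) (h : ℕ) : Prop :=
  ∀ j ∈ S, j ≠ i → (∀ t < h, b t ≠ j) → thr < d.dist (grow X i b h) (X j)

theorem Cascade.congr {d : Linkage k} {thr : ℝ} {S : Finset ℕ} {X : ℕ → Finset (Pt k)} {i : ℕ}
    {b b' : ℕ → ℕ} {h : ℕ} (c : d.Cascade thr S X i b h) (e : ∀ t < h, b t = b' t) :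
    d.Cascade thr S X i b' h where
  mem s hs := e s hs ▸ c.mem s hs
  ne s hs := e s hs ▸ c.ne s hs
  inj s hs t ht := by rw [← e s hs, ← e t (by omega)]; exact c.inj s hs t ht
  le_thr s hs := by
    rw [← grow_congr fun t ht => e t (by omega), ← e s hs]; exact c.le_thr s hs
  nearest s hs j hj hji hb := by
    rw [← grow_congr fun t ht => e t (by omega), ← e s hs]
    exact c.nearest s hs j hj hji fun t ht => by rw [e t (by omega)]; exact hb t ht

/-- The number of consecutive merges of a cascade in which its cluster must grow by a certain
factor. -/
def runNum (K k l : ℕ) : ℕ := packNum K k l (3 * K) + 1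

/-- In `runNum` consecutive merges the size grows by a factor `1 + 1 / growthNum`. -/
def growthNum (K k l : ℕ) : ℕ := 2 * (2 * runNum K k l) ^ (2 * K)

/-- A bound for the number of merges of a cascade. -/
def lengthNum (K k l : ℕ) : ℕ := runNum K k l * (growthNum K k l * l)

/-- A bound for the distance that a cluster moves in a cascade, in units of `L`. -/
def moveNum (K k l : ℕ) : ℕ := (2 * lengthNum K k l) ^ (2 * K) * 2

/-- The radius, in units of `L`, that decides which cascades may run in parallel. -/
def radiusNum (K k l : ℕ) : ℕ := 3 * K ^ 2 * moveNum K k l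

section

variable {d : Linkage k} {K : ℕ} {P : Finset (Pt k)} {L thr : ℝ} {S : Finset ℕ}
  {X : ℕ → Finset (Pt k)} {i : ℕ} {b : ℕ → ℕ} {h : ℕ}

theorem Clustering.grow_nonempty (hX : d.Clustering P L S X) (hi : i ∈ S) (s : ℕ) :
    (grow X i b s).Nonempty :=
  (hX.nonempty i hi).mono (grow_mono (Nat.zero_le s))

theorem Cascade.disjoint (c : d.Cascade thr S X i b h) (hX : d.Clustering P L S X) (hi : i ∈ S)
    {s j : ℕ} (hs : s ≤ h) (hj : j ∈ S) (hji : j ≠ i) (hb : ∀ t < s, b t ≠ j) :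
    Disjoint (grow X i b s) (X j) := by
  rw [Finset.disjoint_left]
  intro u hu huj
  rw [mem_grow] at hu
  rcases hu with h1 | ⟨t, ht, h1⟩
  · exact Finset.disjoint_left.1 (hX.disjoint i hi j hj hji.symm) h1 huj
  · exact Finset.disjoint_left.1
      (hX.disjoint (b t) (c.mem t (by omega)) j hj (hb t ht)) h1 huj

theorem Cascade.disjoint_next (c : d.Cascade thr S X i b h) (hX : d.Clustering P L S X)
    (hi : i ∈ S) {s : ℕ} (hs : s < h) : Disjoint (grow X i b s) (X (b s)) :=
  c.disjoint hX hi hs.le (c.mem s hs) (c.ne s hs) fun t ht => c.inj s hs t ht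

theorem Cascade.subset (c : d.Cascade thr S X i b h) (hX : d.Clustering P L S X) (hi : i ∈ S)
    {s : ℕ} (hs : s ≤ h) : grow X i b s ⊆ P := by
  intro u hu
  rcases mem_grow.1 hu with h1 | ⟨t, ht, h1⟩
  exacts [hX.subset i hi h1, hX.subset _ (c.mem t (by omega)) h1]

theorem Cascade.card_succ (c : d.Cascade thr S X i b h) (hX : d.Clustering P L S X)
    (hi : i ∈ S) {s : ℕ} (hs : s < h) :
    (grow X i b (s + 1)).card = (grow X i b s).card + (X (b s)).card := by
  rw [grow, Finset.card_union_of_disjoint (c.disjoint_next hX hi hs)]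

theorem Cascade.off_succ_le (c : d.Cascade thr S X i b h) (hd : d.WellBehaved K)
    (hX : d.Clustering P L S X) (hi : i ∈ S) {s : ℕ} (hs : s < h) :
    d.off (grow X i b s) (grow X i b (s + 1)) ≤
      ((X (b s)).card : ℝ) / ((grow X i b s).card + (X (b s)).card) * thr := by
  rw [off_comm]
  refine (d.off_le_dist _ _).trans ?_
  rw [grow]
  refine (hd.weightStable _ _ (hX.grow_nonempty hi s) (hX.nonempty _ (c.mem s hs))
    (c.disjoint_next hX hi hs)).trans ?_
  gcongr
  exact c.le_thr s hs

theorem Cascade.off_succ_le_thr (c : d.Cascade thr S X i b h) (hd : d.WellBehaved K)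
    (hX : d.Clustering P L S X) (hi : i ∈ S) {s : ℕ} (hs : s < h) :
    d.off (grow X i b s) (grow X i b (s + 1)) ≤ thr := by
  refine (c.off_succ_le hd hX hi hs).trans ?_
  have h0 : 0 ≤ thr := (d.nonneg _ _).trans (c.le_thr s hs)
  refine mul_le_of_le_one_left h0 (div_le_one_of_le₀ ?_ (by positivity))
  have : (0 : ℝ) ≤ (grow X i b s).card := by positivity
  linarith

/-- In `runNum` consecutive merges the cluster grows by the factor `1 + 1 / growthNum`: otherwise
weight-stability keeps it in place up to `L`, so that all the merged clusters, which are pairwise at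
least `L` apart, are within `3 K L`, in contradiction to packability. -/
theorem Cascade.growth (c : d.Cascade thr S X i b h) (hd : d.WellBehaved K)
    (hX : d.Clustering P L S X) (hi : i ∈ S) (hL : 0 < L) (hthr : thr ≤ 2 * L) {s : ℕ}
    (hs : s + runNum K k (lg P.card) ≤ h) :
    (growthNum K k (lg P.card) + 1) * (grow X i b s).card ≤
      growthNum K k (lg P.card) * (grow X i b (s + runNum K k (lg P.card))).card := by
  set l := lg P.card
  set r := runNum K k l with hr
  set x := growthNum K k l with hx
  set Y := grow X i b with hY
  have hK := hd.one_le
  by_contra hcon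
  push Not at hcon
  have hcard : ∀ s t, s ≤ t → (Y s).card ≤ (Y t).card := fun s t hst =>
    Finset.card_le_card (grow_mono hst)
  have hne : ∀ s, (Y s).Nonempty := fun s => hX.grow_nonempty hi s
  have hr1 : 1 ≤ r := by rw [hr, runNum]; omega
  have hx1 : 0 < x := by rw [hx, growthNum]; positivity
  have hxR : (0 : ℝ) < x := by exact_mod_cast hx1
  have hx' : (((2 * r) ^ (2 * K) : ℕ) : ℝ) = x / 2 := by
    rw [hx, growthNum]; push_cast; ring
  have hstep : ∀ t, s ≤ t → t < s + r → d.off (Y t) (Y (t + 1)) ≤ 2 * L / x := by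
    intro t ht ht'
    have h1 := c.off_succ_le hd hX hi (s := t) (by omega)
    refine h1.trans ?_
    have h2 := c.card_succ hX hi (s := t) (by omega)
    have h3 := hcard s t ht
    have h4 := hcard (t + 1) (s + r) (by omega)
    have h5 : x * (X (b t)).card ≤ (Y t).card + (X (b t)).card := by
      have : x * (X (b t)).card + x * (Y s).card ≤ x * (Y (s + r)).card := by
        rw [← mul_add]; apply Nat.mul_le_mul_left
        rw [← hY] at h2; omega
      have h6 : (x + 1) * (Y s).card = x * (Y s).card + (Y s).card := by ring
      omega
    have h6 : (x : ℝ) * (X (b t)).card ≤ (Y t).card + (X (b t)).card := by exact_mod_cast h5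
    have h7 : (0 : ℝ) < (Y t).card + (X (b t)).card := by
      have : (0 : ℝ) < (Y t).card := by exact_mod_cast (hne t).card_pos
      positivity
    rw [div_mul_eq_mul_div, div_le_div_iff₀ h7 hxR]
    have h8 : ((X (b t)).card : ℝ) * thr ≤ (X (b t)).card * (2 * L) := by gcongr
    nlinarith
  have hnear : ∀ t, s ≤ t → t < s + r → d.dist (Y s) (X (b t)) ≤ (3 * K : ℕ) * L := by
    intro t ht ht'
    have h1 := off_chain_le (N := r) hK hd.approxTriangle (by positivity) hr1 hne hcard hstep
      le_rfl ht
      (by omega) (by omega)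
    rw [hx'] at h1
    have h2 : (x / 2 * (2 * L / x) : ℝ) = L := by field_simp
    rw [h2] at h1
    have h3 := off_triangle hK hd.approxTriangle (hne s) (hne t)
      (hX.nonempty _ (c.mem t (by omega)))
      ((min_le_left _ _).trans (hcard s t ht))
    have h4 : d.off (Y t) (X (b t)) ≤ 2 * L :=
      (d.off_le_dist _ _).trans ((c.le_thr t (by omega)).trans hthr)
    rw [off_of_ne] at h3
    · calc _ ≤ _ := h3
        _ ≤ K * (L + 2 * L) := by gcongr
        _ = _ := by push_cast; ring
    · intro e
      have := (c.disjoint_next hX hi (s := t) (by omega)).mono_left (grow_mono ht)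
      rw [← hY, e, Finset.disjoint_self_iff_empty] at this
      exact (hX.nonempty _ (c.mem t (by omega))).ne_empty this
  have hinj : Set.InjOn b (Finset.Ico s (s + r)) := by
    intro t ht t' ht' e
    simp only [Finset.coe_Ico, Set.mem_Ico] at ht ht'
    rcases Nat.lt_trichotomy t t' with h1 | h1 | h1
    exacts [absurd e (c.inj t' (by omega) t h1), h1, absurd e.symm (c.inj t (by omega) t' h1)]
  have h1 := (hX.mono (S' := (Finset.Ico s (s + r)).image b) (by
      intro j hj
      rw [Finset.mem_image] at hj
      obtain ⟨t, ht, rfl⟩ := hj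
      rw [Finset.mem_Ico] at ht
      exact c.mem t (by omega))).card_le hd hL (hne s) (c.subset hX hi (by omega))
      (q := 3 * K) (by omega) (by
        intro j hj
        rw [Finset.mem_image] at hj
        obtain ⟨t, ht, rfl⟩ := hj
        rw [Finset.mem_Ico] at ht
        exact hnear t ht.1 ht.2)
  rw [Finset.card_image_of_injOn hinj, Nat.card_Ico] at h1
  have h2 : r = packNum K k (lg P.card) (3 * K) + 1 := rfl
  omega

theorem two_mul_pow_le_succ_pow (x : ℕ) (hx : 1 ≤ x) : 2 * x ^ x ≤ (x + 1) ^ x := by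
  have h := one_add_mul_le_pow (a := (1 : ℝ) / x) (by have : (0:ℝ) ≤ 1 / x := by positivity
                                                      linarith) x
  have hx' : (0 : ℝ) < x := by exact_mod_cast hx
  have h1 : (1 : ℝ) + x * (1 / x) = 2 := by field_simp; norm_num
  rw [h1] at h
  have h2 : ((2 * x ^ x : ℕ) : ℝ) ≤ ((x + 1) ^ x : ℕ) := by
    push_cast
    calc (2 : ℝ) * x ^ x ≤ (1 + 1 / x) ^ x * x ^ x := by gcongr
      _ = (x + 1) ^ x := by rw [← mul_pow]; congr 1; field_simp
  exact_mod_cast h2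

/-- With `x = growthNum` and `x l` runs of `runNum` merges, the size would grow at least by the
factor `(1 + 1 / x) ^ (x l) ≥ 2 ^ l`, which exceeds the number of points. -/
theorem Cascade.length_lt (c : d.Cascade thr S X i b h) (hd : d.WellBehaved K)
    (hX : d.Clustering P L S X) (hi : i ∈ S) (hL : 0 < L) (hthr : thr ≤ 2 * L) :
    h < lengthNum K k (lg P.card) := by
  by_contra hcon
  push Not at hcon
  set l := lg P.card with hl
  set r := runNum K k l with hr
  set x := growthNum K k l with hx
  have hx1 : 0 < x := by rw [hx, growthNum, runNum]; positivity
  -- the growth factor of `j` runs, cleared of denominators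
  have key : ∀ j, j * r ≤ h → (x + 1) ^ j ≤ x ^ j * (grow X i b (j * r)).card := by
    intro j
    induction j with
    | zero => intro _; simpa using (hX.grow_nonempty hi _).card_pos
    | succ j ih =>
      intro hj
      have e : (j + 1) * r = j * r + r := by ring
      have h1 := ih (by omega)
      have h2 := c.growth hd hX hi hL hthr (s := j * r) (by rw [← hl, ← hr]; omega)
      rw [← hl, ← hr, ← hx, ← e] at h2
      calc (x + 1) ^ (j + 1) = (x + 1) ^ j * (x + 1) := pow_succ _ _
        _ ≤ x ^ j * (grow X i b (j * r)).card * (x + 1) := by gcongr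
        _ = x ^ j * ((x + 1) * (grow X i b (j * r)).card) := by ring
        _ ≤ x ^ j * (x * (grow X i b ((j + 1) * r)).card) := by gcongr
        _ = _ := by ring
  have hle : x * l * r ≤ h := by rw [mul_comm]; exact hcon
  have h1 := key (x * l) hle
  have h2 := Finset.card_le_card (c.subset hX hi hle)
  have h3 : 2 ^ l * x ^ (x * l) ≤ (x + 1) ^ (x * l) := by
    rw [pow_mul, pow_mul, ← mul_pow]
    exact Nat.pow_le_pow_left (two_mul_pow_le_succ_pow x hx1) _
  have h4 : P.card < 2 ^ l := by
    have h5 := le_two_pow_clog P.card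
    have h6 : 2 ^ l = 2 * 2 ^ Nat.clog 2 P.card := by rw [hl, lg, pow_succ]; ring
    have h7 : 0 < 2 ^ Nat.clog 2 P.card := by positivity
    omega
  have h8 : 2 ^ l * x ^ (x * l) ≤ P.card * x ^ (x * l) := by
    calc _ ≤ _ := h3.trans h1
      _ ≤ x ^ (x * l) * P.card := by gcongr
      _ = _ := mul_comm _ _
  have h9 : 0 < x ^ (x * l) := by positivity
  have := Nat.le_of_mul_le_mul_right h8 h9
  omega

/-- The cluster of a cascade stays within `moveNum * L`. -/
theorem Cascade.off_le (c : d.Cascade thr S X i b h) (hd : d.WellBehaved K)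
    (hX : d.Clustering P L S X) (hi : i ∈ S) (hL : 0 < L) (hthr : thr ≤ 2 * L) {s : ℕ}
    (hs : s ≤ h) : d.off (X i) (grow X i b s) ≤ moveNum K k (lg P.card) * L := by
  have hlen := c.length_lt hd hX hi hL hthr
  have h1 := off_chain_le (Y := grow X i b) (l := 0) (n := h) (e := 2 * L) (a := 0) (b := s)
    (N := lengthNum K k (lg P.card)) hd.one_le hd.approxTriangle (by positivity) (by omega)
    (fun s => hX.grow_nonempty hi s) (fun s t hst => Finset.card_le_card (grow_mono hst))
    (fun s _ hs' => (c.off_succ_le_thr hd hX hi hs').trans hthr) le_rfl (by omega) hs (by omega)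
  refine h1.trans (le_of_eq ?_)
  unfold moveNum; push_cast; ring

end

end Linkage

/-! ### Separating moduli -/

/-- A modulus that separates `i` from at most `N` other numbers below `2 ^ l` need not be larger
than `2 (l N + 1)`: otherwise the product of the differences is divisible by every prime power in
that range, hence by a central binomial coefficient larger than itself. -/
theorem exists_separating_modulus {n l N i : ℕ} (hn : n ≤ 2 ^ l) (hi : i < n) (F : Finset ℕ)
    (hF : ∀ j ∈ F, j < n ∧ j ≠ i) (hN : F.card ≤ N) :
    ∃ m, 1 ≤ m ∧ m ≤ 2 * (l * N + 1) ∧ ∀ j ∈ F, i % m ≠ j % m := by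
  by_contra hcon
  push Not at hcon
  set t := l * N + 1 with ht
  set Z : ℕ := ∏ j ∈ F, ((j : ℤ) - i).natAbs with hZ
  have hpos : ∀ j ∈ F, 0 < ((j : ℤ) - i).natAbs := by
    intro j hj
    have := (hF j hj).2
    omega
  have hZ0 : Z ≠ 0 := (Finset.prod_pos hpos).ne'
  have hdvd : ∀ m, 1 ≤ m → m ≤ 2 * t → m ∣ Z := by
    intro m h1 h2
    obtain ⟨j, hj, hm⟩ := hcon m h1 h2
    have h3 : (m : ℤ) ∣ (j : ℤ) - i := Nat.modEq_iff_dvd.1 hm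
    exact (Int.natCast_dvd.1 h3).trans (Finset.dvd_prod_of_mem _ hj)
  -- a prime power that divides the central binomial coefficient is at most `2 * t`
  have hcb : Nat.centralBinom t ∣ Z := by
    rw [← Nat.factorization_prime_le_iff_dvd (Nat.centralBinom_ne_zero t) hZ0]
    intro p hp
    have h1 : p ^ (Nat.centralBinom t).factorization p ≤ 2 * t := by
      rw [Nat.centralBinom]
      exact Nat.pow_factorization_choose_le (by omega)
    have h2 := hdvd _ (Nat.one_le_pow _ _ hp.pos) h1
    exact (hp.pow_dvd_iff_le_factorization hZ0).1 h2
  have h1 : Z ≤ 2 ^ (l * N) := by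
    calc Z ≤ ∏ _j ∈ F, 2 ^ l := by
          apply Finset.prod_le_prod'
          intro j hj
          have := (hF j hj).1
          omega
      _ = 2 ^ (l * F.card) := by rw [Finset.prod_const, pow_mul]
      _ ≤ _ := Nat.pow_le_pow_right (by norm_num) (by gcongr)
  have h2 := Nat.le_of_dvd (Nat.pos_of_ne_zero hZ0) hcb
  -- `Z ≤ 2 ^ (t - 1)`, whereas the central binomial coefficient is at least `4 ^ t / (2 t)`, hence
  -- at least `2 ^ t`
  have h3 := Nat.four_pow_le_two_mul_self_mul_centralBinom t (by omega)
  have h4 : 2 * t ≤ 2 ^ t := by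
    rw [ht, pow_succ, mul_comm]
    have := Nat.lt_two_pow_self (n := l * N)
    omega
  have h5 : 4 ^ t = 2 ^ t * 2 ^ t := by rw [show 4 = 2 * 2 by norm_num, mul_pow]
  have h6 : 2 ^ t * 2 ^ t ≤ 2 ^ t * Nat.centralBinom t := by
    rw [← h5]; exact h3.trans (by gcongr)
  have h7 := Nat.le_of_mul_le_mul_left h6 (by positivity)
  have h8 : 2 ^ t = 2 * 2 ^ (l * N) := by rw [ht, pow_succ]; ring
  have h9 : 0 < 2 ^ (l * N) := by positivity
  omega

/-! ### Stages: cascades that do not interact -/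

namespace Linkage

variable {k : ℕ}

/-- The slots `i` and `c` are equal, or their clusters are within `R`. -/
def Near (d : Linkage k) (R : ℝ) (X : ℕ → Finset (Pt k)) (i c : ℕ) : Prop :=
  i = c ∨ d.dist (X i) (X c) ≤ R

section

variable {d : Linkage k} {K : ℕ} {P : Finset (Pt k)} {L thr : ℝ} {S : Finset ℕ}
  {X : ℕ → Finset (Pt k)} {i : ℕ} {b : ℕ → ℕ} {h : ℕ}

theorem Clustering.near_of_off (hX : d.Clustering P L S X) {R : ℝ} {i c : ℕ} (hi : i ∈ S)
    (hc : c ∈ S) (h : d.off (X i) (X c) ≤ R) : d.Near R X i c := by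
  by_cases e : i = c
  · exact Or.inl e
  · exact Or.inr (by rwa [off_of_ne d (hX.ne hi hc e)] at h)

theorem Near.off_le {R : ℝ} (hR : 0 ≤ R) {i c : ℕ} (h : d.Near R X i c) :
    d.off (X i) (X c) ≤ R := by
  rcases h with rfl | h
  exacts [by rwa [off_self], (d.off_le_dist _ _).trans h]

theorem two_le_moveNum {K : ℕ} {l : ℕ} (hl : 1 ≤ l) : 2 ≤ moveNum K k l := by
  have : 0 < (2 * lengthNum K k l) ^ (2 * K) := by
    have : 0 < lengthNum K k l := by unfold lengthNum growthNum runNum; positivity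
    positivity
  unfold moveNum; omega

theorem one_le_lg (n : ℕ) : 1 ≤ lg n := by unfold lg; omega

/-- A cluster that comes within `thr` of a growing cluster was near its seed in the beginning,
because the growing cluster has not moved far. -/
theorem Cascade.near_of_le (c : d.Cascade thr S X i b h) (hd : d.WellBehaved K)
    (hX : d.Clustering P L S X) (hi : i ∈ S) (hL : 0 < L) (hthr : thr ≤ 2 * L) {s j : ℕ}
    (hs : s ≤ h) (hj : j ∈ S) (hle : d.dist (grow X i b s) (X j) ≤ thr) :
    d.Near (radiusNum K k (lg P.card) * L) X i j := by
  have hK := hd.one_le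
  apply hX.near_of_off hi hj
  have h1 := c.off_le hd hX hi hL hthr hs
  have h2 := off_triangle hK hd.approxTriangle (hX.nonempty i hi) (hX.grow_nonempty (b := b) hi s)
    (hX.nonempty j hj) ((min_le_left _ _).trans (Finset.card_le_card (grow_mono (Nat.zero_le s))))
  have h3 : d.off (grow X i b s) (X j) ≤ 2 * L := (d.off_le_dist _ _).trans (hle.trans hthr)
  have h4 : (2 : ℝ) ≤ moveNum K k (lg P.card) := by
    exact_mod_cast two_le_moveNum (one_le_lg _)
  have hK' : (1 : ℝ) ≤ K := by exact_mod_cast hK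
  set E : ℝ := ((moveNum K k (lg P.card) : ℕ) : ℝ)
  calc d.off (X i) (X j) ≤ K * (E * L + 2 * L) := h2.trans (by gcongr)
    _ ≤ K * (E * L + E * L) := by gcongr
    _ = (2 * K * 1) * (E * L) := by ring
    _ ≤ (3 * K * K) * (E * L) := by gcongr; norm_num
    _ = _ := by rw [radiusNum]; push_cast; ring

/-- Two growing clusters that come within `thr` of each other have seeds that were near each other
in the beginning. -/
theorem Cascade.near_of_le' (c : d.Cascade thr S X i b h) {i' : ℕ} {b' : ℕ → ℕ} {h' : ℕ}
    (c' : d.Cascade thr S X i' b' h') (hd : d.WellBehaved K)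
    (hX : d.Clustering P L S X) (hi : i ∈ S) (hi' : i' ∈ S) (hL : 0 < L) (hthr : thr ≤ 2 * L)
    {s s' : ℕ} (hs : s ≤ h) (hs' : s' ≤ h')
    (hle : d.dist (grow X i b s) (grow X i' b' s') ≤ thr) :
    d.Near (radiusNum K k (lg P.card) * L) X i i' := by
  have hK := hd.one_le
  apply hX.near_of_off hi hi'
  have h1 := c.off_le hd hX hi hL hthr hs
  have h1' := c'.off_le hd hX hi' hL hthr hs'
  rw [off_comm] at h1'
  have h2 := off_triangle hK hd.approxTriangle (hX.nonempty i hi) (hX.grow_nonempty (b := b) hi s)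
    (hX.nonempty i' hi') ((min_le_left _ _).trans (Finset.card_le_card (grow_mono (Nat.zero_le s))))
  have h2' := off_triangle hK hd.approxTriangle (hX.grow_nonempty (b := b) hi s)
    (hX.grow_nonempty (b := b') hi' s') (hX.nonempty i' hi')
    ((min_le_right _ _).trans (Finset.card_le_card (grow_mono (Nat.zero_le s'))))
  have h3 : d.off (grow X i b s) (grow X i' b' s') ≤ 2 * L :=
    (d.off_le_dist _ _).trans (hle.trans hthr)
  have h4 : (2 : ℝ) ≤ moveNum K k (lg P.card) := by
    exact_mod_cast two_le_moveNum (one_le_lg _)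
  have hK' : (1 : ℝ) ≤ K := by exact_mod_cast hK
  set E : ℝ := ((moveNum K k (lg P.card) : ℕ) : ℝ)
  calc d.off (X i) (X i') ≤ K * (E * L + K * (2 * L + E * L)) :=
        h2.trans (by gcongr; exact h2'.trans (by gcongr))
    _ ≤ K * (K * (E * L) + K * (E * L + E * L)) := by
        have h5 : E * L ≤ K * (E * L) := le_mul_of_one_le_left (by positivity) hK'
        have h6 : 2 * L + E * L ≤ E * L + E * L := by gcongr
        exact mul_le_mul_of_nonneg_left (add_le_add h5
          (mul_le_mul_of_nonneg_left h6 (by positivity))) (by positivity)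
    _ = _ := by rw [radiusNum]; push_cast; ring

end

/-- The data of one stage: complete cascades of the slots `i ∈ T` that start from the same
clustering, where no cluster is near two slots of `T`. -/
structure Stage (d : Linkage k) (R thr : ℝ) (S : Finset ℕ) (X : ℕ → Finset (Pt k)) (T : Finset ℕ)
    (b : ℕ → ℕ → ℕ) (h : ℕ → ℕ) : Prop where
  subset : T ⊆ S
  length_zero : ∀ i, i ∉ T → h i = 0
  cascade : ∀ i ∈ T, d.Cascade thr S X i (b i) (h i)
  done : ∀ i ∈ T, d.CascadeDone thr S X i (b i) (h i)
  not_near : ∀ i ∈ T, ∀ j ∈ T, i ≠ j → ∀ c ∈ S, d.Near R X i c → d.Near R X j c → False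

open scoped Classical in
/-- The slots that remain after a stage. -/
noncomputable def remaining (S : Finset ℕ) (b : ℕ → ℕ → ℕ) (h : ℕ → ℕ) : Finset ℕ :=
  S.filter fun j => ∀ i, ∀ s < h i, b i s ≠ j

/-- The clusters after a stage. -/
noncomputable def after (X : ℕ → Finset (Pt k)) (b : ℕ → ℕ → ℕ) (h : ℕ → ℕ) (j : ℕ) :
    Finset (Pt k) :=
  grow X j (b j) (h j)

section

variable {d : Linkage k} {K : ℕ} {P : Finset (Pt k)} {L thr : ℝ} {S : Finset ℕ}
  {X : ℕ → Finset (Pt k)} {T : Finset ℕ} {b : ℕ → ℕ → ℕ} {h : ℕ → ℕ}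

theorem mem_remaining {j : ℕ} : j ∈ remaining S b h ↔ j ∈ S ∧ ∀ i, ∀ s < h i, b i s ≠ j := by
  simp [remaining]

theorem Stage.mem_of_lt {R : ℝ} (g : d.Stage R thr S X T b h) {i s : ℕ} (hs : s < h i) : i ∈ T := by
  by_contra hi
  rw [g.length_zero i hi] at hs
  omega

theorem Stage.after_of_notMem {R : ℝ} (g : d.Stage R thr S X T b h) {i : ℕ} (hi : i ∉ T) :
    after X b h i = X i := by
  rw [after, g.length_zero i hi, grow]

/-- A cluster that is absorbed by a cascade is near its seed. -/
theorem Stage.near_next (hd : d.WellBehaved K) (hX : d.Clustering P L S X) (hL : 0 < L)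
    (hthr : thr ≤ 2 * L) (g : d.Stage (radiusNum K k (lg P.card) * L) thr S X T b h)
    {i s : ℕ} (hs : s < h i) : d.Near (radiusNum K k (lg P.card) * L) X i (b i s) :=
  have hi := g.mem_of_lt hs
  (g.cascade i hi).near_of_le hd hX (g.subset hi) hL hthr hs.le ((g.cascade i hi).mem s hs)
    ((g.cascade i hi).le_thr s hs)

/-- The seeds of a stage are not absorbed by its cascades. -/
theorem Stage.next_notMem (hd : d.WellBehaved K) (hX : d.Clustering P L S X) (hL : 0 < L)
    (hthr : thr ≤ 2 * L) (g : d.Stage (radiusNum K k (lg P.card) * L) thr S X T b h)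
    {i s : ℕ} (hs : s < h i) : b i s ∉ T := fun hb =>
  have hi := g.mem_of_lt hs
  g.not_near i hi _ hb ((g.cascade i hi).ne s hs).symm _ (g.subset hb)
    (g.near_next hd hX hL hthr hs) (Or.inl rfl)

/-- No cluster is absorbed by two cascades of a stage. -/
theorem Stage.next_ne (hd : d.WellBehaved K) (hX : d.Clustering P L S X) (hL : 0 < L)
    (hthr : thr ≤ 2 * L) (g : d.Stage (radiusNum K k (lg P.card) * L) thr S X T b h)
    {i s i' s' : ℕ} (hs : s < h i) (hs' : s' < h i') (hne : i ≠ i') : b i s ≠ b i' s' := fun e =>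
  have hi := g.mem_of_lt hs
  g.not_near i hi i' (g.mem_of_lt hs') hne _ ((g.cascade i hi).mem s hs)
    (g.near_next hd hX hL hthr hs) (by rw [e]; exact g.near_next hd hX hL hthr hs')

/-- Clusters of different cascades of a stage are farther than `thr` from each other at all times,
even if the cascades have advanced by different numbers of merges. -/
theorem Stage.lt_dist (hd : d.WellBehaved K) (hX : d.Clustering P L S X) (hL : 0 < L)
    (hthr : thr ≤ 2 * L) (g : d.Stage (radiusNum K k (lg P.card) * L) thr S X T b h)
    {i s i' s' : ℕ} (hi : i ∈ T) (hi' : i' ∈ T) (hs : s ≤ h i) (hs' : s' ≤ h i') (hne : i ≠ i') :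
    thr < d.dist (grow X i (b i) s) (grow X i' (b i') s') := by
  by_contra hcon
  exact g.not_near i hi i' hi' hne i' (g.subset hi')
    ((g.cascade i hi).near_of_le' (g.cascade i' hi') hd hX (g.subset hi) (g.subset hi') hL hthr
      hs hs' (not_lt.1 hcon)) (Or.inl rfl)

/-- After a stage, a cluster that took part in it is farther than `thr` from all others. -/
theorem Stage.lt_dist_after (hd : d.WellBehaved K) (hX : d.Clustering P L S X) (hL : 0 < L)
    (hthr : thr ≤ 2 * L) (g : d.Stage (radiusNum K k (lg P.card) * L) thr S X T b h)
    {i j : ℕ} (hi : i ∈ T) (hj : j ∈ remaining S b h) (hne : i ≠ j) :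
    thr < d.dist (after X b h i) (after X b h j) := by
  rw [mem_remaining] at hj
  by_cases hjT : j ∈ T
  · exact g.lt_dist hd hX hL hthr hi hjT le_rfl le_rfl hne
  · rw [g.after_of_notMem hjT]
    exact g.done i hi j hj.1 hne.symm (hj.2 i)

/-- The clusters stay at least `L` apart, although linkage values may decrease in merges: a cascade
only ends when nothing is left within `thr`, clusters of different cascades are far from each other,
and the remaining pairs have not changed. -/
theorem Stage.clustering_after (hd : d.WellBehaved K) (hX : d.Clustering P L S X) (hL : 0 < L)
    (hLt : L ≤ thr) (hthr : thr ≤ 2 * L)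
    (g : d.Stage (radiusNum K k (lg P.card) * L) thr S X T b h) :
    d.Clustering P L (remaining S b h) (after X b h) where
  nonempty i hi := hX.grow_nonempty (mem_remaining.1 hi).1 _
  subset i hi := by
    by_cases hT : i ∈ T
    · exact (g.cascade i hT).subset hX (g.subset hT) le_rfl
    · rw [g.after_of_notMem hT]; exact hX.subset i (mem_remaining.1 hi).1
  disjoint i hi j hj hij := by
    rw [mem_remaining] at hi hj
    rw [Finset.disjoint_left]
    intro u hu hu'
    have aux : ∀ i' ∈ S, ∀ j' ∈ S, i' ≠ j' → u ∈ X i' → u ∈ X j' → False :=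
      fun i' hi' j' hj' hne h1 h2 => Finset.disjoint_left.1 (hX.disjoint i' hi' j' hj' hne) h1 h2
    have hm : ∀ {i s}, s < h i → b i s ∈ S := fun hs => (g.cascade _ (g.mem_of_lt hs)).mem _ hs
    rcases mem_grow.1 hu with h1 | ⟨t, ht, h1⟩ <;> rcases mem_grow.1 hu' with h2 | ⟨t', ht', h2⟩
    · exact aux i hi.1 j hj.1 hij h1 h2
    · exact aux i hi.1 _ (hm ht') (hi.2 j t' ht').symm h1 h2
    · exact aux _ (hm ht) j hj.1 (hj.2 i t ht) h1 h2
    · exact aux _ (hm ht) _ (hm ht') (g.next_ne hd hX hL hthr ht ht' hij) h1 h2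
  le_dist i hi j hj hij := by
    by_cases hT : i ∈ T
    · exact hLt.trans (g.lt_dist_after hd hX hL hthr hT hj hij).le
    by_cases hT' : j ∈ T
    · rw [d.symm]; exact hLt.trans (g.lt_dist_after hd hX hL hthr hT' hi hij.symm).le
    rw [g.after_of_notMem hT, g.after_of_notMem hT']
    exact hX.le_dist i (mem_remaining.1 hi).1 j (mem_remaining.1 hj).1 hij

/-- The first cascades of a stage also form a stage. -/
theorem Stage.restrict {R : ℝ} (g : d.Stage R thr S X T b h) (m : ℕ) :
    d.Stage R thr S X (T.filter (· < m)) b (fun i => if i < m then h i else 0) where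
  subset := (Finset.filter_subset _ _).trans g.subset
  length_zero i hi := by
    by_cases hm : i < m
    · simp only [hm, if_true]
      exact g.length_zero i fun hT => hi (Finset.mem_filter.2 ⟨hT, hm⟩)
    · simp [hm]
  cascade i hi := by
    rw [Finset.mem_filter] at hi
    simpa only [hi.2, if_true] using g.cascade i hi.1
  done i hi := by
    rw [Finset.mem_filter] at hi
    simpa only [hi.2, if_true] using g.done i hi.1
  not_near i hi j hj :=
    g.not_near i (Finset.mem_filter.1 hi).1 j (Finset.mem_filter.1 hj).1

end

open scoped Classical in
/-- The merges `l` lead from the clustering `X i`, `i ∈ S` to the clustering `X' i`, `i ∈ S'` in a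
`c`-approximate HAC: in front of every continuation from the latter they give one from the former.
-/
def Reach (d : Linkage k) (c : ℝ) (S : Finset ℕ) (X : ℕ → Finset (Pt k))
    (l : List (Finset (Pt k) × Finset (Pt k))) (S' : Finset ℕ) (X' : ℕ → Finset (Pt k)) : Prop :=
  ∀ l', ApproxHACFrom d c (S'.image X') l' → ApproxHACFrom d c (S.image X) (l ++ l')

theorem Reach.refl (d : Linkage k) (c : ℝ) (S : Finset ℕ) (X : ℕ → Finset (Pt k)) :
    d.Reach c S X [] S X := fun _ h => h

theorem Reach.trans {d : Linkage k} {c : ℝ} {S S' S'' : Finset ℕ}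
    {X X' X'' : ℕ → Finset (Pt k)} {l l' : List (Finset (Pt k) × Finset (Pt k))}
    (h : d.Reach c S X l S' X') (h' : d.Reach c S' X' l' S'' X'') :
    d.Reach c S X (l ++ l') S'' X'' := fun m hm => by
  rw [List.append_assoc]; exact h _ (h' _ hm)

open scoped Classical in
theorem Reach.congr_right {d : Linkage k} {c : ℝ} {S S' : Finset ℕ}
    {X X' X'' : ℕ → Finset (Pt k)} {l : List (Finset (Pt k) × Finset (Pt k))}
    (h : d.Reach c S X l S' X') (e : ∀ i ∈ S', X' i = X'' i) : d.Reach c S X l S' X'' :=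
  fun m hm => h m (by rwa [Finset.image_congr (g := X'') (fun i hi => e i hi)])

open scoped Classical in
/-- Replacing two clusters by a new one amounts to assigning the new one to the first slot and
removing the second. -/
theorem image_merge {S : Finset ℕ} {X : ℕ → Finset (Pt k)} {i j : ℕ} (hi : i ∈ S) (hj : j ∈ S)
    (hij : i ≠ j) (hinj : ∀ a ∈ S, ∀ b ∈ S, a ≠ b → X a ≠ X b) (Z : Finset (Pt k)) :
    insert Z (((S.image X).erase (X i)).erase (X j)) =
      (S.erase j).image (Function.update X i Z) := by
  ext W
  simp only [Finset.mem_insert, Finset.mem_erase, Finset.mem_image]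
  constructor
  · rintro (rfl | ⟨h1, h2, a, ha, rfl⟩)
    · exact ⟨i, ⟨hij, hi⟩, by simp⟩
    · have h3 : a ≠ i := fun e => h2 (by rw [e])
      have h4 : a ≠ j := fun e => h1 (by rw [e])
      exact ⟨a, ⟨h4, ha⟩, by simp [h3]⟩
  · rintro ⟨a, ⟨h1, h2⟩, rfl⟩
    by_cases h3 : a = i
    · left; simp [h3]
    · right
      rw [Function.update_of_ne h3]
      exact ⟨hinj a h2 j hj h1, hinj a h2 i hi h3, a, h2, rfl⟩

section

variable {d : Linkage k} {K : ℕ} {P : Finset (Pt k)} {L thr : ℝ} {S : Finset ℕ}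
  {X : ℕ → Finset (Pt k)}

open scoped Classical in
/-- A cascade is a run of an approximate HAC: all pairs without the growing cluster stay at least
`L` apart, and the growing cluster is always merged with a nearest one. -/
theorem Cascade.reach {c : ℝ} (hc : 1 ≤ c) (hX : d.Clustering P L S X) (hthr : thr ≤ c * L)
    {i : ℕ} (hi : i ∈ S) {b : ℕ → ℕ} {h : ℕ} (hb : d.Cascade thr S X i b h) :
    ∀ s ≤ h, d.Reach c S X ((List.range s).map fun t => (grow X i b t, X (b t)))
      (S.filter fun j => ∀ t < s, b t ≠ j) (Function.update X i (grow X i b s)) := by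
  intro s
  induction s with
  | zero =>
    intro _ l' hl'
    simpa [grow] using hl'
  | succ s ih =>
    intro hs
    rw [List.range_succ, List.map_append]
    refine (ih (by omega)).trans ?_
    intro l' hl'
    set S₁ := S.filter fun j => ∀ t < s, b t ≠ j with hS₁
    set Y := Function.update X i (grow X i b s) with hY
    have hiS : i ∈ S₁ := Finset.mem_filter.2 ⟨hi, fun t ht => hb.ne t (by omega)⟩
    have hbS : b s ∈ S₁ := Finset.mem_filter.2 ⟨hb.mem s hs, fun t ht => hb.inj s hs t ht⟩
    have hbi : b s ≠ i := hb.ne s hs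
    have hYi : Y i = grow X i b s := by simp [hY]
    have hYj : ∀ j, j ≠ i → Y j = X j := fun j hj => by simp [hY, hj]
    have hdisj : ∀ j ∈ S₁, j ≠ i → Disjoint (grow X i b s) (X j) := fun j hj hji => by
      rw [hS₁, Finset.mem_filter] at hj
      exact hb.disjoint hX hi (by omega) hj.1 hji hj.2
    have hnej : ∀ j ∈ S₁, j ≠ i → grow X i b s ≠ X j := fun j hj hji e => by
      have := hdisj j hj hji
      rw [e, Finset.disjoint_self_iff_empty] at this
      exact (hX.nonempty j (Finset.mem_filter.1 hj).1).ne_empty this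
    have hinj : ∀ j ∈ S₁, ∀ j' ∈ S₁, j ≠ j' → Y j ≠ Y j' := by
      intro j hj j' hj' hne
      by_cases h1 : j = i
      · subst h1; rw [hYi, hYj j' hne.symm]; exact hnej j' hj' hne.symm
      by_cases h2 : j' = i
      · subst h2; rw [hYi, hYj j hne]; exact (hnej j hj hne).symm
      rw [hYj j h1, hYj j' h2]
      exact hX.ne (Finset.mem_filter.1 hj).1 (Finset.mem_filter.1 hj').1 hne
    simp only [List.map_cons, List.map_nil, List.cons_append, List.nil_append]
    have h1 : (grow X i b s, X (b s)) = (Y i, Y (b s)) := by rw [hYi, hYj _ hbi]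
    rw [h1]
    refine ApproxHACFrom.merge _ _ _ _ (Finset.mem_image_of_mem _ hiS)
      (Finset.mem_image_of_mem _ hbS) (hinj i hiS _ hbS hbi.symm) ?_ ?_
    · have hc0 : 0 ≤ c := by linarith
      have hle := hb.le_thr s hs
      have key : ∀ j ∈ S₁, j ≠ i → d.dist (Y i) (Y (b s)) ≤ c * d.dist (Y i) (Y j) := by
        intro j hj hji
        rw [hYi, hYj j hji, hYj _ hbi]
        rw [hS₁, Finset.mem_filter] at hj
        exact (hb.nearest s hs j hj.1 hji hj.2).trans
          (le_mul_of_one_le_left (d.nonneg _ _) hc)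
      simp only [Finset.mem_image, forall_exists_index, and_imp]
      rintro _ j hj rfl _ j' hj' rfl hne
      have hjj : j ≠ j' := fun e => hne (by rw [e])
      by_cases h1 : j = i
      · subst h1; exact key j' hj' hjj.symm
      by_cases h2 : j' = i
      · subst h2; rw [d.symm (Y j)]; exact key j hj hjj
      rw [hYi, hYj _ hbi, hYj j h1, hYj j' h2]
      exact (hle.trans hthr).trans (mul_le_mul_of_nonneg_left
        (hX.le_dist j (Finset.mem_filter.1 hj).1 j' (Finset.mem_filter.1 hj').1 hjj) hc0)
    · rw [image_merge hiS hbS hbi.symm hinj]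
      convert hl' using 2
      · rw [hYi, hYj _ hbi, hY, Function.update_idem]; rfl
      · ext j
        simp only [hS₁, Finset.mem_erase, Finset.mem_filter]
        constructor
        · rintro ⟨h2, h3, h4⟩
          refine ⟨h3, fun t ht => ?_⟩
          rcases Nat.lt_or_ge t s with h5 | h5
          · exact h4 t h5
          · rw [show t = s by omega]; exact h2.symm
        · rintro ⟨h2, h3⟩
          exact ⟨(h3 s (by omega)).symm, h2, fun t ht => h3 t (by omega)⟩

open scoped Classical in
/-- The parallel cascades of a stage can be carried out one after the other, in the order of the
slots; `f` lists the merges in this order. -/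
theorem Stage.reach {c : ℝ} (hc : 1 ≤ c) (hd : d.WellBehaved K) (hX : d.Clustering P L S X)
    (hL : 0 < L) (hLt : L ≤ thr) (hthr : thr ≤ 2 * L) (hthr' : thr ≤ c * L) {T : Finset ℕ}
    {b : ℕ → ℕ → ℕ} {h : ℕ → ℕ}
    (g : d.Stage (radiusNum K k (lg P.card) * L) thr S X T b h)
    (f : ℕ → Finset (Pt k) × Finset (Pt k))
    (hf : ∀ i, ∀ s < h i, f (∑ j ∈ Finset.range i, h j + s) = (grow X i (b i) s, X (b i s)))
    (m : ℕ) :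
    d.Reach c S X ((List.range (∑ j ∈ Finset.range m, h j)).map f)
      (remaining S b fun i => if i < m then h i else 0)
      (after X b fun i => if i < m then h i else 0) := by
  induction m with
  | zero =>
    intro l' hl'
    have e : (after X b fun _ => 0) = X := rfl
    simpa [remaining, e] using hl'
  | succ m ih =>
    rw [Finset.sum_range_succ, List.range_add, List.map_append, List.map_map]
    refine ih.trans ?_
    set h₁ : ℕ → ℕ := fun i => if i < m then h i else 0 with hh₁
    have g₁ := g.restrict m
    have hX₁ := g₁.clustering_after hd hX hL hLt hthr
    rw [← hh₁] at g₁ hX₁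
    have hh : ∀ i, i ≠ m → (if i < m + 1 then h i else 0) = h₁ i := by
      intro i hi
      rw [hh₁]
      have : i < m + 1 ↔ i < m := by omega
      simp only [this]
    have hm₁ : h₁ m = 0 := by simp [hh₁]
    have hrem : remaining S b (fun i => if i < m + 1 then h i else 0) =
        (remaining S b h₁).filter fun j => ∀ t < h m, b m t ≠ j := by
      ext j
      simp only [mem_remaining, Finset.mem_filter]
      constructor
      · rintro ⟨h1, h2⟩
        refine ⟨⟨h1, fun i s hs => ?_⟩, fun t ht => h2 m t (by simpa using ht)⟩
        refine h2 i s ?_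
        rcases eq_or_ne i m with rfl | h3
        · rw [hm₁] at hs; omega
        · rwa [hh i h3]
      · rintro ⟨⟨h1, h2⟩, h3⟩
        refine ⟨h1, fun i s hs => ?_⟩
        rcases eq_or_ne i m with rfl | h4
        · exact h3 s (by simpa using hs)
        · rw [hh i h4] at hs; exact h2 i s hs
    have haft : ∀ j, j ≠ m → after X b (fun i => if i < m + 1 then h i else 0) j =
        after X b h₁ j := fun j hj => by rw [after, after, hh j hj]
    have haftm : after X b (fun i => if i < m + 1 then h i else 0) m = grow X m (b m) (h m) := by
      simp [after]
    by_cases hm : m ∈ T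
    · have hcm := g.cascade m hm
      have hmS : m ∈ remaining S b h₁ := mem_remaining.2 ⟨g.subset hm, fun i s hs e => by
        have hs' : s < h i := by
          rw [hh₁] at hs; dsimp only at hs; split_ifs at hs
          exacts [hs, absurd hs (by omega)]
        exact g.next_notMem hd hX hL hthr hs' (e ▸ hm)⟩
      have hlt : ∀ {i s}, s < h₁ i → i < m ∧ s < h i := by
        intro i s hs
        rw [hh₁] at hs; dsimp only at hs; split_ifs at hs with h1
        exacts [⟨h1, hs⟩, absurd hs (by omega)]
      have hgrow : ∀ s ≤ h m, grow (after X b h₁) m (b m) s = grow X m (b m) s := by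
        intro s
        induction s with
        | zero => intro _; change after X b h₁ m = X m; rw [after, hm₁]; rfl
        | succ s ihs =>
          intro hs
          rw [grow, ihs (by omega), grow, g₁.after_of_notMem]
          intro hb
          exact g.next_notMem hd hX hL hthr hs (Finset.mem_filter.1 hb).1
      have hnext : ∀ s < h m, after X b h₁ (b m s) = X (b m s) := fun s hs =>
        g₁.after_of_notMem fun hb => g.next_notMem hd hX hL hthr hs (Finset.mem_filter.1 hb).1
      have hcas : d.Cascade thr (remaining S b h₁) (after X b h₁) m (b m) (h m) :=
        { mem := fun s hs => mem_remaining.2 ⟨hcm.mem s hs, fun i s' hs' =>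
            g.next_ne hd hX hL hthr (hlt hs').2 hs (by have := (hlt hs').1; omega)⟩
          ne := hcm.ne
          inj := hcm.inj
          le_thr := fun s hs => by
            rw [hgrow s hs.le, hnext s hs]; exact hcm.le_thr s hs
          nearest := fun s hs j hj hji hjb => by
            rw [hgrow s hs.le, hnext s hs]
            by_cases hjT : j ∈ T
            · refine (hcm.le_thr s hs).trans (g.lt_dist hd hX hL hthr hm hjT hs.le ?_ hji.symm).le
              rw [hh₁]; dsimp only; split_ifs <;> omega
            · rw [g₁.after_of_notMem fun hb => hjT (Finset.mem_filter.1 hb).1]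
              exact hcm.nearest s hs j (mem_remaining.1 hj).1 hji hjb }
      have hr := hcas.reach hc hX₁ hthr' hmS (h m) le_rfl
      rw [hrem]
      have hlist : (List.range (h m)).map (f ∘ fun x => ∑ j ∈ Finset.range m, h j + x) =
          (List.range (h m)).map fun t =>
            (grow (after X b h₁) m (b m) t, after X b h₁ (b m t)) := by
        apply List.map_congr_left
        intro t ht
        rw [List.mem_range] at ht
        rw [Function.comp_apply, hf m t ht, hgrow t ht.le, hnext t ht]
      rw [hlist]
      refine hr.congr_right fun j _ => ?_
      by_cases hj : j = m
      · subst hj; rw [Function.update_self, haftm, hgrow _ le_rfl]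
      · rw [Function.update_of_ne hj, haft j hj]
    · have h0 := g.length_zero m hm
      rw [hrem, h0]
      simp only [List.range_zero, List.map_nil, Nat.not_lt_zero, false_imp_iff, implies_true,
        Finset.filter_true]
      refine (Reach.refl d c _ _).congr_right fun j _ => ?_
      by_cases hj : j = m
      · subst hj; rw [haftm, h0, after, hm₁]
      · rw [haft j hj]

end

end Linkage

/-! ### A scale-free bound for the diameter -/

namespace Linkage

variable {k : ℕ}

/-- `D` bounds the linkage values of disjoint clusters of at most `s` points of `P`. -/
def DiamLE (d : Linkage k) (P : Finset (Pt k)) (s : ℕ) (D : ℝ) : Prop :=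
  ∀ A B : Finset (Pt k), A.Nonempty → B.Nonempty → A ⊆ P → B ⊆ P → Disjoint A B →
    A.card ≤ s → B.card ≤ s → d.dist A B ≤ D

section

variable {d : Linkage k} {K : ℕ} {P : Finset (Pt k)} {s : ℕ} {D : ℝ}

open scoped Classical in
/-- A cluster of at most `2 s` points is the union of two halves. By weight-stability it is near the
first one, which in turn is within `D` of any other point. -/
theorem DiamLE.point_le (hd : d.WellBehaved K) (hD : 0 ≤ D) (h : d.DiamLE P s D) (hs : 1 ≤ s)
    {Z : Finset (Pt k)} (hZ : Z.Nonempty) (hZP : Z ⊆ P) (hZs : Z.card ≤ 2 * s) {r : Pt k}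
    (hr : r ∈ P) (hrZ : r ∉ Z) : d.dist Z {r} ≤ 2 * K * D := by
  have hK : (1 : ℝ) ≤ K := by exact_mod_cast hd.one_le
  have hrP : {r} ⊆ P := Finset.singleton_subset_iff.2 hr
  rcases Nat.lt_or_ge s Z.card with h1 | h1
  · obtain ⟨Z₁, hZ₁, hc⟩ := Finset.exists_subset_card_eq h1.le
    have hc2 : (Z \ Z₁).card ≤ s := by rw [Finset.card_sdiff_of_subset hZ₁]; omega
    have hc3 : 0 < (Z \ Z₁).card := by rw [Finset.card_sdiff_of_subset hZ₁]; omega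
    have hne₁ : Z₁.Nonempty := Finset.card_pos.1 (by omega)
    have hne₂ : (Z \ Z₁).Nonempty := Finset.card_pos.1 hc3
    have h2 : d.dist Z Z₁ ≤ D := by
      have h3 := hd.weightStable Z₁ (Z \ Z₁) hne₁ hne₂ Finset.disjoint_sdiff
      rw [Finset.union_sdiff_of_subset hZ₁] at h3
      refine h3.trans ?_
      refine (mul_le_of_le_one_left (d.nonneg _ _) (div_le_one_of_le₀ ?_ (by positivity))).trans
        (h _ _ hne₁ hne₂ (hZ₁.trans hZP) (Finset.sdiff_subset.trans hZP) Finset.disjoint_sdiff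
          hc.le hc2)
      have : (0 : ℝ) ≤ Z₁.card := by positivity
      linarith
    have h4 : d.dist Z₁ {r} ≤ D := h _ _ hne₁ (Finset.singleton_nonempty r) (hZ₁.trans hZP) hrP
      (Finset.disjoint_singleton_right.2 fun e => hrZ (hZ₁ e)) hc.le (by simpa using hs)
    have h5 := hd.approxTriangle Z Z₁ {r} hZ hne₁ (Finset.singleton_nonempty r)
      (by rw [Finset.card_singleton]; exact (min_le_right _ _).trans hne₁.card_pos)
    calc _ ≤ K * (D + D) := h5.trans (by gcongr)
      _ = _ := by ring
  · have h2 := h Z {r} hZ (Finset.singleton_nonempty r) hZP hrP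
      (Finset.disjoint_singleton_right.2 hrZ) h1 (by simpa using hs)
    nlinarith

open scoped Classical in
/-- Adding a point to a cluster of at most `2 s` points moves it only by a multiple of `D`. -/
theorem DiamLE.off_insert_le (hd : d.WellBehaved K) (hD : 0 ≤ D) (h : d.DiamLE P s D) (hs : 1 ≤ s)
    {Z : Finset (Pt k)} (hZ : Z.Nonempty) (hZP : Z ⊆ P) (hZs : Z.card ≤ 2 * s) {r : Pt k}
    (hr : r ∈ P) (hrZ : r ∉ Z) : d.off Z (insert r Z) ≤ 2 * K * D := by
  rw [off_comm]
  refine (d.off_le_dist _ _).trans ?_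
  have h1 := hd.weightStable Z {r} hZ (Finset.singleton_nonempty r)
    (Finset.disjoint_singleton_right.2 hrZ)
  rw [Finset.union_comm, ← Finset.insert_eq] at h1
  refine h1.trans ((mul_le_of_le_one_left (d.nonneg _ _) (div_le_one_of_le₀ ?_
    (by positivity))).trans (h.point_le hd hD hs hZ hZP hZs hr hrZ))
  have : (0 : ℝ) ≤ Z.card := by positivity
  linarith

open scoped Classical in
/-- Adding `2 ^ j` points to a cluster: insert half of them first, and apply the triangle inequality
to the intermediate cluster. Adding the points one by one would lose a factor in every step. -/
theorem DiamLE.off_subset_le (hd : d.WellBehaved K) (hD : 0 ≤ D) (h : d.DiamLE P s D) (hs : 1 ≤ s)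
    (j : ℕ) : ∀ X Y : Finset (Pt k), X.Nonempty → X ⊆ Y → Y ⊆ P → Y.card ≤ 2 * s →
      (Y \ X).card ≤ 2 ^ j → d.off X Y ≤ (2 * K) ^ j * (2 * K * D) := by
  induction j with
  | zero =>
    intro X Y hX hXY hYP hYs hc
    rw [pow_zero, one_mul]
    rcases (Y \ X).eq_empty_or_nonempty with h1 | ⟨r, hr⟩
    · rw [Finset.sdiff_eq_empty_iff_subset] at h1
      rw [hXY.antisymm h1, off_self]; positivity
    · have h2 : Y \ X = {r} := by
        refine (Finset.eq_of_subset_of_card_le (Finset.singleton_subset_iff.2 hr) ?_).symm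
        simpa using hc
      have h3 : Y = insert r X := by
        rw [Finset.insert_eq, ← h2, Finset.sdiff_union_of_subset hXY]
      rw [Finset.mem_sdiff] at hr
      rw [h3]
      exact h.off_insert_le hd hD hs hX (hXY.trans hYP) ((Finset.card_le_card hXY).trans hYs)
        (hYP hr.1) hr.2
  | succ j ih =>
    intro X Y hX hXY hYP hYs hc
    rw [Finset.card_sdiff_of_subset hXY, pow_succ] at hc
    obtain ⟨Z, hXZ, hZY, hZ⟩ := Finset.exists_subsuperset_card_eq hXY
      (n := min Y.card (X.card + 2 ^ j)) (by have := Finset.card_le_card hXY; omega) (by omega)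
    have h1 := ih X Z hX hXZ (hZY.trans hYP) ((Finset.card_le_card hZY).trans hYs)
      (by rw [Finset.card_sdiff_of_subset hXZ]; omega)
    have h2 := ih Z Y (hX.mono hXZ) hZY hYP hYs
      (by rw [Finset.card_sdiff_of_subset hZY]; omega)
    have h3 := off_triangle hd.one_le hd.approxTriangle hX (hX.mono hXZ) (hX.mono hXY)
      ((min_le_left _ _).trans (Finset.card_le_card hXZ))
    calc _ ≤ K * ((2 * K) ^ j * (2 * K * D) + (2 * K) ^ j * (2 * K * D)) :=
          h3.trans (by gcongr)
      _ = _ := by ring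

open scoped Classical in
/-- Exchanging `2 ^ j` points of a cluster for the same number of other points: exchange half of
them first. The intermediate cluster has the same size, as the triangle inequality requires. -/
theorem DiamLE.off_swap_le (hd : d.WellBehaved K) (hD : 0 ≤ D) (h : d.DiamLE P s D) (hs : 1 ≤ s)
    (j : ℕ) : ∀ X Y : Finset (Pt k), X.Nonempty → X ⊆ P → Y ⊆ P → X.card = Y.card →
      X.card ≤ 2 * s → (X \ Y).card ≤ 2 ^ j →
      d.off X Y ≤ (2 * K) ^ j * ((2 * K) * (2 * K * D)) := by
  induction j with
  | zero =>
    intro X Y hX hXP hYP hXY hXs hc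
    rw [pow_zero, one_mul]
    have hY : Y.Nonempty := Finset.card_pos.1 (hXY ▸ hX.card_pos)
    have hcYX : (Y \ X).card = (X \ Y).card := (Finset.card_sdiff_comm hXY).symm
    rcases (X \ Y).eq_empty_or_nonempty with h1 | ⟨x, hx⟩
    · rw [Finset.sdiff_eq_empty_iff_subset] at h1
      rw [Finset.eq_of_subset_of_card_le h1 hXY.ge, off_self]; positivity
    · have h2 : X \ Y = {x} := by
        refine (Finset.eq_of_subset_of_card_le (Finset.singleton_subset_iff.2 hx) ?_).symm
        simpa using hc
      have h3 : (Y \ X).card = 1 := by rw [hcYX, h2]; simp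
      obtain ⟨y, hy⟩ := Finset.card_eq_one.1 h3
      have hxm := hx
      have hym : y ∈ Y \ X := by rw [hy]; simp
      rw [Finset.mem_sdiff] at hxm hym
      have h4 : insert y X = X ∪ Y := by
        rw [Finset.insert_eq, ← hy, Finset.sdiff_union_self_eq_union, Finset.union_comm]
      have h5 : insert x Y = X ∪ Y := by
        rw [Finset.insert_eq, ← h2, Finset.sdiff_union_self_eq_union]
      have h6 := h.off_insert_le hd hD hs hX hXP hXs (hYP hym.1) hym.2
      have h7 := h.off_insert_le hd hD hs hY hYP (hXY ▸ hXs) (hXP hxm.1) hxm.2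
      rw [h4] at h6
      rw [h5, off_comm] at h7
      have h8 := off_triangle hd.one_le hd.approxTriangle hX (hX.mono Finset.subset_union_left) hY
        ((min_le_left _ _).trans (Finset.card_le_card (Finset.subset_union_left (s₂ := Y))))
      calc _ ≤ K * (2 * K * D + 2 * K * D) := h8.trans (by gcongr)
        _ = _ := by ring
  | succ j ih =>
    intro X Y hX hXP hYP hXY hXs hc
    have hcYX : (Y \ X).card = (X \ Y).card := (Finset.card_sdiff_comm hXY).symm
    have hY : Y.Nonempty := Finset.card_pos.1 (hXY ▸ hX.card_pos)
    rw [pow_succ] at hc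
    obtain ⟨U, hU, hUc⟩ := Finset.exists_subset_card_eq
      (min_le_left (X \ Y).card (2 ^ j))
    obtain ⟨V, hV, hVc⟩ := Finset.exists_subset_card_eq
      (show min (X \ Y).card (2 ^ j) ≤ (Y \ X).card by omega)
    set Z := (X \ U) ∪ V with hZ
    have hUX : U ⊆ X := hU.trans Finset.sdiff_subset
    have hVY : V ⊆ Y := hV.trans Finset.sdiff_subset
    have hVX : Disjoint (X \ U) V := by
      rw [Finset.disjoint_left]; intro u hu hv
      exact (Finset.mem_sdiff.1 (hV hv)).2 (Finset.mem_sdiff.1 hu).1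
    have hZc : Z.card = X.card := by
      rw [hZ, Finset.card_union_of_disjoint hVX, Finset.card_sdiff_of_subset hUX]
      have := Finset.card_le_card hUX
      omega
    have hZP : Z ⊆ P := Finset.union_subset (Finset.sdiff_subset.trans hXP) (hVY.trans hYP)
    have hZne : Z.Nonempty := Finset.card_pos.1 (hZc ▸ hX.card_pos)
    have e1 : X \ Z ⊆ U := by
      intro u hu
      simp only [hZ, Finset.mem_sdiff, Finset.mem_union, not_or, not_and, not_not] at hu
      exact hu.2.1 hu.1
    have e2 : Z \ Y ⊆ (X \ Y) \ U := by
      intro u hu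
      simp only [hZ, Finset.mem_sdiff, Finset.mem_union] at hu ⊢
      rcases hu with ⟨h1 | h1, h2⟩
      exacts [⟨⟨h1.1, h2⟩, h1.2⟩, absurd (hVY h1) h2]
    have h1 := ih X Z hX hXP hZP hZc.symm hXs ((Finset.card_le_card e1).trans (by omega))
    have h2 := ih Z Y hZne hZP hYP (hZc.trans hXY) (hZc ▸ hXs)
      ((Finset.card_le_card e2).trans (by rw [Finset.card_sdiff_of_subset hU]; omega))
    have h3 := off_triangle hd.one_le hd.approxTriangle hX hZne hY
      ((min_le_left _ _).trans hZc.ge)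
    calc _ ≤ K * ((2 * K) ^ j * ((2 * K) * (2 * K * D)) + (2 * K) ^ j * ((2 * K) * (2 * K * D))) :=
          h3.trans (by gcongr)
      _ = _ := by ring

open scoped Classical in
/-- If `A` has at most as many points as `B`, exchange all points of `A` for points of `B`, and then
add the other points of `B`. -/
theorem DiamLE.double (hd : d.WellBehaved K) (hD : 0 ≤ D) (h : d.DiamLE P s D) (hs : 1 ≤ s) :
    d.DiamLE P (2 * s) ((2 * K) ^ (lg P.card + 2) * D) := by
  have hK : (1 : ℝ) ≤ K := by exact_mod_cast hd.one_le
  have key : ∀ A B : Finset (Pt k), A.Nonempty → B.Nonempty → A ⊆ P → B ⊆ P → Disjoint A B →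
      A.card ≤ 2 * s → B.card ≤ 2 * s → A.card ≤ B.card →
      d.dist A B ≤ (2 * K) ^ (lg P.card + 2) * D := by
    intro A B hA hB hAP hBP hdis hAs hBs hAB
    have hne : A ≠ B := fun e => by
      rw [← e, Finset.disjoint_self_iff_empty] at hdis; exact hA.ne_empty hdis
    rw [← d.off_of_ne hne]
    obtain ⟨B', hB', hc⟩ := Finset.exists_subset_card_eq hAB
    have hB'ne : B'.Nonempty := Finset.card_pos.1 (hc ▸ hA.card_pos)
    have hcard : ∀ Z : Finset (Pt k), Z ⊆ P → Z.card ≤ 2 ^ Nat.clog 2 P.card := fun Z hZ =>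
      (Finset.card_le_card hZ).trans (le_two_pow_clog _)
    have h1 := h.off_swap_le hd hD hs (Nat.clog 2 P.card) A B' hA hAP (hB'.trans hBP) hc.symm hAs
      (hcard _ (Finset.sdiff_subset.trans hAP))
    have h2 := h.off_subset_le hd hD hs (Nat.clog 2 P.card) B' B hB'ne hB' hBP hBs
      (hcard _ (Finset.sdiff_subset.trans hBP))
    have h3 := off_triangle hd.one_le hd.approxTriangle hA hB'ne hB
      ((min_le_left _ _).trans hc.ge)
    set c := Nat.clog 2 P.card
    have h4 : (2 * K : ℝ) ^ c * (2 * K * D) ≤ (2 * K) ^ c * ((2 * K) * (2 * K * D)) := by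
      gcongr
      exact le_mul_of_one_le_left (by positivity) (by linarith)
    calc _ ≤ K * ((2 * K) ^ c * ((2 * K) * (2 * K * D)) + (2 * K) ^ c * (2 * K * D)) :=
          h3.trans (by gcongr)
      _ ≤ K * ((2 * K) ^ c * ((2 * K) * (2 * K * D)) + (2 * K) ^ c * ((2 * K) * (2 * K * D))) := by
          gcongr
      _ = (2 * K) ^ (c + 1 + 2) * D := by ring
      _ = _ := rfl
  intro A B hA hB hAP hBP hdis hAs hBs
  rcases le_total A.card B.card with h1 | h1
  · exact key A B hA hB hAP hBP hdis hAs hBs h1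
  · rw [d.symm]; exact key B A hB hA hBP hAP hdis.symm hBs hAs h1

/-- The linkage values of clusters exceed those of points by at most a quasipolynomial factor, by
doubling the sizes of the clusters `lg |P|` times. The bound does not depend on the scale of the
linkage function, so it applies to points at any distances. -/
theorem WellBehaved.dist_le (hd : d.WellBehaved K) (hD : 0 ≤ D)
    (h : ∀ u ∈ P, ∀ v ∈ P, u ≠ v → d.pt u v ≤ D) {A B : Finset (Pt k)} (hA : A.Nonempty)
    (hB : B.Nonempty) (hAP : A ⊆ P) (hBP : B ⊆ P) (hAB : Disjoint A B) :
    d.dist A B ≤ 2 ^ (2 * K * (lg P.card + 2) * lg P.card) * D := by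
  have hK := hd.one_le
  have h1 : d.DiamLE P 1 D := by
    intro A B hA hB hAP hBP hdis hA1 hB1
    obtain ⟨u, rfl⟩ := Finset.card_eq_one.1 (le_antisymm hA1 hA.card_pos)
    obtain ⟨v, rfl⟩ := Finset.card_eq_one.1 (le_antisymm hB1 hB.card_pos)
    rw [Finset.singleton_subset_iff] at hAP hBP
    exact h u hAP v hBP (by simpa using hdis)
  have h2 : ∀ j, d.DiamLE P (2 ^ j) ((2 ^ (2 * K * (lg P.card + 2) * j)) * D) := by
    intro j
    induction j with
    | zero => simpa using h1
    | succ j ih =>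
      have h3 := ih.double hd (by positivity) Nat.one_le_two_pow
      rw [← pow_succ'] at h3
      intro A B hA hB hAP hBP hdis hA1 hB1
      refine (h3 A B hA hB hAP hBP hdis hA1 hB1).trans ?_
      have h4 : ((2 * K : ℕ) : ℝ) ≤ (2 ^ (2 * K) : ℕ) := by
        exact_mod_cast Nat.lt_two_pow_self.le
      push_cast at h4
      calc _ ≤ ((2 : ℝ) ^ (2 * K)) ^ (lg P.card + 2) * (2 ^ (2 * K * (lg P.card + 2) * j) * D) := by
            gcongr
        _ = _ := by rw [← pow_mul, ← mul_assoc, ← pow_add]; ring_nf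
  have h5 : P.card ≤ 2 ^ lg P.card := (le_two_pow_clog _).trans
    (Nat.pow_le_pow_right (by norm_num) (by unfold lg; omega))
  exact h2 _ A B hA hB hAP hBP hAB ((Finset.card_le_card hAP).trans h5)
    ((Finset.card_le_card hBP).trans h5)

end

end Linkage

/-! ### Joins of stores -/

section priority

variable {α : Type} {m : ℕ} {x : α} {y : ℕ → α}

theorem priority_of_forall (h : ∀ i < m, y i = x) : priority m x y = x := by
  unfold priority
  rw [dif_neg]
  rintro ⟨i, hi, hne⟩
  exact hne (h i hi)

theorem priority_cases (m : ℕ) (x : α) (y : ℕ → α) :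
    (priority m x y = x ∧ ∀ i < m, y i = x) ∨ ∃ i < m, priority m x y = y i ∧ y i ≠ x := by
  classical
  unfold priority
  split_ifs with h
  · exact Or.inr ⟨_, (Nat.find_spec h).1, rfl, (Nat.find_spec h).2⟩
  · push Not at h
    exact Or.inl ⟨rfl, h⟩

theorem priority_of_owner {o : ℕ} (ho : o < m) (h : ∀ i < m, i ≠ o → y i = x) :
    priority m x y = y o := by
  rcases priority_cases m x y with ⟨h1, h2⟩ | ⟨i, hi, h1, h2⟩
  · rw [h1, h2 o ho]
  · rw [h1]
    by_contra hne
    exact h2 (h i hi fun e => hne (by rw [e]))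

end priority

section join

variable {k : ℕ} {σ : Store k} {a m : ℕ} {τ : ℕ → Store k}

theorem Store.join_nat_var : (σ.join a m τ).nat (a, 0, 0) = σ.nat (a, 0, 0) := by
  simp [Store.join]

theorem Store.join_nat {x : Addr} (hx : x ≠ (a, 0, 0)) :
    (σ.join a m τ).nat x = priority m (σ.nat x) fun i => (τ i).nat x := by
  simp [Store.join, hx]

theorem Store.join_nat_of_forall {x : Addr}
    (h : ∀ i < m, (τ i).nat x = (σ.thread a i).nat x) : (σ.join a m τ).nat x = σ.nat x := by
  by_cases hx : x = (a, 0, 0)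
  · rw [hx, join_nat_var]
  · rw [join_nat hx]
    refine priority_of_forall fun i hi => ?_
    rw [h i hi]; simp [Store.thread, hx]

theorem Store.join_nat_of_owner {x : Addr} (hx : x ≠ (a, 0, 0)) {o : ℕ} (ho : o < m)
    (h : ∀ i < m, i ≠ o → (τ i).nat x = (σ.thread a i).nat x) :
    (σ.join a m τ).nat x = (τ o).nat x := by
  rw [join_nat hx]
  refine priority_of_owner ho fun i hi hio => ?_
  rw [h i hi hio]; simp [Store.thread, hx]

theorem Store.join_nat_cases {x : Addr} (hx : x ≠ (a, 0, 0)) :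
    ((σ.join a m τ).nat x = σ.nat x ∧ ∀ i < m, (τ i).nat x = σ.nat x) ∨
      ∃ i < m, (σ.join a m τ).nat x = (τ i).nat x ∧ (τ i).nat x ≠ σ.nat x := by
  rw [join_nat hx]; exact priority_cases m _ _

theorem Store.join_real_of_forall {x : Addr} (h : ∀ i < m, (τ i).real x = σ.real x) :
    (σ.join a m τ).real x = σ.real x := priority_of_forall h

theorem Store.join_real_of_owner {x : Addr} {o : ℕ} (ho : o < m)
    (h : ∀ i < m, i ≠ o → (τ i).real x = σ.real x) : (σ.join a m τ).real x = (τ o).real x :=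
  priority_of_owner (y := fun i => (τ i).real x) ho h

theorem Store.join_clu_of_forall {x : Addr} (h : ∀ i < m, (τ i).clu x = σ.clu x) :
    (σ.join a m τ).clu x = σ.clu x := priority_of_forall h

theorem Store.join_clu_of_owner {x : Addr} {o : ℕ} (ho : o < m)
    (h : ∀ i < m, i ≠ o → (τ i).clu x = σ.clu x) : (σ.join a m τ).clu x = (τ o).clu x :=
  priority_of_owner (y := fun i => (τ i).clu x) ho h

end join

/-! ### Frames -/

/-- The stores differ at most in the natural-number arrays `N`, the real arrays `R` and the cluster
arrays `C`. -/
structure Frame {k : ℕ} (N R C : List ℕ) (σ σ' : Store k) : Prop where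
  nat : ∀ a, a ∉ N → ∀ i j, σ'.nat (a, i, j) = σ.nat (a, i, j)
  real : ∀ a, a ∉ R → ∀ i j, σ'.real (a, i, j) = σ.real (a, i, j)
  clu : ∀ a, a ∉ C → ∀ i j, σ'.clu (a, i, j) = σ.clu (a, i, j)

theorem Frame.refl {k : ℕ} (N R C : List ℕ) (σ : Store k) : Frame N R C σ σ :=
  ⟨fun _ _ _ _ => rfl, fun _ _ _ _ => rfl, fun _ _ _ _ => rfl⟩

theorem Frame.trans {k : ℕ} {N R C : List ℕ} {σ σ' σ'' : Store k} (h : Frame N R C σ σ')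
    (h' : Frame N R C σ' σ'') : Frame N R C σ σ'' :=
  ⟨fun a ha i j => (h'.nat a ha i j).trans (h.nat a ha i j),
    fun a ha i j => (h'.real a ha i j).trans (h.real a ha i j),
    fun a ha i j => (h'.clu a ha i j).trans (h.clu a ha i j)⟩

theorem Frame.mono {k : ℕ} {N R C N' R' C' : List ℕ} {σ σ' : Store k} (h : Frame N R C σ σ')
    (hN : N ⊆ N') (hR : R ⊆ R') (hC : C ⊆ C') : Frame N' R' C' σ σ' :=
  ⟨fun a ha => h.nat a fun e => ha (hN e), fun a ha => h.real a fun e => ha (hR e),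
    fun a ha => h.clu a fun e => ha (hC e)⟩

/-- The loop variable is not in the frame, since it gets its former content back. -/
theorem Frame.join {k : ℕ} {N R C : List ℕ} {σ : Store k} {a m : ℕ} {τ : ℕ → Store k}
    (h : ∀ i < m, Frame N R C (σ.thread a i) (τ i)) : Frame N R C σ (σ.join a m τ) :=
  ⟨fun a ha i j => Store.join_nat_of_forall fun t ht => (h t ht).nat a ha i j,
    fun a ha i j => Store.join_real_of_forall fun t ht => (h t ht).real a ha i j,
    fun a ha i j => Store.join_clu_of_forall fun t ht => (h t ht).clu a ha i j⟩

/-! ### Runs with bounds for work and depth -/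

/-- A program without loops and forks. -/
def Cmd.Straight : Cmd → Prop
  | .setNat _ _ => True
  | .setReal _ _ => True
  | .union _ _ _ => True
  | .linkage _ _ _ => True
  | .seq p q => p.Straight ∧ q.Straight
  | .ite _ p q => p.Straight ∧ q.Straight
  | .loop _ _ => False
  | .par _ _ _ => False

/-- An upper bound for the running time of a program without loops and forks. -/
def Cmd.size : Cmd → ℕ
  | .seq p q => p.size + q.size
  | .ite _ p q => 1 + max p.size q.size
  | _ => 1

open scoped Classical in
/-- The effect of a program without loops and forks. -/
noncomputable def Cmd.den {k : ℕ} (d : Linkage k) : Cmd → Store k → Store k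
  | .setNat x e, σ => { σ with nat := Function.update σ.nat (x.addr σ) (e.eval σ) }
  | .setReal x e, σ => { σ with real := Function.update σ.real (x.addr σ) (e.eval σ) }
  | .union x y z, σ =>
    { σ with clu := Function.update σ.clu (x.addr σ) (σ.clu (y.addr σ) ∪ σ.clu (z.addr σ)) }
  | .linkage x y z, σ =>
    { σ with
      real := Function.update σ.real (x.addr σ) (d.dist (σ.clu (y.addr σ)) (σ.clu (z.addr σ))) }
  | .seq p q, σ => q.den d (p.den d σ)
  | .ite b p q, σ => if b.holds σ then p.den d σ else q.den d σ
  | .loop _ _, σ => σ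
  | .par _ _ _, σ => σ

/-- A run with bounds for work and depth. -/
def Ev {k : ℕ} (d : Linkage k) (p : Cmd) (σ σ' : Store k) (W T : ℕ) : Prop :=
  ∃ w t, Exec d p σ σ' w t ∧ w ≤ W ∧ t ≤ T

/-- A run with bounds for work and depth that ends in a store with the property `Q`. -/
def Runs {k : ℕ} (d : Linkage k) (p : Cmd) (σ : Store k) (W T : ℕ) (Q : Store k → Prop) : Prop :=
  ∃ σ', Ev d p σ σ' W T ∧ Q σ'

section

variable {k : ℕ} {d : Linkage k} {p q : Cmd} {σ σ' : Store k} {W T W' T' : ℕ}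
  {Q Q' : Store k → Prop}

theorem Ev.mono (h : Ev d p σ σ' W T) (hW : W ≤ W') (hT : T ≤ T') : Ev d p σ σ' W' T' := by
  obtain ⟨w, t, h1, h2, h3⟩ := h
  exact ⟨w, t, h1, h2.trans hW, h3.trans hT⟩

theorem Runs.mono (h : Runs d p σ W T Q) (hW : W ≤ W') (hT : T ≤ T') : Runs d p σ W' T' Q := by
  obtain ⟨σ', h1, h2⟩ := h
  exact ⟨σ', h1.mono hW hT, h2⟩

theorem Runs.imp (h : Runs d p σ W T Q) (hQ : ∀ σ', Q σ' → Q' σ') : Runs d p σ W T Q' := by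
  obtain ⟨σ', h1, h2⟩ := h
  exact ⟨σ', h1, hQ σ' h2⟩

theorem Runs.seq (h : Runs d p σ W T fun σ₁ => Runs d q σ₁ W' T' Q) :
    Runs d (.seq p q) σ (W + W') (T + T') Q := by
  obtain ⟨σ₁, ⟨w, t, h1, h2, h3⟩, ⟨σ₂, ⟨w', t', h1', h2', h3'⟩, hQ⟩⟩ := h
  exact ⟨σ₂, ⟨_, _, Exec.seq h1 h1', add_le_add h2 h2', add_le_add h3 h3'⟩, hQ⟩

theorem Runs.ite {b : Cond} (h : b.holds σ → Runs d p σ W T Q)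
    (h' : ¬ b.holds σ → Runs d q σ W T Q) : Runs d (.ite b p q) σ (1 + W) (1 + T) Q := by
  by_cases hb : b.holds σ
  · obtain ⟨σ₁, ⟨w, t, h1, h2, h3⟩, hQ⟩ := h hb
    exact ⟨σ₁, ⟨_, _, Exec.iteTrue hb h1, by omega, by omega⟩, hQ⟩
  · obtain ⟨σ₁, ⟨w, t, h1, h2, h3⟩, hQ⟩ := h' hb
    exact ⟨σ₁, ⟨_, _, Exec.iteFalse hb h1, by omega, by omega⟩, hQ⟩

theorem Ev.of_straight (hp : p.Straight) : Ev d p σ (p.den d σ) p.size p.size := by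
  induction p generalizing σ with
  | setNat x e => exact ⟨1, 1, Exec.setNat σ x e, le_rfl, le_rfl⟩
  | setReal x e => exact ⟨1, 1, Exec.setReal σ x e, le_rfl, le_rfl⟩
  | union x y z => exact ⟨1, 1, Exec.union σ x y z, le_rfl, le_rfl⟩
  | linkage x y z => exact ⟨1, 1, Exec.linkage σ x y z, le_rfl, le_rfl⟩
  | seq p q ihp ihq =>
    obtain ⟨w, t, h1, h2, h3⟩ := ihp (σ := σ) hp.1
    obtain ⟨w', t', h1', h2', h3'⟩ := ihq (σ := p.den d σ) hp.2
    exact ⟨_, _, Exec.seq h1 h1', add_le_add h2 h2', add_le_add h3 h3'⟩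
  | ite b p q ihp ihq =>
    by_cases hb : b.holds σ
    · obtain ⟨w, t, h1, h2, h3⟩ := ihp (σ := σ) hp.1
      refine ⟨_, _, ?_, add_le_add le_rfl (h2.trans (le_max_left _ q.size)),
        add_le_add le_rfl (h3.trans (le_max_left _ q.size))⟩
      rw [Cmd.den, if_pos hb]
      exact Exec.iteTrue hb h1
    · obtain ⟨w, t, h1, h2, h3⟩ := ihq (σ := σ) hp.2
      refine ⟨_, _, ?_, add_le_add le_rfl (h2.trans (le_max_right p.size _)),
        add_le_add le_rfl (h3.trans (le_max_right p.size _))⟩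
      rw [Cmd.den, if_neg hb]
      exact Exec.iteFalse hb h1
  | loop b p _ => exact hp.elim
  | par a m p _ => exact hp.elim

theorem Runs.of_straight (hp : p.Straight) (hQ : Q (p.den d σ)) : Runs d p σ p.size p.size Q :=
  ⟨_, Ev.of_straight hp, hQ⟩

/-- A parallel loop runs if its threads do, each from its own copy of the store; the stores in which
they end are then joined. -/
theorem Ev.par {a : ℕ} {m : NatExp} (τ : ℕ → Store k)
    (h : ∀ i < m.eval σ, Ev d p (σ.thread a i) (τ i) W T) :
    Ev d (.par a m p) σ (σ.join a (m.eval σ) τ) (1 + m.eval σ * (1 + W))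
      (1 + Nat.clog 2 (m.eval σ) + T) := by
  classical
  choose! w t h1 h2 h3 using h
  refine ⟨_, _, Exec.par τ w t h1, ?_, ?_⟩
  · gcongr
    calc _ ≤ ∑ _i ∈ Finset.range (m.eval σ), (1 + W) :=
          Finset.sum_le_sum fun i hi => by
            have := h2 i (Finset.mem_range.1 hi)
            omega
      _ = _ := by simp
  · gcongr
    exact Finset.sup_le fun i hi => h3 i (Finset.mem_range.1 hi)

theorem Runs.par {a : ℕ} {m : NatExp} {Qt : ℕ → Store k → Prop}
    (h : ∀ i < m.eval σ, Runs d p (σ.thread a i) W T (Qt i))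
    (hQ : ∀ τ : ℕ → Store k, (∀ i < m.eval σ, Qt i (τ i)) → Q (σ.join a (m.eval σ) τ)) :
    Runs d (.par a m p) σ (1 + m.eval σ * (1 + W)) (1 + Nat.clog 2 (m.eval σ) + T) Q := by
  have : Nonempty (Store k) := ⟨σ⟩
  choose! τ h1 h2 using h
  exact ⟨_, Ev.par τ h1, hQ τ h2⟩

/-- The invariant `I f` has a fuel `f` that decreases in every iteration and thereby bounds the
number of iterations. -/
theorem Runs.loop {b : Cond} (I : ℕ → Store k → Prop)
    (step : ∀ f σ, I f σ → b.holds σ → Runs d p σ W T fun σ' => ∃ f' < f, I f' σ') :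
    ∀ f σ, I f σ → Runs d (.loop b p) σ (f * (1 + W) + 1) (f * (1 + T) + 1)
      fun σ' => ¬ b.holds σ' ∧ ∃ f', I f' σ' := by
  intro f
  induction f using Nat.strong_induction_on with
  | _ f ih =>
    intro σ hσ
    by_cases hb : b.holds σ
    · obtain ⟨σ₁, ⟨w, t, h1, h2, h3⟩, f', hf', hI⟩ := step f σ hσ hb
      obtain ⟨σ₂, ⟨w', t', h1', h2', h3'⟩, hQ⟩ := ih f' hf' σ₁ hI
      refine ⟨σ₂, ⟨_, _, Exec.loopStep hb h1 h1', ?_, ?_⟩, hQ⟩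
      · have : (f' + 1) * (1 + W) ≤ f * (1 + W) := Nat.mul_le_mul_right _ hf'
        rw [add_mul] at this; omega
      · have : (f' + 1) * (1 + T) ≤ f * (1 + T) := Nat.mul_le_mul_right _ hf'
        rw [add_mul] at this; omega
    · exact ⟨σ, ⟨_, _, Exec.loopDone hb, by omega, by omega⟩, hb, f, hσ⟩

end

/-! ### Doubling -/

/-- The expression for the cell `(a, 0, 0)`. -/
def sc (a : ℕ) : NatExp := .get a (.lit 0) (.lit 0)

/-- The cell `(a, 0, 0)`. -/
def scell (a : ℕ) : Cell := ⟨a, .lit 0, .lit 0⟩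

/-- The expression for the cell `(a, e, 0)`. -/
def vec (a : ℕ) (e : NatExp) : NatExp := .get a e (.lit 0)

/-- The cell `(a, e, 0)`. -/
def vcell (a : ℕ) (e : NatExp) : Cell := ⟨a, e, .lit 0⟩

/-- The program that changes nothing. -/
def skip : Cmd := .setNat (scell 0) (sc 0)

/-- In rounds `s = s₀, 2 s₀, 4 s₀, …`, while `s < n`, combine the cell `(8, j, 0)` with the cell
`(8, j - s, 0)` for all `j` with `s ≤ j < n`. -/
def doubling (s₀ : NatExp) (comb : Cmd) : Cmd :=
  .seq (.setNat (scell 15) s₀)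
    (.loop (.not (.natLe (sc 0) (sc 15)))
      (.seq (.par 22 (sc 0) (.ite (.natLe (sc 15) (sc 22)) comb skip))
        (.setNat (scell 15) (.add (sc 15) (sc 15)))))

section

variable {k : ℕ} {d : Linkage k}

@[simp] theorem sc_eval (σ : Store k) (a : ℕ) : (sc a).eval σ = σ.nat (a, 0, 0) := rfl
@[simp] theorem scell_addr (σ : Store k) (a : ℕ) : (scell a).addr σ = (a, 0, 0) := rfl
@[simp] theorem vec_eval (σ : Store k) (a : ℕ) (e : NatExp) :
    (vec a e).eval σ = σ.nat (a, e.eval σ, 0) := rfl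
@[simp] theorem vcell_addr (σ : Store k) (a : ℕ) (e : NatExp) :
    (vcell a e).addr σ = (a, e.eval σ, 0) := rfl
@[simp] theorem skip_den (σ : Store k) : skip.den d σ = σ := by
  simp [skip, Cmd.den]
theorem skip_straight : skip.Straight := trivial
theorem skip_size : skip.size = 1 := rfl

/-- The doubling loop computes a summary `G j (2 ^ e) v` of the entries `j, j - s₀, j - 2 s₀, …` if
two summaries of adjacent blocks can be combined by `op`. -/
theorem Runs.doubling {s₀ : NatExp} {comb : Cmd} (hcomb : comb.Straight) (hsize : comb.size ≤ 2)
    {op : ℕ → ℕ → ℕ} {G : ℕ → ℕ → ℕ → Prop} {σ : Store k} {n s : ℕ}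
    (hn : σ.nat (0, 0, 0) = n) (hn1 : 1 ≤ n) (hs₀ : s₀.eval σ = s) (hs1 : 1 ≤ s)
    (hop : ∀ ς : Store k, ς.real = σ.real → comb.den d ς =
      { ς with
        nat := Function.update ς.nat (8, ς.nat (22, 0, 0), 0)
          (op (ς.nat (8, ς.nat (22, 0, 0), 0))
            (ς.nat (8, ς.nat (22, 0, 0) - ς.nat (15, 0, 0), 0))) })
    (h0 : ∀ j < n, G j 1 (σ.nat (8, j, 0)))
    (h1 : ∀ j < n, ∀ c v v', c * s ≤ j → G j c v → G (j - c * s) c v' → G j (2 * c) (op v v'))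
    (h2 : ∀ j < n, ∀ c v, j < c * s → G j c v → G j (2 * c) v) :
    Runs d (doubling s₀ comb) σ (8 * n * lg n) (lg n * (lg n + 6)) fun σ' =>
      Frame [8, 15] [] [] σ σ' ∧ ∃ c, n ≤ c * s ∧ ∀ j < n, G j c (σ'.nat (8, j, 0)) := by
  have key := Runs.seq (d := d) (p := .setNat (scell 15) s₀)
    (q := .loop (.not (.natLe (sc 0) (sc 15)))
      (.seq (.par 22 (sc 0) (.ite (.natLe (sc 15) (sc 22)) comb skip))
        (.setNat (scell 15) (.add (sc 15) (sc 15)))))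
    (σ := σ) (W := 1) (T := 1)
    (W' := (lg n - 1) * (1 + (1 + n * (1 + 3) + 1)) + 1)
    (T' := (lg n - 1) * (1 + (1 + Nat.clog 2 n + 3 + 1)) + 1)
    (Q := fun σ' => Frame [8, 15] [] [] σ σ' ∧
      ∃ c, n ≤ c * s ∧ ∀ j < n, G j c (σ'.nat (8, j, 0))) ?_
  · refine key.mono ?_ ?_
    · obtain ⟨c, hc⟩ : ∃ c, lg n = c + 1 := ⟨_, rfl⟩
      rw [hc, Nat.add_sub_cancel]
      nlinarith [Nat.zero_le (c * n), Nat.mul_le_mul_left c hn1]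
    · have : Nat.clog 2 n = lg n - 1 := by unfold lg; omega
      rw [this]
      obtain ⟨c, hc⟩ : ∃ c, lg n = c + 1 := ⟨_, rfl⟩
      rw [hc, Nat.add_sub_cancel]
      nlinarith
  refine (Runs.of_straight (d := d) (p := .setNat (scell 15) s₀) trivial ?_)
  have hloop := Runs.loop (d := d) (b := .not (.natLe (sc 0) (sc 15)))
    (p := .seq (.par 22 (sc 0) (.ite (.natLe (sc 15) (sc 22)) comb skip))
        (.setNat (scell 15) (.add (sc 15) (sc 15))))
    (W := 1 + n * (1 + 3) + 1) (T := 1 + Nat.clog 2 n + 3 + 1)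
    (fun f σ' => Frame [8, 15] [] [] σ σ' ∧ ∃ e, σ'.nat (15, 0, 0) = 2 ^ e * s ∧
      e + f = Nat.clog 2 n ∧ ∀ j < n, G j (2 ^ e) (σ'.nat (8, j, 0))) ?_ (lg n - 1)
      (Cmd.den d (.setNat (scell 15) s₀) σ) ?_
  · refine hloop.imp ?_
    rintro σ' ⟨hb, f, hF, e, he, -, hG⟩
    refine ⟨hF, 2 ^ e, ?_, hG⟩
    simp only [Cond.holds, sc_eval, not_not] at hb
    rwa [hF.nat 0 (by simp), hn, he] at hb
  · rintro f σ₁ ⟨hF, e, he, hef, hG⟩ hb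
    have hn₁ : σ₁.nat (0, 0, 0) = n := by rw [hF.nat 0 (by simp), hn]
    simp only [Cond.holds, sc_eval, hn₁, he, not_le] at hb
    have hlt : e < Nat.clog 2 n := by
      rw [Nat.lt_clog_iff_pow_lt one_lt_two]
      exact (Nat.le_mul_of_pos_right _ hs1).trans_lt hb
    have hreal₁ : σ₁.real = σ.real := by
      funext ⟨a, i, j⟩; exact hF.real a (by simp) i j
    have hclu₁ : σ₁.clu = σ.clu := by
      funext ⟨a, i, j⟩; exact hF.clu a (by simp) i j
    refine Runs.seq (W := 1 + n * (1 + 3)) (T := 1 + Nat.clog 2 n + 3) ?_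
    have hpar := Runs.par (d := d) (a := 22) (m := sc 0) (σ := σ₁) (W := 3) (T := 3)
      (p := .ite (.natLe (sc 15) (sc 22)) comb skip)
      (Qt := fun j ς => ς = if 2 ^ e * s ≤ j then
          { (σ₁.thread 22 j) with
            nat := Function.update (σ₁.thread 22 j).nat (8, j, 0)
              (op (σ₁.nat (8, j, 0)) (σ₁.nat (8, j - 2 ^ e * s, 0))) }
        else σ₁.thread 22 j)
      (Q := fun σ₂ => Runs d (.setNat (scell 15) (.add (sc 15) (sc 15))) σ₂ 1 1 fun σ' => ∃ f' < f,
        Frame [8, 15] [] [] σ σ' ∧ ∃ e, σ'.nat (15, 0, 0) = 2 ^ e * s ∧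
      e + f' = Nat.clog 2 n ∧ ∀ j < n, G j (2 ^ e) (σ'.nat (8, j, 0))) ?_ ?_
    · simpa only [sc_eval, hn₁] using hpar
    · intro j hj
      refine (Runs.of_straight (d := d) (p := .ite (.natLe (sc 15) (sc 22)) comb skip)
        ⟨hcomb, skip_straight⟩ ?_).mono ?_ ?_
      · have h15 : (σ₁.thread 22 j).nat (15, 0, 0) = 2 ^ e * s := by
          simp [Store.thread, he]
        have h22 : (σ₁.thread 22 j).nat (22, 0, 0) = j := by simp [Store.thread]
        simp only [Cmd.den, Cond.holds, sc_eval, skip_den, h15, h22]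
        refine if_congr Iff.rfl ?_ rfl
        rw [hop _ (by simpa [Store.thread] using hreal₁), h15, h22]
        simp [Store.thread]
      all_goals
        simp only [Cmd.size, skip_size]; omega
    · intro τ hτ
      rw [sc_eval, hn₁] at hτ ⊢
      set σ₂ := σ₁.join 22 n τ with hσ₂
      have hreal : ∀ j < n, (τ j).real = σ₁.real := by
        intro j hj; rw [hτ j hj]; split_ifs <;> rfl
      have hclu : ∀ j < n, (τ j).clu = σ₁.clu := by
        intro j hj; rw [hτ j hj]; split_ifs <;> rfl
      have hnat : ∀ j < n, ∀ x : Addr, x ≠ (8, j, 0) → (τ j).nat x = (σ₁.thread 22 j).nat x := by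
        intro j hj x hx; rw [hτ j hj]; split_ifs
        · exact Function.update_of_ne hx _ _
        · rfl
      have hF₂ : Frame [8, 15] [] [] σ₁ σ₂ := Frame.join fun j hj =>
        ⟨fun a ha i i' => hnat j hj _ fun e => ha (by simp [(Prod.mk.inj e).1]),
          fun a ha i i' => by rw [hreal j hj]; rfl, fun a ha i i' => by rw [hclu j hj]; rfl⟩
      have h15 : σ₂.nat (15, 0, 0) = 2 ^ e * s := by
        rw [hσ₂, Store.join_nat_of_forall fun j hj => hnat j hj _ (by simp), he]
      have hV : ∀ j < n, G j (2 ^ (e + 1)) (σ₂.nat (8, j, 0)) := by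
        intro j hj
        rw [hσ₂, Store.join_nat_of_owner (by simp) hj fun i hi hij =>
          hnat i hi _ (by simpa using hij.symm), hτ j hj, pow_succ']
        split_ifs with hle
        · simp only [Function.update_self]
          exact h1 j hj _ _ _ hle (hG j hj) (hG _ (by omega))
        · simp only [Store.thread]
          rw [Function.update_of_ne (by simp)]
          exact h2 j hj _ _ (by omega) (hG j hj)
      refine Runs.of_straight (d := d) (p := .setNat (scell 15) (.add (sc 15) (sc 15))) trivial ?_
      refine ⟨f - 1, by omega, ?_, e + 1, ?_, by omega, ?_⟩
      · refine hF.trans (hF₂.trans ⟨fun a ha i j => ?_, fun a ha i j => rfl, fun a ha i j => rfl⟩)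
        simp only [Cmd.den, scell_addr]
        rw [Function.update_of_ne]
        intro e; exact ha (by simp [(Prod.mk.inj e).1])
      · simp only [Cmd.den, scell_addr, Function.update_self, NatExp.eval, sc_eval, h15]
        ring
      · intro j hj
        simp only [Cmd.den, scell_addr]
        rw [Function.update_of_ne (by simp)]
        exact hV j hj
  · refine ⟨⟨fun a ha i j => ?_, fun a ha i j => rfl, fun a ha i j => rfl⟩, 0, ?_, ?_, ?_⟩
    · simp only [Cmd.den, scell_addr]
      rw [Function.update_of_ne]
      intro e; exact ha (by simp [(Prod.mk.inj e).1])
    · simp [Cmd.den, hs₀]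
    · unfold lg; omega
    · intro j hj
      simp only [Cmd.den, scell_addr]
      rw [Function.update_of_ne (by simp)]
      exact h0 j hj

end

/-! ### Slots and parallel loops -/

/-- The current cluster of slot `i`. -/
def Store.slotClu {k : ℕ} (σ : Store k) (i : ℕ) : Finset (Pt k) := σ.clu (1, i, 0)

/-- The set of all `i < n` such that the cell `(a, i, 0)` is not zero. -/
def Store.slots {k : ℕ} (n a : ℕ) (σ : Store k) : Finset ℕ :=
  (Finset.range n).filter fun i => 1 ≤ σ.nat (a, i, 0)

theorem Store.mem_slots {k : ℕ} {n a i : ℕ} {σ : Store k} :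
    i ∈ σ.slots n a ↔ i < n ∧ 1 ≤ σ.nat (a, i, 0) := by simp [Store.slots]

theorem Frame.slots {k : ℕ} {N R C : List ℕ} {σ σ' : Store k} (h : Frame N R C σ σ') (n : ℕ) {a : ℕ}
    (ha : a ∉ N) : σ'.slots n a = σ.slots n a := by
  ext i; rw [Store.mem_slots, Store.mem_slots, h.nat a ha]

theorem Frame.slotClu {k : ℕ} {N R C : List ℕ} {σ σ' : Store k} (h : Frame N R C σ σ')
    (ha : 1 ∉ C) : σ'.slotClu = σ.slotClu := funext fun i => h.clu 1 ha i 0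

theorem Frame.thread {k : ℕ} (σ : Store k) (a i : ℕ) : Frame [a] [] [] σ (σ.thread a i) :=
  ⟨fun b hb i' j' => by
    simp only [Store.thread]
    rw [Function.update_of_ne]
    intro e; exact hb (by simp [(Prod.mk.inj e).1]), fun _ _ _ _ => rfl, fun _ _ _ _ => rfl⟩

/-- A frame for a store that is updated in a natural-number array. -/
theorem Frame.update_nat {k : ℕ} {N R C : List ℕ} {σ σ' : Store k} (h : Frame N R C σ σ')
    {a i j v : ℕ}
    (ha : a ∈ N) : Frame N R C σ { σ' with nat := Function.update σ'.nat (a, i, j) v } :=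
  ⟨fun b hb i' j' => by
    dsimp only
    rw [Function.update_of_ne, h.nat b hb]
    intro e; exact hb ((Prod.mk.inj e).1 ▸ ha), h.real, h.clu⟩

theorem Frame.update_real {k : ℕ} {N R C : List ℕ} {σ σ' : Store k} (h : Frame N R C σ σ')
    {a i j : ℕ}
    {v : ℝ} (ha : a ∈ R) : Frame N R C σ { σ' with real := Function.update σ'.real (a, i, j) v } :=
  ⟨h.nat, fun b hb i' j' => by
    dsimp only
    rw [Function.update_of_ne, h.real b hb]
    intro e; exact hb ((Prod.mk.inj e).1 ▸ ha), h.clu⟩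

theorem Frame.update_clu {k : ℕ} {N R C : List ℕ} {σ σ' : Store k} (h : Frame N R C σ σ')
    {a i j : ℕ}
    {v : Finset (Pt k)} (ha : a ∈ C) :
    Frame N R C σ { σ' with clu := Function.update σ'.clu (a, i, j) v } :=
  ⟨h.nat, h.real, fun b hb i' j' => by
    dsimp only
    rw [Function.update_of_ne, h.clu b hb]
    intro e; exact hb ((Prod.mk.inj e).1 ▸ ha)⟩

section

variable {k : ℕ} {d : Linkage k}

/-- A parallel loop without nested loops. -/
theorem Runs.par_straight {p : Cmd} (hp : p.Straight) {σ : Store k} {n a : ℕ} {Q : Store k → Prop}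
    (hn : σ.nat (0, 0, 0) = n) (hQ : Q (σ.join a n fun i => p.den d (σ.thread a i))) :
    Runs d (.par a (sc 0) p) σ (1 + n * (1 + p.size)) (1 + Nat.clog 2 n + p.size) Q := by
  have h := Ev.par (d := d) (σ := σ) (a := a) (m := sc 0) (p := p)
    (fun i => p.den d (σ.thread a i)) (fun i _ => Ev.of_straight hp)
  rw [sc_eval, hn] at h
  exact ⟨_, h, hQ⟩

/-- Two nested parallel loops. -/
theorem Runs.par_par_straight {p : Cmd} (hp : p.Straight) {σ : Store k} {n a b : ℕ}
    {Q : Store k → Prop} (ha : a ≠ 0) (hn : σ.nat (0, 0, 0) = n)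
    (hQ : Q (σ.join a n fun i => (σ.thread a i).join b n fun j =>
      p.den d ((σ.thread a i).thread b j))) :
    Runs d (.par a (sc 0) (.par b (sc 0) p)) σ (1 + n * (1 + (1 + n * (1 + p.size))))
      (1 + Nat.clog 2 n + (1 + Nat.clog 2 n + p.size)) Q := by
  have hn' : ∀ i, (σ.thread a i).nat (0, 0, 0) = n := fun i => by
    rw [(Frame.thread σ a i).nat 0 (by simpa using ha.symm), hn]
  have h := Ev.par (d := d) (σ := σ) (a := a) (m := sc 0) (p := .par b (sc 0) p)
    (W := 1 + n * (1 + p.size)) (T := 1 + Nat.clog 2 n + p.size)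
    (fun i => (σ.thread a i).join b n fun j => p.den d ((σ.thread a i).thread b j)) (fun i _ => by
      have h' := Ev.par (d := d) (σ := σ.thread a i) (a := b) (m := sc 0) (p := p)
        (fun j => p.den d ((σ.thread a i).thread b j)) (fun i _ => Ev.of_straight hp)
      rwa [sc_eval, hn'] at h')
  rw [sc_eval, hn] at h
  exact ⟨_, h, hQ⟩

end

/-! ### Residue classes -/

/-- Combine two entries by addition. -/
def combAdd : Cmd :=
  .setNat (vcell 8 (sc 22)) (.add (vec 8 (sc 22)) (vec 8 (.sub (sc 22) (sc 15))))

/-- Mark the numbers of residue `r` modulo `m` in the array `8`, where `m` and `r` are in the cells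
`12` and `13`. There is no division of natural numbers, so the mark at `r` is propagated in steps of
`m`, `2 m`, `4 m`, … -/
def markResidue : Cmd :=
  .seq (.par 20 (sc 0) (.setNat (vcell 8 (sc 20)) (.lit 0)))
    (.seq (.setNat (vcell 8 (sc 13)) (.lit 1)) (doubling (sc 12) combAdd))

section

variable {k : ℕ} {d : Linkage k}

theorem combAdd_den (ς : Store k) : combAdd.den d ς =
    { ς with
      nat := Function.update ς.nat (8, ς.nat (22, 0, 0), 0)
        (ς.nat (8, ς.nat (22, 0, 0), 0) +
          ς.nat (8, ς.nat (22, 0, 0) - ς.nat (15, 0, 0), 0)) } := rfl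

theorem markResidue_runs {σ : Store k} {n m r : ℕ} (hn : σ.nat (0, 0, 0) = n) (hn1 : 1 ≤ n)
    (hm : σ.nat (12, 0, 0) = m) (hr : σ.nat (13, 0, 0) = r) (hrm : r < m) :
    Runs d markResidue σ (1 + n * 2 + (1 + 8 * n * lg n))
      (1 + Nat.clog 2 n + 1 + (1 + lg n * (lg n + 6))) fun σ' =>
      Frame [8, 15] [] [] σ σ' ∧ ∀ i < n, 1 ≤ σ'.nat (8, i, 0) ↔ i % m = r := by
  refine Runs.seq (Runs.par_straight (p := .setNat (vcell 8 (sc 20)) (.lit 0)) trivial hn ?_)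
  set σ₁ := σ.join 20 n fun i => Cmd.den d (.setNat (vcell 8 (sc 20)) (.lit 0)) (σ.thread 20 i)
    with hσ₁
  have hF₁ : Frame [8, 15] [] [] σ σ₁ := Frame.join fun i _ =>
    (Frame.refl _ _ _ _).update_nat (by simp [vcell])
  have hV₁ : ∀ i < n, σ₁.nat (8, i, 0) = 0 := by
    intro i hi
    rw [hσ₁, Store.join_nat_of_owner (by simp) hi]
    · simp [Cmd.den, Store.thread, NatExp.eval]
    · intro j hj hji
      simp only [Cmd.den, vcell_addr, sc_eval, Store.thread, Function.update_self]
      rw [Function.update_of_ne]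
      simpa using hji.symm
  clear_value σ₁
  refine Runs.seq (Runs.of_straight (p := .setNat (vcell 8 (sc 13)) (.lit 1)) trivial ?_)
  have hr₁ : σ₁.nat (13, 0, 0) = r := by rw [hF₁.nat 13 (by simp), hr]
  simp only [Cmd.den, vcell_addr, sc_eval, NatExp.eval, hr₁]
  set σ₂ : Store k := { σ₁ with nat := Function.update σ₁.nat (8, r, 0) 1 } with hσ₂
  have hF₂ : Frame [8, 15] [] [] σ σ₂ := hF₁.update_nat (by simp)
  have hV₂ : ∀ i < n, 1 ≤ σ₂.nat (8, i, 0) ↔ i = r := by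
    intro i hi
    simp only [hσ₂]
    by_cases h : i = r
    · simp [h]
    · rw [Function.update_of_ne (by simpa using h), hV₁ i hi]; simp [h]
  clear_value σ₂
  have key := Runs.doubling (d := d) (s₀ := sc 12) (comb := combAdd) trivial (by decide)
    (op := fun v v' => v + v') (G := fun j c v => 1 ≤ v ↔ ∃ e < c, j = r + e * m)
    (σ := σ₂) (n := n) (s := m) (by rw [hF₂.nat 0 (by simp), hn]) hn1
    (by rw [sc_eval, hF₂.nat 12 (by simp), hm]) (by omega) (fun ς _ => combAdd_den ς) ?_ ?_ ?_
  · refine key.imp ?_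
    rintro σ' ⟨hF, c, hc, hG⟩
    refine ⟨hF₂.trans hF, fun i hi => ?_⟩
    rw [hG i hi]
    constructor
    · rintro ⟨e, -, rfl⟩
      rw [Nat.add_mul_mod_self_right, Nat.mod_eq_of_lt hrm]
    · intro h
      refine ⟨i / m, ?_, ?_⟩
      · rw [Nat.div_lt_iff_lt_mul (by omega)]; omega
      · have := Nat.mod_add_div' i m
        omega
  · intro j hj
    rw [hV₂ j hj]
    constructor
    · rintro rfl; exact ⟨0, by omega, by simp⟩
    · rintro ⟨e, he, rfl⟩
      have : e = 0 := by omega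
      simp [this]
  · intro j hj c v v' hle h1 h2
    have h3 : 1 ≤ v + v' ↔ 1 ≤ v ∨ 1 ≤ v' := by omega
    rw [h3, h1, h2]
    constructor
    · rintro (⟨e, he, h⟩ | ⟨e, he, h⟩)
      · exact ⟨e, by omega, h⟩
      · refine ⟨e + c, by omega, ?_⟩
        rw [add_mul]; omega
    · rintro ⟨e, he, h⟩
      by_cases hec : e < c
      · exact Or.inl ⟨e, hec, h⟩
      · obtain ⟨e', rfl⟩ := Nat.exists_eq_add_of_le (not_lt.1 hec)
        refine Or.inr ⟨e', by omega, ?_⟩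
        rw [add_mul] at h; omega
  · intro j hj c v hlt h1
    rw [h1]
    constructor
    · rintro ⟨e, he, h⟩; exact ⟨e, by omega, h⟩
    · rintro ⟨e, he, h⟩
      refine ⟨e, ?_, h⟩
      by_contra hcon
      have : c * m ≤ e * m := Nat.mul_le_mul_right _ (not_lt.1 hcon)
      omega

end

/-! ### Selecting seeds of cascades -/

/-- Decide whether `i` is a candidate and the current cluster `j` is near it. -/
def nearBody : Cmd :=
  .seq (.linkage (scell 4) (vcell 1 (sc 20)) (vcell 1 (sc 21)))
    (.seq (.setNat ⟨16, sc 20, sc 21⟩ (.lit 0))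
    (.ite (.natLe (.lit 1) (vec 5 (sc 20)))
      (.ite (.natLe (.lit 1) (vec 8 (sc 20)))
        (.ite (.natLe (.lit 1) (vec 3 (sc 21)))
          (.ite (.realLe (.get (scell 4)) (.mul (.get (scell 2)) (.get (scell 0))))
            (.setNat ⟨16, sc 20, sc 21⟩ (.lit 1))
            (.ite (.natLe (sc 20) (sc 21))
              (.ite (.natLe (sc 21) (sc 20)) (.setNat ⟨16, sc 20, sc 21⟩ (.lit 1)) skip) skip))
          skip) skip) skip))

/-- In the array `16`, mark for candidates `i` all current clusters `j` near `i`. -/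
def markNear : Cmd := .par 20 (sc 0) (.par 21 (sc 0) nearBody)

/-- For every cluster, choose a candidate near it; preselect all candidates. The choice is
initialized with `n`, which is not a slot, so that every later write to it is a change of the cell
and takes part in the priority rule. -/
def chooseFirst : Cmd :=
  .seq (.par 20 (sc 0) (.seq (.setNat (vcell 9 (sc 20)) (sc 0))
      (.seq (.setNat (vcell 10 (sc 20)) (.get 16 (sc 20) (sc 20)))
        (.setNat (vcell 7 (sc 20)) (.lit 0)))))
    (.par 20 (sc 0) (.par 21 (sc 0)
      (.ite (.natLe (.lit 1) (.get 16 (sc 20) (sc 21))) (.setNat (vcell 9 (sc 21)) (sc 20)) skip)))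

/-- Drop the candidates that are not the chosen ones of all the clusters near them. As a cluster
chooses only one candidate, no cluster is near two of those that are left. -/
def dropBlocked : Cmd :=
  .par 20 (sc 0) (.par 21 (sc 0)
    (.ite (.natLe (.lit 1) (.get 16 (sc 20) (sc 21)))
      (.ite (.natLe (vec 9 (sc 21)) (sc 20))
        (.ite (.natLe (sc 20) (vec 9 (sc 21))) skip (.setNat (vcell 10 (sc 20)) (.lit 0)))
        (.setNat (vcell 10 (sc 20)) (.lit 0)))
      skip))

section

variable {k : ℕ} {d : Linkage k}

theorem Frame.ite {N R C : List ℕ} {σ σ₁ σ₂ : Store k} {P : Prop} [Decidable P]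
    (h₁ : Frame N R C σ σ₁) (h₂ : Frame N R C σ σ₂) : Frame N R C σ (if P then σ₁ else σ₂) := by
  split_ifs <;> assumption

open scoped Classical in
/-- The entry `(i, j)` is set if and only if `i` is a candidate of the residue class marked in the
array `8`, slot `j` is alive, and the two are near. A residue class thus enters the rest of the
stage only through this matrix. -/
theorem markNear_runs {σ : Store k} {n : ℕ} (hn : σ.nat (0, 0, 0) = n) :
    Runs d markNear σ (1 + n * (1 + (1 + n * (1 + 9))))
      (1 + Nat.clog 2 n + (1 + Nat.clog 2 n + 9)) fun σ' =>
      Frame [16] [4] [] σ σ' ∧ ∀ i < n, ∀ j < n, 1 ≤ σ'.nat (16, i, j) ↔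
        1 ≤ σ.nat (5, i, 0) ∧ 1 ≤ σ.nat (8, i, 0) ∧ 1 ≤ σ.nat (3, j, 0) ∧
        d.Near (σ.real (2, 0, 0) * σ.real (0, 0, 0)) σ.slotClu i j := by
  refine Runs.par_par_straight (p := nearBody) (a := 20) (b := 21)
    (by simp [nearBody, Cmd.Straight, skip]) (by decide) hn ?_
  have hth : ∀ i j, (σ.thread 20 i).thread 21 j =
      { σ with nat := Function.update (Function.update σ.nat (20, 0, 0) i) (21, 0, 0) j } :=
    fun _ _ => rfl
  have hden : ∀ i j, ∃ v x, nearBody.den d ((σ.thread 20 i).thread 21 j) =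
      { (σ.thread 20 i).thread 21 j with
        nat := Function.update ((σ.thread 20 i).thread 21 j).nat (16, i, j) v
        real := Function.update σ.real (4, 0, 0) x } ∧ (1 ≤ v ↔
        1 ≤ σ.nat (5, i, 0) ∧ 1 ≤ σ.nat (8, i, 0) ∧ 1 ≤ σ.nat (3, j, 0) ∧
        d.Near (σ.real (2, 0, 0) * σ.real (0, 0, 0)) σ.slotClu i j) := by
    intro i j
    refine ⟨if 1 ≤ σ.nat (5, i, 0) ∧ 1 ≤ σ.nat (8, i, 0) ∧ 1 ≤ σ.nat (3, j, 0) ∧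
        d.Near (σ.real (2, 0, 0) * σ.real (0, 0, 0)) σ.slotClu i j then 1 else 0,
        d.dist (σ.slotClu i) (σ.slotClu j), ?_, by split_ifs with h <;> simp [h]⟩
    rw [hth]
    simp only [nearBody, Cmd.den, Cond.holds, NatExp.eval, RealExp.eval, Cell.addr, scell, vcell,
      sc_eval, vec_eval, skip_den, Function.update_self, ne_eq, Prod.mk.injEq, not_false_eq_true,
      Function.update_of_ne, Nat.reduceEqDiff, false_and, and_true,
      true_and, Store.slotClu, Linkage.Near, OfNat.zero_ne_ofNat]
    by_cases h1 : 1 ≤ σ.nat (5, i, 0)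
    · by_cases h2 : 1 ≤ σ.nat (8, i, 0)
      · by_cases h3 : 1 ≤ σ.nat (3, j, 0)
        · by_cases h4 : d.dist (σ.clu (1, i, 0)) (σ.clu (1, j, 0)) ≤
            σ.real (2, 0, 0) * σ.real (0, 0, 0)
          · simp [h1, h2, h3, h4]
          · by_cases h5 : i = j
            · subst h5; simp [h1, h2, h3, h4]
            · rcases Nat.lt_or_gt_of_ne h5 with h6 | h6
              · simp [h1, h2, h3, h4, h5, h6.le, h6.not_ge]
              · simp [h1, h2, h3, h4, h5, h6.not_ge]
        · simp [h1, h2, h3]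
      · simp [h1, h2]
    · simp [h1]
  choose v x hden hv using hden
  simp only [hden]
  refine ⟨Frame.join fun i _ => Frame.join fun j _ =>
    Frame.update_nat (σ' := { (σ.thread 20 i).thread 21 j with
      real := Function.update σ.real (4, 0, 0) (x i j) })
      ((Frame.refl _ _ _ _).update_real (by simp)) (by simp), fun i hi j hj => ?_⟩
  rw [Store.join_nat_of_owner (by simp) hi, Store.join_nat_of_owner (by simp) hj]
  · simp [hv]
  · intro j' hj' hne
    exact Function.update_of_ne (by simpa using hne.symm) _ _
  · intro i' hi' hne
    rw [Store.join_nat_of_forall]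
    intro j' hj'
    exact Function.update_of_ne (by simp [hne.symm]) _ _

/-- Several threads write to the choice of a cluster; whichever prevails, the choice is a candidate
near that cluster if there is one at all. -/
theorem chooseFirst_runs {σ : Store k} {n : ℕ} (hn : σ.nat (0, 0, 0) = n) :
    Runs d chooseFirst σ (1 + n * (1 + 3) + (1 + n * (1 + (1 + n * (1 + 2)))))
      (1 + Nat.clog 2 n + 3 + (1 + Nat.clog 2 n + (1 + Nat.clog 2 n + 2))) fun σ' =>
      Frame [7, 9, 10] [] [] σ σ' ∧
      (∀ i < n, σ'.nat (7, i, 0) = 0 ∧ σ'.nat (10, i, 0) = σ.nat (16, i, i)) ∧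
      ∀ j < n, ((∃ i < n, 1 ≤ σ.nat (16, i, j)) →
        σ'.nat (9, j, 0) < n ∧ 1 ≤ σ.nat (16, σ'.nat (9, j, 0), j)) := by
  have hne : ∀ {x y i : ℕ}, x ≠ y → ((x, i, 0) : Addr) ≠ (y, i, 0) := fun h e =>
    h (Prod.mk.inj e).1
  refine Runs.seq (Runs.par_straight (p := .seq (.setNat (vcell 9 (sc 20)) (sc 0))
      (.seq (.setNat (vcell 10 (sc 20)) (.get 16 (sc 20) (sc 20)))
        (.setNat (vcell 7 (sc 20)) (.lit 0)))) (by simp [Cmd.Straight]) hn ?_)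
  set p : Cmd := .seq (.setNat (vcell 9 (sc 20)) (sc 0))
      (.seq (.setNat (vcell 10 (sc 20)) (.get 16 (sc 20) (sc 20)))
        (.setNat (vcell 7 (sc 20)) (.lit 0))) with hp
  have hden : ∀ i, p.den d (σ.thread 20 i) = { σ.thread 20 i with
      nat := Function.update (Function.update (Function.update (σ.thread 20 i).nat
        (9, i, 0) n) (10, i, 0) (σ.nat (16, i, i))) (7, i, 0) 0 } := by
    intro i
    simp [hp, Cmd.den, Store.thread, NatExp.eval, hn]
  simp only [hden]
  set σ₁ := σ.join 20 n fun i => { σ.thread 20 i with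
      nat := Function.update (Function.update (Function.update (σ.thread 20 i).nat
        (9, i, 0) n) (10, i, 0) (σ.nat (16, i, i))) (7, i, 0) 0 } with hσ₁
  have hF₁ : Frame [7, 9, 10] [] [] σ σ₁ := Frame.join fun i _ =>
    (((Frame.refl _ _ _ (σ.thread 20 i)).update_nat (a := 9) (by simp)).update_nat (a := 10)
      (by simp)).update_nat (a := 7) (by simp)
  have hown : ∀ i < n, σ₁.nat (7, i, 0) = 0 ∧ σ₁.nat (10, i, 0) = σ.nat (16, i, i) ∧
      σ₁.nat (9, i, 0) = n := by
    intro i hi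
    have h : ∀ a, a ≠ 20 → σ₁.nat (a, i, 0) = (Function.update (Function.update (Function.update
        (σ.thread 20 i).nat (9, i, 0) n) (10, i, 0) (σ.nat (16, i, i))) (7, i, 0) 0) (a, i, 0) := by
      intro a ha
      rw [hσ₁, Store.join_nat_of_owner (by simp [ha]) hi]
      intro j hj hji
      simp [Ne.symm hji]
    rw [h 7 (by decide), h 10 (by decide), h 9 (by decide)]
    simp
  clear_value σ₁
  have hn₁ : σ₁.nat (0, 0, 0) = n := by rw [hF₁.nat 0 (by simp), hn]
  set q : Cmd := .ite (.natLe (.lit 1) (.get 16 (sc 20) (sc 21)))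
    (.setNat (vcell 9 (sc 21)) (sc 20)) skip with hq
  refine Runs.par_par_straight (p := q) (a := 20) (b := 21) (by simp [hq, Cmd.Straight, skip])
    (by decide) hn₁ ?_
  have hden : ∀ i j, q.den d ((σ₁.thread 20 i).thread 21 j) =
      if 1 ≤ σ.nat (16, i, j) then { (σ₁.thread 20 i).thread 21 j with
        nat := Function.update ((σ₁.thread 20 i).thread 21 j).nat (9, j, 0) i }
      else (σ₁.thread 20 i).thread 21 j := by
    intro i j
    simp [hq, Cmd.den, Store.thread, NatExp.eval, Cond.holds, hF₁.nat 16]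
  simp only [hden]
  have hin : ∀ i j, j < n → ((σ₁.thread 20 i).join 21 n fun j => if 1 ≤ σ.nat (16, i, j) then
      { (σ₁.thread 20 i).thread 21 j with
        nat := Function.update ((σ₁.thread 20 i).thread 21 j).nat (9, j, 0) i }
      else (σ₁.thread 20 i).thread 21 j).nat (9, j, 0) = if 1 ≤ σ.nat (16, i, j) then i else n := by
    intro i j hj
    rw [Store.join_nat_of_owner (by simp) hj]
    · split_ifs
      · simp
      · simp [Store.thread, (hown j hj).2.2]
    · intro j' hj' hne
      split_ifs
      · simp [hne.symm]
      · rfl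
  set τ : ℕ → Store k := fun i => (σ₁.thread 20 i).join 21 n fun j => if 1 ≤ σ.nat (16, i, j) then
      { (σ₁.thread 20 i).thread 21 j with
        nat := Function.update ((σ₁.thread 20 i).thread 21 j).nat (9, j, 0) i }
      else (σ₁.thread 20 i).thread 21 j with hτ
  have hFτ : ∀ i, Frame [9] [] [] (σ₁.thread 20 i) (τ i) := fun i => Frame.join fun j _ =>
    Frame.ite ((Frame.refl _ _ _ _).update_nat (by simp)) (Frame.refl _ _ _ _)
  have hF₂ : Frame [9] [] [] σ₁ (σ₁.join 20 n τ) := Frame.join fun i _ => hFτ i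
  refine ⟨hF₁.trans (hF₂.mono (by simp) (by simp) (by simp)), fun i hi => ?_, fun j hj hex => ?_⟩
  · rw [hF₂.nat 7 (by simp), hF₂.nat 10 (by simp)]
    exact ⟨(hown i hi).1, (hown i hi).2.1⟩
  · rcases Store.join_nat_cases (σ := σ₁) (a := 20) (m := n) (τ := τ) (x := (9, j, 0)) (by simp)
      with ⟨-, h⟩ | ⟨i, hi, h, h'⟩
    · exfalso
      obtain ⟨i, hi, h1⟩ := hex
      have h2 := h i hi
      rw [hin i j hj, if_pos h1, (hown j hj).2.2] at h2
      omega
    · rw [h]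
      rw [hin i j hj, (hown j hj).2.2] at h'
      rw [hin i j hj]
      split_ifs at h' ⊢ with h1
      · exact ⟨hi, h1⟩
      · exact absurd rfl h'

theorem dropBlocked_runs {σ : Store k} {n : ℕ} (hn : σ.nat (0, 0, 0) = n) :
    Runs d dropBlocked σ (1 + n * (1 + (1 + n * (1 + 4))))
      (1 + Nat.clog 2 n + (1 + Nat.clog 2 n + 4)) fun σ' =>
      Frame [10] [] [] σ σ' ∧ ∀ i < n, 1 ≤ σ'.nat (10, i, 0) ↔
        1 ≤ σ.nat (10, i, 0) ∧ ∀ j < n, 1 ≤ σ.nat (16, i, j) → σ.nat (9, j, 0) = i := by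
  set q : Cmd := .ite (.natLe (.lit 1) (.get 16 (sc 20) (sc 21)))
      (.ite (.natLe (vec 9 (sc 21)) (sc 20))
        (.ite (.natLe (sc 20) (vec 9 (sc 21))) skip (.setNat (vcell 10 (sc 20)) (.lit 0)))
        (.setNat (vcell 10 (sc 20)) (.lit 0)))
      skip with hq
  refine Runs.par_par_straight (p := q) (a := 20) (b := 21) (by simp [hq, Cmd.Straight, skip])
    (by decide) hn ?_
  have hden : ∀ i j, q.den d ((σ.thread 20 i).thread 21 j) =
      if 1 ≤ σ.nat (16, i, j) ∧ σ.nat (9, j, 0) ≠ i then { (σ.thread 20 i).thread 21 j with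
        nat := Function.update ((σ.thread 20 i).thread 21 j).nat (10, i, 0) 0 }
      else (σ.thread 20 i).thread 21 j := by
    intro i j
    simp only [hq, Cmd.den, Cond.holds, NatExp.eval, sc_eval, vec_eval, skip_den, vcell_addr]
    have e1 : ((σ.thread 20 i).thread 21 j).nat (20, 0, 0) = i := by simp [Store.thread]
    have e2 : ((σ.thread 20 i).thread 21 j).nat (21, 0, 0) = j := by simp [Store.thread]
    have e3 : ((σ.thread 20 i).thread 21 j).nat (16, i, j) = σ.nat (16, i, j) := by
      simp [Store.thread]
    have e4 : ((σ.thread 20 i).thread 21 j).nat (9, j, 0) = σ.nat (9, j, 0) := by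
      simp [Store.thread]
    simp only [e1, e2, e3, e4]
    by_cases h1 : 1 ≤ σ.nat (16, i, j)
    · rcases lt_trichotomy (σ.nat (9, j, 0)) i with h2 | h2 | h2
      · simp [h1, h2.le, h2.not_ge, h2.ne]
      · simp [h1, h2]
      · simp [h1, h2.not_ge, h2.ne']
    · simp [h1]
  simp only [hden]
  set τ : ℕ → Store k := fun i => (σ.thread 20 i).join 21 n fun j =>
      if 1 ≤ σ.nat (16, i, j) ∧ σ.nat (9, j, 0) ≠ i then { (σ.thread 20 i).thread 21 j with
        nat := Function.update ((σ.thread 20 i).thread 21 j).nat (10, i, 0) 0 }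
      else (σ.thread 20 i).thread 21 j with hτ
  refine ⟨Frame.join fun i _ => Frame.join fun j _ =>
    Frame.ite ((Frame.refl _ _ _ _).update_nat (by simp)) (Frame.refl _ _ _ _), fun i hi => ?_⟩
  rw [Store.join_nat_of_owner (by simp) hi]
  · have hbase : (σ.thread 20 i).nat (10, i, 0) = σ.nat (10, i, 0) := by simp [Store.thread]
    rcases Store.join_nat_cases (σ := σ.thread 20 i) (a := 21) (m := n) (x := (10, i, 0))
      (τ := fun j => if 1 ≤ σ.nat (16, i, j) ∧ σ.nat (9, j, 0) ≠ i then
        { (σ.thread 20 i).thread 21 j with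
          nat := Function.update ((σ.thread 20 i).thread 21 j).nat (10, i, 0) 0 }
        else (σ.thread 20 i).thread 21 j) (by simp) with ⟨h, h'⟩ | ⟨j, hj, h, h'⟩
    · simp only [hτ]
      rw [h, hbase]
      refine ⟨fun h1 => ⟨h1, fun j hj h2 => ?_⟩, fun h1 => h1.1⟩
      by_contra h3
      have h4 := h' j hj
      rw [if_pos ⟨h2, h3⟩, hbase] at h4
      simp at h4
      omega
    · simp only [hτ]
      rw [h]
      rw [hbase] at h'
      split_ifs at h' ⊢ with h1
      · simp only [Function.update_self]
        refine ⟨fun h2 => by omega, fun h2 => absurd (h2.2 j hj h1.1) h1.2⟩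
      · exact absurd (by simp [Store.thread]) h'
  · intro i' hi' hne
    rw [hτ]
    rw [Store.join_nat_of_forall]
    intro j' hj'
    dsimp only
    split_ifs
    · exact Function.update_of_ne (by simp [hne.symm]) _ _
    · rfl

/-- The selected slots are candidates, no cluster is near two of them, and a candidate is selected
if it is the only one near each of the clusters near it. -/
theorem select_runs {σ : Store k} {n : ℕ} (hn : σ.nat (0, 0, 0) = n) :
    Runs d (.seq chooseFirst dropBlocked) σ
      (1 + n * (1 + 3) + (1 + n * (1 + (1 + n * (1 + 2)))) + (1 + n * (1 + (1 + n * (1 + 4)))))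
      (1 + Nat.clog 2 n + 3 + (1 + Nat.clog 2 n + (1 + Nat.clog 2 n + 2)) +
        (1 + Nat.clog 2 n + (1 + Nat.clog 2 n + 4))) fun σ' =>
      Frame [7, 9, 10] [] [] σ σ' ∧ (∀ i < n, σ'.nat (7, i, 0) = 0) ∧
      (∀ i ∈ σ'.slots n 10, 1 ≤ σ.nat (16, i, i)) ∧
      (∀ i ∈ σ'.slots n 10, ∀ i' ∈ σ'.slots n 10, i ≠ i' → ∀ j < n, 1 ≤ σ.nat (16, i, j) →
        1 ≤ σ.nat (16, i', j) → False) ∧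
      ∀ i < n, 1 ≤ σ.nat (16, i, i) → (∀ j < n, 1 ≤ σ.nat (16, i, j) → ∀ i' < n,
        1 ≤ σ.nat (16, i', j) → i' = i) → i ∈ σ'.slots n 10 := by
  refine Runs.seq ((chooseFirst_runs hn).imp ?_)
  rintro σ₁ ⟨hF₁, hA, hB⟩
  refine (dropBlocked_runs (by rw [hF₁.nat 0 (by simp), hn])).imp ?_
  rintro σ₂ ⟨hF₂, hC⟩
  have hC' : ∀ i, i ∈ σ₂.slots n 10 ↔ i < n ∧ 1 ≤ σ.nat (16, i, i) ∧
      ∀ j < n, 1 ≤ σ.nat (16, i, j) → σ₁.nat (9, j, 0) = i := by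
    intro i
    rw [Store.mem_slots]
    refine and_congr_right fun hi => ?_
    rw [hC i hi, (hA i hi).2]
    simp only [hF₁.nat 16 (by simp)]
  refine ⟨hF₁.trans (hF₂.mono (by simp) (by simp) (by simp)), fun i hi => ?_, fun i hi => ?_,
    fun i hi i' hi' hne j hj h1 h2 => ?_, fun i hi h1 h2 => ?_⟩
  · rw [hF₂.nat 7 (by simp), (hA i hi).1]
  · exact ((hC' i).1 hi).2.1
  · exact hne ((((hC' i).1 hi).2.2 j hj h1).symm.trans (((hC' i').1 hi').2.2 j hj h2))
  · refine (hC' i).2 ⟨hi, h1, fun j hj h3 => ?_⟩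
    obtain ⟨h4, h5⟩ := hB j hj ⟨i, hi, h3⟩
    exact h2 j hj h3 _ h4 h5

end

/-! ### Running a cascade -/

namespace Linkage

variable {k : ℕ} {d : Linkage k} {thr : ℝ} {S : Finset ℕ} {X : ℕ → Finset (Pt k)} {i : ℕ}
  {b : ℕ → ℕ} {h : ℕ}

theorem Cascade.zero (b : ℕ → ℕ) : d.Cascade thr S X i b 0 :=
  ⟨by simp, by simp, by simp, by simp, by simp⟩

theorem Cascade.succ (c : d.Cascade thr S X i b h) {v : ℕ} (hv : v ∈ S) (hvi : v ≠ i)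
    (hvb : ∀ t < h, b t ≠ v) (hle : d.dist (grow X i b h) (X v) ≤ thr)
    (hmin : ∀ j ∈ S, j ≠ i → (∀ t < h, b t ≠ j) →
      d.dist (grow X i b h) (X v) ≤ d.dist (grow X i b h) (X j)) :
    d.Cascade thr S X i (Function.update b h v) (h + 1) := by
  have c' := c.congr (b' := Function.update b h v) fun t ht =>
    (Function.update_of_ne (by omega) _ _).symm
  have hg : grow X i (Function.update b h v) h = grow X i b h :=
    grow_congr fun t ht => Function.update_of_ne (by omega) _ _
  refine ⟨fun s hs => ?_, fun s hs => ?_, fun s hs t ht => ?_, fun s hs => ?_,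
    fun s hs j hj hji hb => ?_⟩ <;> rcases Nat.lt_succ_iff_lt_or_eq.1 hs with h1 | rfl
  · exact c'.mem s h1
  · simpa using hv
  · exact c'.ne s h1
  · simpa using hvi
  · exact c'.inj s h1 t ht
  · rw [Function.update_self, Function.update_of_ne (by omega)]; exact hvb t ht
  · exact c'.le_thr s h1
  · rw [hg, Function.update_self]; exact hle
  · exact c'.nearest s h1 j hj hji hb
  · rw [hg, Function.update_self]
    refine hmin j hj hji fun t ht => ?_
    have := hb t ht
    rwa [Function.update_of_ne (by omega)] at this

end Linkage

/-- The threshold `L (q + 1) / q` of the current phase. Merges below it are `(1 + 1 /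
q)`-approximate while all pairs are at least `L` apart. -/
def thrExp (q : ℕ) : RealExp :=
  .mul (.get (scell 0)) (.div (.ofNat (.lit (q + 1))) (.ofNat (.lit q)))

/-- The value of `thrExp`. -/
noncomputable def Store.thr {k : ℕ} (q : ℕ) (σ : Store k) : ℝ :=
  σ.real (0, 0, 0) * (((q + 1 : ℕ) : ℝ) / (q : ℕ))

/-- Store the linkage value of the slots `i` and `j`, or, if `j` is not alive or equal to `i`, a
value above the threshold, so that `j` is never merged. -/
def distBody (q : ℕ) : Cmd :=
  .seq (.ite (.natLe (.lit 1) (vec 3 (sc 21)))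
      (.ite (.natLe (sc 20) (sc 21))
        (.ite (.natLe (sc 21) (sc 20))
          (.setReal (vcell 3 (sc 21)) (.add (thrExp q) (.ofNat (.lit 1))))
          (.linkage (vcell 3 (sc 21)) (vcell 1 (sc 20)) (vcell 1 (sc 21))))
        (.linkage (vcell 3 (sc 21)) (vcell 1 (sc 20)) (vcell 1 (sc 21))))
      (.setReal (vcell 3 (sc 21)) (.add (thrExp q) (.ofNat (.lit 1)))))
    (.setNat (vcell 8 (sc 21)) (sc 21))

/-- Combine two entries by choosing the one whose linkage value is smaller. -/
def combMin : Cmd :=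
  .ite (.realLe (.get (vcell 3 (vec 8 (.sub (sc 22) (sc 15))))) (.get (vcell 3 (vec 8 (sc 22)))))
    (.setNat (vcell 8 (sc 22)) (vec 8 (.sub (sc 22) (sc 15)))) skip

/-- Find a cluster nearest to that of slot `i`. -/
def findNearest (q : ℕ) : Cmd :=
  .seq (.par 21 (sc 0) (distBody q)) (doubling (.lit 1) combMin)

/-- The expression for the slot found by `findNearest`. -/
def best : NatExp := vec 8 (.sub (sc 0) (.lit 1))

/-- Merge the slot found by `findNearest` into slot `i`. -/
def absorb : Cmd :=
  .seq (.union (vcell 1 (sc 20)) (vcell 1 (sc 20)) (vcell 1 best))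
    (.seq (.setNat ⟨6, sc 20, vec 7 (sc 20)⟩ best)
    (.seq (.setNat (vcell 7 (sc 20)) (.add (vec 7 (sc 20)) (.lit 1)))
    (.seq (.setNat (vcell 3 best) (.lit 0)) (.setNat (vcell 5 best) (.lit 0)))))

/-- One step of a cascade. -/
def cascadeStep (q : ℕ) : Cmd :=
  .seq (findNearest q)
    (.ite (.realLe (.get (vcell 3 best)) (thrExp q)) absorb (.setNat (scell 17) (.lit 0)))

/-- The cascade of slot `i`. -/
def cascade (q : ℕ) : Cmd :=
  .seq (.setNat (vcell 5 (sc 20)) (.lit 0)) (.seq (.setNat (scell 17) (.lit 1))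
    (.loop (.natLe (.lit 1) (sc 17)) (cascadeStep q)))

section

variable {k : ℕ} {d : Linkage k}

theorem Frame.thr {N R C : List ℕ} {σ σ' : Store k} (h : Frame N R C σ σ') (hR : 0 ∉ R) (q : ℕ) :
    σ'.thr q = σ.thr q := by rw [Store.thr, Store.thr, h.real 0 hR]

theorem thrExp_eval (q : ℕ) (σ : Store k) : (thrExp q).eval σ = σ.thr q := rfl

theorem combMin_straight : combMin.Straight := ⟨trivial, skip_straight⟩

open scoped Classical in
/-- The values `D j` have a minimum at the slot that is found. The doubling loop combines minima
over blocks of slots; the entry of slot `n - 1` ends up with the minimum over all of them. -/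
theorem findNearest_runs {σ : Store k} {n i q : ℕ} (hn : σ.nat (0, 0, 0) = n) (hn1 : 1 ≤ n)
    (hi : σ.nat (20, 0, 0) = i) :
    Runs d (findNearest q) σ (1 + n * (1 + 5) + 8 * n * lg n)
      (1 + Nat.clog 2 n + 5 + lg n * (lg n + 6)) fun σ' =>
      Frame [8, 15] [3] [] σ σ' ∧ ∃ D : ℕ → ℝ,
      (∀ j < n, D j = if 1 ≤ σ.nat (3, j, 0) ∧ j ≠ i then d.dist (σ.slotClu i) (σ.slotClu j)
        else σ.thr q + 1) ∧ σ'.nat (8, n - 1, 0) < n ∧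
      σ'.real (3, σ'.nat (8, n - 1, 0), 0) = D (σ'.nat (8, n - 1, 0)) ∧
      ∀ j < n, D (σ'.nat (8, n - 1, 0)) ≤ D j := by
  set D : ℕ → ℝ := fun j => if 1 ≤ σ.nat (3, j, 0) ∧ j ≠ i then
    d.dist (σ.slotClu i) (σ.slotClu j) else σ.thr q + 1 with hD
  refine Runs.seq (Runs.par_straight (p := distBody q)
    (by simp [distBody, Cmd.Straight]) hn ?_)
  have hden : ∀ j, (distBody q).den d (σ.thread 21 j) = { σ.thread 21 j with
      nat := Function.update (σ.thread 21 j).nat (8, j, 0) j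
      real := Function.update σ.real (3, j, 0) (D j) } := by
    intro j
    have e1 : (σ.thread 21 j).nat (21, 0, 0) = j := by simp [Store.thread]
    have e2 : (σ.thread 21 j).nat (20, 0, 0) = i := by simp [Store.thread, hi]
    have e3 : (σ.thread 21 j).nat (3, j, 0) = σ.nat (3, j, 0) := by simp [Store.thread]
    have e4 : (thrExp q).eval (σ.thread 21 j) = σ.thr q := rfl
    simp only [distBody, Cmd.den, Cond.holds, NatExp.eval, RealExp.eval, vec_eval, sc_eval,
      vcell_addr, e1, e2, e3, e4, hD]
    by_cases h1 : 1 ≤ σ.nat (3, j, 0)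
    · rcases lt_trichotomy i j with h2 | h2 | h2
      · simp [h1, h2.le, h2.not_ge, h2.ne', Store.slotClu, Store.thread]
      · simp [h1, h2, Store.thread]
      · simp [h1, h2.not_ge, h2.ne, Store.slotClu, Store.thread]
    · simp [h1, Store.thread]
  simp only [hden]
  set σ₁ := σ.join 21 n fun j => { σ.thread 21 j with
      nat := Function.update (σ.thread 21 j).nat (8, j, 0) j
      real := Function.update σ.real (3, j, 0) (D j) } with hσ₁
  have hF₁ : Frame [8, 15] [3] [] σ σ₁ := Frame.join fun j _ =>
    Frame.update_nat (σ' := { σ.thread 21 j with real := Function.update σ.real (3, j, 0) (D j) })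
      ((Frame.refl _ _ _ (σ.thread 21 j)).update_real (by simp)) (by simp)
  have hV : ∀ j < n, σ₁.nat (8, j, 0) = j := by
    intro j hj
    rw [hσ₁, Store.join_nat_of_owner (by simp) hj]
    · simp
    · intro j' hj' hne; simp [hne.symm]
  have hR : ∀ j < n, σ₁.real (3, j, 0) = D j := by
    intro j hj
    rw [hσ₁, Store.join_real_of_owner hj]
    · simp
    · intro j' hj' hne; simp [hne.symm]
  clear_value σ₁
  have key := Runs.doubling (d := d) (s₀ := .lit 1) (comb := combMin) combMin_straight
    (by decide) (op := fun v v' => if σ₁.real (3, v', 0) ≤ σ₁.real (3, v, 0) then v' else v)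
    (G := fun j c v => v ≤ j ∧ j < v + c ∧ ∀ l ≤ j, j < l + c → D v ≤ D l) (σ := σ₁) (n := n)
    (s := 1) (by rw [hF₁.nat 0 (by simp), hn]) hn1 rfl le_rfl ?_ ?_ ?_ ?_
  · refine key.imp ?_
    rintro σ' ⟨hF, c, hc, hG⟩
    obtain ⟨h1, -, h3⟩ := hG (n - 1) (by omega)
    refine ⟨hF₁.trans (hF.mono (by simp) (by simp) (by simp)), D, fun j _ => rfl, by omega, ?_,
      fun j hj => h3 j (by omega) (by omega)⟩
    rw [hF.real 3 (by simp), hR _ (by omega)]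
  · intro ς hς
    simp only [combMin, Cmd.den, Cond.holds, RealExp.eval, NatExp.eval, vcell_addr, vec_eval,
      sc_eval, skip_den, hς]
    split_ifs
    · rw [← hς]
    · rw [Function.update_eq_self, ← hς]
  · intro j hj
    rw [hV j hj]
    refine ⟨le_rfl, by omega, fun l hl hl' => ?_⟩
    rw [show l = j by omega]
  · rintro j hj c v v' hle ⟨h1, h2, h3⟩ ⟨h1', h2', h3'⟩
    rw [hR v (by omega), hR v' (by omega)]
    have hmin : ∀ l ≤ j, j < l + 2 * c → min (D v) (D v') ≤ D l := by
      intro l hl hl'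
      rcases Nat.lt_or_ge j (l + c) with h4 | h4
      · exact (min_le_left _ _).trans (h3 l hl h4)
      · exact (min_le_right _ _).trans (h3' l (by omega) (by omega))
    split_ifs with h4
    · rw [min_eq_right h4] at hmin
      exact ⟨by omega, by omega, hmin⟩
    · rw [min_eq_left (not_le.1 h4).le] at hmin
      exact ⟨by omega, by omega, hmin⟩
  · rintro j hj c v hlt ⟨h1, h2, h3⟩
    exact ⟨h1, by omega, fun l hl _ => h3 l hl (by omega)⟩

open Linkage in
open scoped Classical in
/-- The store `σ` after the first `h` merges `b` of the cascade of slot `i`, which was started in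
the store `σ₀`. -/
structure CascadeStore (σ₀ : Store k) (i : ℕ) (b : ℕ → ℕ) (h : ℕ) (σ : Store k) : Prop where
  frame : Frame [3, 5, 6, 7, 8, 15, 17] [3] [1] σ₀ σ
  len : σ.nat (7, i, 0) = h
  len_ne : ∀ j ≠ i, σ.nat (7, j, 0) = σ₀.nat (7, j, 0)
  log : ∀ s < h, σ.nat (6, i, s) = b s
  log_ne : ∀ j ≠ i, ∀ s, σ.nat (6, j, s) = σ₀.nat (6, j, s)
  clu : σ.slotClu i = grow σ₀.slotClu i b h
  clu_ne : ∀ j ≠ i, σ.slotClu j = σ₀.slotClu j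
  alive : ∀ j, σ.nat (3, j, 0) = if ∃ t < h, b t = j then 0 else σ₀.nat (3, j, 0)
  old : ∀ j, σ.nat (5, j, 0) = if j = i ∨ ∃ t < h, b t = j then 0 else σ₀.nat (5, j, 0)

open Linkage in
theorem CascadeStore.congr_frame {σ₀ σ σ' : Store k} {i h : ℕ} {b : ℕ → ℕ}
    (c : CascadeStore σ₀ i b h σ) (hF : Frame [8, 15, 17] [3] [] σ σ') :
    CascadeStore σ₀ i b h σ' where
  frame := c.frame.trans (hF.mono (by simp) (by simp) (by simp))
  len := by rw [hF.nat 7 (by simp), c.len]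
  len_ne j hj := by rw [hF.nat 7 (by simp), c.len_ne j hj]
  log s hs := by rw [hF.nat 6 (by simp), c.log s hs]
  log_ne j hj s := by rw [hF.nat 6 (by simp), c.log_ne j hj s]
  clu := by rw [hF.slotClu (by simp), c.clu]
  clu_ne j hj := by rw [hF.slotClu (by simp), c.clu_ne j hj]
  alive j := by rw [hF.nat 3 (by simp), c.alive j]
  old j := by rw [hF.nat 5 (by simp), c.old j]

theorem absorb_den (σ : Store k) {i v : ℕ} (hi : σ.nat (20, 0, 0) = i)
    (hv : σ.nat (8, σ.nat (0, 0, 0) - 1, 0) = v) : absorb.den d σ = { σ with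
      nat := Function.update (Function.update (Function.update (Function.update σ.nat
        (6, i, σ.nat (7, i, 0)) v) (7, i, 0) (σ.nat (7, i, 0) + 1)) (3, v, 0) 0) (5, v, 0) 0
      clu := Function.update σ.clu (1, i, 0) (Cmd.den d (.union (vcell 1 (sc 20)) (vcell 1 (sc 20))
        (vcell 1 best)) σ |>.clu (1, i, 0)) } := by
  simp [absorb, best, Cmd.den, vcell, Cell.addr, NatExp.eval, hi, hv]

open Linkage in
open scoped Classical in
/-- Merging the slot `v` continues the recorded cascade by `v`. -/
theorem absorb_cascadeStore {σ₀ σ : Store k} {i h v : ℕ} {b : ℕ → ℕ}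
    (c : CascadeStore σ₀ i b h σ) (hi : σ.nat (20, 0, 0) = i)
    (hv : σ.nat (8, σ.nat (0, 0, 0) - 1, 0) = v) (hvi : v ≠ i) :
    CascadeStore σ₀ i (Function.update b h v) (h + 1) (absorb.den d σ) := by
  have hg : grow σ₀.slotClu i (Function.update b h v) h = grow σ₀.slotClu i b h :=
    grow_congr fun t ht => Function.update_of_ne (by omega) _ _
  have hex : ∀ j, (∃ t < h + 1, Function.update b h v t = j) ↔ j = v ∨ ∃ t < h, b t = j := by
    intro j
    constructor
    · rintro ⟨t, ht, rfl⟩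
      rcases Nat.lt_succ_iff_lt_or_eq.1 ht with h1 | rfl
      · exact Or.inr ⟨t, h1, (Function.update_of_ne (by omega) _ _).symm⟩
      · exact Or.inl (by simp)
    · rintro (rfl | ⟨t, ht, rfl⟩)
      · exact ⟨h, by omega, by simp⟩
      · exact ⟨t, by omega, Function.update_of_ne (by omega) _ _⟩
  rw [absorb_den σ hi hv]
  refine ⟨?_, ?_, fun j hj => ?_, fun s hs => ?_, fun j hj s => ?_, ?_, fun j hj => ?_, fun j => ?_,
    fun j => ?_⟩
  · exact Frame.update_clu (σ' := { σ with nat := _ })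
      ((((c.frame.update_nat (by simp)).update_nat (by simp)).update_nat
      (by simp)).update_nat (by simp)) (by simp)
  · simp [c.len]
  · simp [hj, c.len_ne j hj]
  · rcases Nat.lt_succ_iff_lt_or_eq.1 hs with h1 | rfl
    · simp [c.len, h1.ne, c.log s h1]
    · simp [c.len]
  · simp [hj, c.log_ne j hj s]
  · have h1 := c.clu
    have h2 := c.clu_ne v hvi
    simp only [Store.slotClu] at h1 h2 ⊢
    simp only [Cmd.den, best, vcell_addr, vec_eval, sc_eval, NatExp.eval, hi, hv,
      Function.update_self, h1, h2, grow]
    rw [hg]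
    rfl
  · have h2 := c.clu_ne j hj
    simp only [Store.slotClu] at h2 ⊢
    rw [Function.update_of_ne (by simpa using hj), h2]
  · rw [if_congr (hex j) rfl rfl]
    by_cases hjv : j = v
    · simp [hjv]
    · simp [hjv, c.alive j]
  · rw [if_congr (or_congr Iff.rfl (hex j)) rfl rfl]
    by_cases hjv : j = v
    · simp [hjv]
    · simp [hjv, c.old j]

open Linkage in
/-- The cascade of slot `i` runs to its end. -/
theorem cascade_runs {K : ℕ} (hd : d.WellBehaved K) {P : Finset (Pt k)} {σ : Store k} {n i q : ℕ}
    (hn : σ.nat (0, 0, 0) = n) (hn1 : 1 ≤ n) (hP : P.card = n) (hi : σ.nat (20, 0, 0) = i)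
    (hiS : i ∈ σ.slots n 3) (hL : 0 < σ.real (0, 0, 0)) (hthr : σ.thr q ≤ 2 * σ.real (0, 0, 0))
    (hX : d.Clustering P (σ.real (0, 0, 0)) (σ.slots n 3) σ.slotClu) (hlen : σ.nat (7, i, 0) = 0) :
    Runs d (cascade q) σ
      (1 + (1 + (lengthNum K k (lg n) * (1 + (1 + n * (1 + 5) + 8 * n * lg n + (1 + 5))) + 1)))
      (1 + (1 + (lengthNum K k (lg n) *
        (1 + (1 + Nat.clog 2 n + 5 + lg n * (lg n + 6) + (1 + 5))) + 1)))
      fun σ' => ∃ b h, CascadeStore σ i b h σ' ∧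
        d.Cascade (σ.thr q) (σ.slots n 3) σ.slotClu i b h ∧
        d.CascadeDone (σ.thr q) (σ.slots n 3) σ.slotClu i b h := by
  refine Runs.seq (Runs.of_straight (p := .setNat (vcell 5 (sc 20)) (.lit 0)) trivial ?_)
  refine Runs.seq (Runs.of_straight (p := .setNat (scell 17) (.lit 1)) trivial ?_)
  set σ₂ := Cmd.den d (.setNat (scell 17) (.lit 1))
    (Cmd.den d (.setNat (vcell 5 (sc 20)) (.lit 0)) σ) with hσ₂
  have hc₂ : CascadeStore σ i (fun _ => 0) 0 σ₂ := by
    simp only [hσ₂, Cmd.den, vcell_addr, scell_addr, sc_eval, NatExp.eval, hi]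
    refine ⟨((Frame.refl _ _ _ _).update_nat (by simp)).update_nat (by simp), ?_, fun j hj => ?_,
      by simp, fun j hj s => ?_, rfl, fun j hj => rfl, fun j => ?_, fun j => ?_⟩
    · simpa using hlen
    · simp
    · simp
    · simp
    · by_cases hj : j = i <;> simp [hj]
  have h17 : σ₂.nat (17, 0, 0) = 1 := by simp [hσ₂, Cmd.den, NatExp.eval]
  clear_value σ₂
  have hloop := Runs.loop (d := d) (b := .natLe (.lit 1) (sc 17)) (p := cascadeStep q)
    (W := 1 + n * (1 + 5) + 8 * n * lg n + (1 + 5))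
    (T := 1 + Nat.clog 2 n + 5 + lg n * (lg n + 6) + (1 + 5))
    (fun f σ' => ∃ b h, CascadeStore σ i b h σ' ∧
      d.Cascade (σ.thr q) (σ.slots n 3) σ.slotClu i b h ∧
      ((σ'.nat (17, 0, 0) = 1 ∧ h + f = lengthNum K k (lg n)) ∨
        (σ'.nat (17, 0, 0) = 0 ∧ d.CascadeDone (σ.thr q) (σ.slots n 3) σ.slotClu i b h)))
    ?_ (lengthNum K k (lg n)) σ₂
    ⟨_, _, hc₂, Cascade.zero _, Or.inl ⟨h17, by simp⟩⟩
  · refine hloop.imp ?_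
    rintro σ' ⟨hb, f, b, h, h1, h2, h3⟩
    simp only [Cond.holds, NatExp.eval, sc_eval] at hb
    rcases h3 with h3 | h3
    · omega
    · exact ⟨b, h, h1, h2, h3.2⟩
  · rintro f σ₁ ⟨b, h, hc, hcas, h3⟩ hb
    simp only [Cond.holds, NatExp.eval, sc_eval] at hb
    obtain ⟨h17, hf⟩ : σ₁.nat (17, 0, 0) = 1 ∧ h + f = lengthNum K k (lg n) := by
      rcases h3 with h3 | h3
      exacts [h3, by omega]
    have hlt := hcas.length_lt hd hX hiS hL hthr
    rw [hP] at hlt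
    have hi₁ : σ₁.nat (20, 0, 0) = i := by rw [hc.frame.nat 20 (by simp), hi]
    have hn₁ : σ₁.nat (0, 0, 0) = n := by rw [hc.frame.nat 0 (by simp), hn]
    have hthr₁ : σ₁.thr q = σ.thr q := hc.frame.thr (by simp) q
    refine Runs.seq ((findNearest_runs (i := i) hn₁ hn1 hi₁).imp ?_)
    rintro σ₃ ⟨hF, D, hD, hv, hDv, hmin⟩
    set v := σ₃.nat (8, n - 1, 0) with hvdef
    have hc₃ := hc.congr_frame (hF.mono (by simp) (by simp) (by simp))
    have hn₃ : σ₃.nat (0, 0, 0) = n := by rw [hF.nat 0 (by simp), hn₁]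
    have hi₃ : σ₃.nat (20, 0, 0) = i := by rw [hF.nat 20 (by simp), hi₁]
    have h17₃ : σ₃.nat (17, 0, 0) = 1 := by rw [hF.nat 17 (by simp), h17]
    have hthr₃ : σ₃.thr q = σ.thr q := by rw [hF.thr (by simp), hthr₁]
    have halive : ∀ j, 1 ≤ σ₁.nat (3, j, 0) ↔ 1 ≤ σ.nat (3, j, 0) ∧ ∀ t < h, b t ≠ j := by
      intro j
      rw [hc.alive j]
      split_ifs with h4
      · obtain ⟨t, ht, rfl⟩ := h4
        simp only [nonpos_iff_eq_zero, one_ne_zero, false_iff, not_and, not_forall]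
        exact fun _ => ⟨t, ht, fun h => h rfl⟩
      · push Not at h4
        exact ⟨fun h5 => ⟨h5, h4⟩, fun h5 => h5.1⟩
    have hD' : ∀ j ∈ σ.slots n 3, j ≠ i → (∀ t < h, b t ≠ j) →
        D j = d.dist (grow σ.slotClu i b h) (σ.slotClu j) := by
      intro j hj hji hjb
      rw [Store.mem_slots] at hj
      rw [hD j hj.1, if_pos ⟨(halive j).2 ⟨hj.2, hjb⟩, hji⟩, hc.clu, hc.clu_ne j hji]
    have hbest : best.eval σ₃ = v := by simp only [best, vec_eval, NatExp.eval, sc_eval, hn₃, hvdef]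
    have hcond : (Cond.realLe (.get (vcell 3 best)) (thrExp q)).holds σ₃ ↔ D v ≤ σ.thr q := by
      simp only [Cond.holds, RealExp.eval, vcell_addr, hbest, thrExp_eval, hthr₃, ← hDv]
    refine Runs.ite (fun hle => ?_) (fun hgt => ?_)
    · rw [hcond] at hle
      have hadm : 1 ≤ σ₁.nat (3, v, 0) ∧ v ≠ i := by
        by_contra hcon
        rw [hD v hv, if_neg hcon, hthr₁] at hle
        linarith
      have hal := (halive v).1 hadm.1
      have hvS : v ∈ σ.slots n 3 := Store.mem_slots.2 ⟨hv, hal.1⟩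
      refine Runs.of_straight (p := absorb) (by simp [absorb, Cmd.Straight]) ?_
      refine ⟨f - 1, by omega, Function.update b h v, h + 1,
        absorb_cascadeStore hc₃ hi₃ (by rw [hn₃]) hadm.2,
        hcas.succ hvS hadm.2 hal.2 ?_ ?_, Or.inl ⟨?_, by omega⟩⟩
      · rwa [← hD' v hvS hadm.2 hal.2]
      · intro j hj hji hjb
        rw [← hD' v hvS hadm.2 hal.2, ← hD' j hj hji hjb]
        exact hmin j (Store.mem_slots.1 hj).1
      · rw [absorb_den σ₃ hi₃ (by rw [hn₃])]
        simpa using h17₃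
    · rw [hcond, not_le] at hgt
      refine (Runs.of_straight (p := .setNat (scell 17) (.lit 0)) trivial ?_).mono
        (by decide) (by decide)
      refine ⟨0, by omega, b, h, hc₃.congr_frame ((Frame.refl _ _ _ _).update_nat
        (by simp [scell])),
        hcas, Or.inr ⟨by simp [Cmd.den, NatExp.eval], ?_⟩⟩
      intro j hj hji hjb
      rw [← hD' j hj hji hjb]
      exact hgt.trans_le (hmin j (Store.mem_slots.1 hj).1)

end

/-! ### Parallel cascades -/

/-- The cascades of the selected slots, each in its own thread. -/
def runCascades (q : ℕ) : Cmd :=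
  .par 20 (sc 0) (.ite (.natLe (.lit 1) (vec 10 (sc 20))) (cascade q) skip)

/-- The work of a cascade. -/
def cascadeWork (K k n : ℕ) : ℕ :=
  1 + (1 + (Linkage.lengthNum K k (lg n) * (1 + (1 + n * (1 + 5) + 8 * n * lg n + (1 + 5))) + 1))

/-- The depth of a cascade. -/
def cascadeDepth (K k n : ℕ) : ℕ :=
  1 + (1 + (Linkage.lengthNum K k (lg n) * (1 + (1 + Nat.clog 2 n + 5 + lg n * (lg n + 6) +
    (1 + 5))) + 1))

section

variable {k : ℕ} {d : Linkage k}

open Linkage in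
open scoped Classical in
/-- The threads of a parallel loop see only their own writes, so each cascade runs as if it were the
only one. The joined store is the result of all of them: a slot remains if no cascade has absorbed
it, and it remains a candidate if it is not a seed either. -/
theorem runCascades_runs {K : ℕ} (hd : d.WellBehaved K) {P : Finset (Pt k)} {σ : Store k} {n q : ℕ}
    (hn : σ.nat (0, 0, 0) = n) (hn1 : 1 ≤ n) (hP : P.card = n)
    (hTS : σ.slots n 10 ⊆ σ.slots n 3) (hL : 0 < σ.real (0, 0, 0))
    (hthr : σ.thr q ≤ 2 * σ.real (0, 0, 0))
    (hX : d.Clustering P (σ.real (0, 0, 0)) (σ.slots n 3) σ.slotClu)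
    (hlen : ∀ i < n, σ.nat (7, i, 0) = 0) :
    Runs d (runCascades q) σ (1 + n * (1 + (1 + cascadeWork K k n)))
      (1 + Nat.clog 2 n + (1 + cascadeDepth K k n)) fun σ' =>
      Frame [3, 5, 6, 7, 8, 15, 17] [3] [1] σ σ' ∧ ∃ (b : ℕ → ℕ → ℕ) (h : ℕ → ℕ),
        (∀ i, i ∉ σ.slots n 10 → h i = 0) ∧
        (∀ i ∈ σ.slots n 10, d.Cascade (σ.thr q) (σ.slots n 3) σ.slotClu i (b i) (h i) ∧
          d.CascadeDone (σ.thr q) (σ.slots n 3) σ.slotClu i (b i) (h i)) ∧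
        (∀ i < n, σ'.nat (7, i, 0) = h i) ∧ (∀ i, ∀ s < h i, σ'.nat (6, i, s) = b i s) ∧
        (∀ i < n, σ'.slotClu i = after σ.slotClu b h i) ∧
        σ'.slots n 3 = remaining (σ.slots n 3) b h ∧
        σ'.slots n 5 = (remaining (σ.slots n 5) b h) \ σ.slots n 10 := by
  have hpar := Runs.par (d := d) (a := 20) (m := sc 0) (σ := σ)
    (W := 1 + cascadeWork K k n) (T := 1 + cascadeDepth K k n)
    (p := .ite (.natLe (.lit 1) (vec 10 (sc 20))) (cascade q) skip)
    (Qt := fun i τ => ∃ b h, (i ∉ σ.slots n 10 → h = 0) ∧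
      (i ∈ σ.slots n 10 → CascadeStore (σ.thread 20 i) i b h τ ∧
        d.Cascade (σ.thr q) (σ.slots n 3) σ.slotClu i b h ∧
        d.CascadeDone (σ.thr q) (σ.slots n 3) σ.slotClu i b h) ∧
      (i ∉ σ.slots n 10 → τ = σ.thread 20 i))
    (Q := fun σ' => Frame [3, 5, 6, 7, 8, 15, 17] [3] [1] σ σ' ∧ ∃ (b : ℕ → ℕ → ℕ) (h : ℕ → ℕ),
        (∀ i, i ∉ σ.slots n 10 → h i = 0) ∧
        (∀ i ∈ σ.slots n 10, d.Cascade (σ.thr q) (σ.slots n 3) σ.slotClu i (b i) (h i) ∧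
          d.CascadeDone (σ.thr q) (σ.slots n 3) σ.slotClu i (b i) (h i)) ∧
        (∀ i < n, σ'.nat (7, i, 0) = h i) ∧ (∀ i, ∀ s < h i, σ'.nat (6, i, s) = b i s) ∧
        (∀ i < n, σ'.slotClu i = after σ.slotClu b h i) ∧
        σ'.slots n 3 = remaining (σ.slots n 3) b h ∧
        σ'.slots n 5 = (remaining (σ.slots n 5) b h) \ σ.slots n 10) ?_ ?_
  · rw [runCascades]
    simpa only [sc_eval, hn] using hpar
  · intro i hi
    rw [sc_eval, hn] at hi
    have hF := Frame.thread σ 20 i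
    have e10 : (σ.thread 20 i).nat (10, i, 0) = σ.nat (10, i, 0) := hF.nat 10 (by simp) _ _
    have e20 : (σ.thread 20 i).nat (20, 0, 0) = i := by simp [Store.thread]
    have hcond : (Cond.natLe (.lit 1) (vec 10 (sc 20))).holds (σ.thread 20 i) ↔
        i ∈ σ.slots n 10 := by
      simp only [Cond.holds, NatExp.eval, vec_eval, sc_eval, e20, e10, Store.mem_slots, hi,
        true_and]
    refine Runs.ite (fun hc => ?_) (fun hc => ?_)
    · rw [hcond] at hc
      have hr := cascade_runs (q := q) (i := i) (n := n) (σ := σ.thread 20 i) hd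
        (by rw [hF.nat 0 (by simp), hn]) hn1 hP e20
        (by rw [hF.slots n (by simp)]; exact hTS hc) hL hthr
        (by rw [hF.slots n (by simp), hF.slotClu (by simp)]; exact hX)
        (by rw [hF.nat 7 (by simp), hlen i hi])
      refine hr.imp ?_
      rintro τ ⟨b, h, h1, h2, h3⟩
      rw [hF.slots n (by simp), hF.slotClu (by simp)] at h2 h3
      exact ⟨b, h, fun h => absurd hc h, fun _ => ⟨h1, h2, h3⟩, fun h => absurd hc h⟩
    · rw [hcond] at hc
      refine (Runs.of_straight (p := skip) skip_straight ?_).mono ?_ ?_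
      · exact ⟨fun _ => 0, 0, fun _ => rfl, fun h => absurd h hc, fun _ => skip_den _⟩
      all_goals simp only [skip_size, cascadeWork, cascadeDepth]; omega
  · intro τ hτ
    rw [sc_eval, hn] at hτ ⊢
    have hτ' : ∀ i, ∃ b h, (i ∉ σ.slots n 10 → h = 0) ∧ (i < n →
        (i ∈ σ.slots n 10 → CascadeStore (σ.thread 20 i) i b h (τ i) ∧
          d.Cascade (σ.thr q) (σ.slots n 3) σ.slotClu i b h ∧
          d.CascadeDone (σ.thr q) (σ.slots n 3) σ.slotClu i b h) ∧
        (i ∉ σ.slots n 10 → τ i = σ.thread 20 i)) := by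
      intro i
      by_cases hi : i < n
      · obtain ⟨b, h, h1, h2, h3⟩ := hτ i hi
        exact ⟨b, h, h1, fun _ => ⟨h2, h3⟩⟩
      · exact ⟨fun _ => 0, 0, fun _ => rfl, fun h => absurd h hi⟩
    choose b h h0 hcase using hτ'
    set T := σ.slots n 10 with hT
    have hTn : ∀ i ∈ T, i < n := fun i hi => (Store.mem_slots.1 hi).1
    have hst : ∀ i ∈ T, CascadeStore (σ.thread 20 i) i (b i) (h i) (τ i) := fun i hi =>
      ((hcase i (hTn i hi)).1 hi).1
    have hun : ∀ i < n, i ∉ T → τ i = σ.thread 20 i := fun i hi hiT => (hcase i hi).2 hiT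
    have hth : ∀ i a j c, a ≠ 20 → (σ.thread 20 i).nat (a, j, c) = σ.nat (a, j, c) :=
      fun i a j c ha => (Frame.thread σ 20 i).nat a (by simpa using ha) _ _
    -- the cells of arrays `3` and `5` can only be cleared, and only by threads of `T`
    have hclear : ∀ a, a = 3 ∨ a = 5 → ∀ j < n, (1 ≤ (σ.join 20 n τ).nat (a, j, 0) ↔
        1 ≤ σ.nat (a, j, 0) ∧ (∀ i, ∀ s < h i, b i s ≠ j) ∧ (a = 5 → j ∉ T)) := by
      intro a ha j hj
      have hval : ∀ i < n, (τ i).nat (a, j, 0) =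
          if (∃ s < h i, b i s = j) ∨ (a = 5 ∧ j = i ∧ i ∈ T) then 0 else σ.nat (a, j, 0) := by
        intro i hi
        by_cases hiT : i ∈ T
        · rcases ha with rfl | rfl
          · rw [(hst i hiT).alive j, hth i 3 _ _ (by decide)]; simp
          · rw [(hst i hiT).old j, hth i 5 _ _ (by decide)]; simp [hiT, or_comm]
        · have h3 : h i = 0 := h0 i hiT
          rw [hun i hi hiT, hth i a _ _ (by omega)]
          simp [h3, hiT]
      have hmem : ∀ i s, s < h i → i < n := fun i s hs => by
        by_contra hcon
        have := h0 i fun hiT => hcon (hTn i hiT)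
        omega
      rcases Store.join_nat_cases (σ := σ) (a := 20) (m := n) (τ := τ) (x := (a, j, 0))
        (by simp; omega) with ⟨h1, h2⟩ | ⟨i, hi, h1, h2⟩
      · rw [h1]
        refine ⟨fun h3 => ⟨h3, fun i s hs e => ?_, fun ha5 hjT => ?_⟩, fun h3 => h3.1⟩
        · have h4 := h2 i (hmem i s hs)
          rw [hval i (hmem i s hs), if_pos (Or.inl ⟨s, hs, e⟩)] at h4
          omega
        · have h4 := h2 j hj
          rw [hval j hj, if_pos (Or.inr ⟨ha5, rfl, hjT⟩)] at h4
          omega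
      · rw [h1]
        rw [hval i hi] at h2 ⊢
        split_ifs at h2 ⊢ with h3
        · refine ⟨fun h4 => by omega, fun ⟨_, h5, h6⟩ => ?_⟩
          rcases h3 with ⟨s, hs, e⟩ | ⟨ha5, hji, hiT⟩
          · exact absurd e (h5 i s hs)
          · exact absurd (hji ▸ hiT) (h6 ha5)
        · exact absurd rfl h2
    refine ⟨Frame.join fun i hi => ?_, b, h, h0, fun i hi => ((hcase i (hTn i hi)).1 hi).2,
      fun i hi => ?_, fun i s hs => ?_, fun i hi => ?_, ?_, ?_⟩
    · by_cases hiT : i ∈ T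
      · exact (hst i hiT).frame
      · rw [hun i hi hiT]; exact Frame.refl _ _ _ _
    · rw [Store.join_nat_of_owner (by simp) hi]
      · by_cases hiT : i ∈ T
        · exact (hst i hiT).len
        · rw [hun i hi hiT, hth _ _ _ _ (by decide), h0 i hiT]; exact hlen i hi
      · intro j hj hji
        by_cases hjT : j ∈ T
        · exact (hst j hjT).len_ne i hji.symm
        · rw [hun j hj hjT]
    · have hiT : i ∈ T := by
        by_contra hcon
        rw [h0 i hcon] at hs; omega
      rw [Store.join_nat_of_owner (by simp) (hTn i hiT)]
      · exact (hst i hiT).log s hs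
      · intro j hj hji
        by_cases hjT : j ∈ T
        · exact (hst j hjT).log_ne i hji.symm s
        · rw [hun j hj hjT]
    · have : (σ.join 20 n τ).slotClu i = (τ i).slotClu i := by
        refine Store.join_clu_of_owner hi fun j hj hji => ?_
        by_cases hjT : j ∈ T
        · exact (hst j hjT).clu_ne i hji.symm
        · rw [hun j hj hjT]; rfl
      rw [this, after]
      by_cases hiT : i ∈ T
      · exact (hst i hiT).clu
      · rw [hun i hi hiT, h0 i hiT]; rfl
    · ext j
      rw [Store.mem_slots, mem_remaining, Store.mem_slots]
      constructor
      · rintro ⟨hj, h1⟩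
        rw [hclear 3 (Or.inl rfl) j hj] at h1
        exact ⟨⟨hj, h1.1⟩, h1.2.1⟩
      · rintro ⟨⟨hj, h1⟩, h2⟩
        exact ⟨hj, (hclear 3 (Or.inl rfl) j hj).2 ⟨h1, h2, fun h => absurd h (by decide)⟩⟩
    · ext j
      rw [Store.mem_slots, Finset.mem_sdiff, mem_remaining, Store.mem_slots]
      constructor
      · rintro ⟨hj, h1⟩
        rw [hclear 5 (Or.inr rfl) j hj] at h1
        exact ⟨⟨⟨hj, h1.1⟩, h1.2.1⟩, h1.2.2 rfl⟩
      · rintro ⟨⟨⟨hj, h1⟩, h2⟩, h3⟩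
        exact ⟨hj, (hclear 5 (Or.inr rfl) j hj).2 ⟨h1, h2, fun _ => h3⟩⟩

end

/-! ### Writing the merges -/

/-- Prefix sums of the lengths of the cascades. -/
def positions : Cmd :=
  .seq (.par 20 (sc 0) (.setNat (vcell 8 (sc 20)) (vec 7 (sc 20)))) (doubling (.lit 1) combAdd)

/-- Write the next merge of the cascade of slot `i`. The merge at position `t` creates node `n + t`,
which becomes the node of slot `i`. -/
def emitStep : Cmd :=
  .seq (.setNat ⟨2, sc 15, .lit 0⟩ (vec 4 (sc 20)))
  (.seq (.setNat ⟨2, sc 15, .lit 1⟩ (vec 4 (.get 6 (sc 20) (sc 17))))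
  (.seq (.union (vcell 0 (.add (sc 0) (sc 15))) (vcell 0 (vec 4 (sc 20)))
    (vcell 0 (vec 4 (.get 6 (sc 20) (sc 17)))))
  (.seq (.setNat (vcell 4 (sc 20)) (.add (sc 0) (sc 15)))
  (.seq (.setNat (scell 15) (.add (sc 15) (.lit 1)))
    (.setNat (scell 17) (.add (sc 17) (.lit 1)))))))

/-- Write the merges of the cascade of slot `i` to the output. -/
def emit : Cmd :=
  .seq (.setNat (scell 17) (.lit 0))
  (.seq (.setNat (scell 15) (.add (sc 11) (.sub (vec 8 (sc 20)) (vec 7 (sc 20)))))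
    (.loop (.not (.natLe (vec 7 (sc 20)) (sc 17))) emitStep))

section

variable {k : ℕ} {d : Linkage k}

theorem positions_runs {σ : Store k} {n : ℕ} (hn : σ.nat (0, 0, 0) = n) (hn1 : 1 ≤ n) :
    Runs d positions σ (1 + n * (1 + 1) + 8 * n * lg n)
      (1 + Nat.clog 2 n + 1 + lg n * (lg n + 6)) fun σ' =>
      Frame [8, 15] [] [] σ σ' ∧
      ∀ i < n, σ'.nat (8, i, 0) = ∑ l ∈ Finset.range (i + 1), σ.nat (7, l, 0) := by
  refine Runs.seq (Runs.par_straight (p := .setNat (vcell 8 (sc 20)) (vec 7 (sc 20))) trivial hn ?_)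
  set σ₁ := σ.join 20 n fun i =>
    Cmd.den d (.setNat (vcell 8 (sc 20)) (vec 7 (sc 20))) (σ.thread 20 i) with hσ₁
  have hF₁ : Frame [8, 15] [] [] σ σ₁ := Frame.join fun i _ =>
    (Frame.refl _ _ _ _).update_nat (by simp [vcell])
  have hV₁ : ∀ i < n, σ₁.nat (8, i, 0) = σ.nat (7, i, 0) := by
    intro i hi
    rw [hσ₁, Store.join_nat_of_owner (by simp) hi]
    · simp [Cmd.den, Store.thread]
    · intro j hj hji
      simp only [Cmd.den, vcell_addr, sc_eval, Store.thread, Function.update_self]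
      rw [Function.update_of_ne]
      simpa using hji.symm
  clear_value σ₁
  have key := Runs.doubling (d := d) (s₀ := .lit 1) (comb := combAdd) trivial (by decide)
    (op := fun v v' => v + v')
    (G := fun j c v => v = ∑ l ∈ Finset.Ico (j + 1 - c) (j + 1), σ.nat (7, l, 0))
    (σ := σ₁) (n := n) (s := 1) (by rw [hF₁.nat 0 (by simp), hn]) hn1 rfl le_rfl
    (fun ς _ => combAdd_den ς) ?_ ?_ ?_
  · refine key.imp ?_
    rintro σ' ⟨hF, c, hc, hG⟩
    refine ⟨hF₁.trans hF, fun i hi => ?_⟩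
    rw [hG i hi, show i + 1 - c = 0 by omega, Finset.range_eq_Ico]
  · intro j hj
    rw [hV₁ j hj]; simp
  · intro j hj c v v' hle h1 h2
    rw [mul_one] at hle h2
    rw [h1, h2, add_comm, show j - c + 1 = j + 1 - c by omega,
      Finset.sum_Ico_consecutive _ (by omega) (by omega),
      show j + 1 - c - c = j + 1 - 2 * c by omega]
  · intro j hj c v hlt h1
    rw [h1, show j + 1 - c = 0 by omega, show j + 1 - 2 * c = 0 by omega]

/-- The node number of the cluster of slot `i` after `s` merges that are written from position `t`
on. -/
def nodeAfter (n v t : ℕ) : ℕ → ℕ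
  | 0 => v
  | s + 1 => n + (t + s)

open Linkage in
/-- The store after `s` merges of the cascade `b` of slot `i` have been written from position `t`
on. -/
structure EmitStore (σ₀ : Store k) (X : ℕ → Finset (Pt k)) (n i t : ℕ) (b : ℕ → ℕ) (s : ℕ)
    (σ : Store k) : Prop where
  frame : Frame [2, 4, 15, 17] [] [0] σ₀ σ
  node : σ.nat (4, i, 0) = nodeAfter n (σ₀.nat (4, i, 0)) t s
  node_ne : ∀ j ≠ i, σ.nat (4, j, 0) = σ₀.nat (4, j, 0)
  fst : ∀ u < s, σ.nat (2, t + u, 0) = nodeAfter n (σ₀.nat (4, i, 0)) t u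
  snd : ∀ u < s, σ.nat (2, t + u, 1) = σ₀.nat (4, b u, 0)
  out_ne : ∀ v, v < t ∨ t + s ≤ v → ∀ c, σ.nat (2, v, c) = σ₀.nat (2, v, c)
  clu : ∀ u < s, σ.clu (0, n + (t + u), 0) = grow X i b (u + 1)
  clu_ne : ∀ v, v < n + t ∨ n + (t + s) ≤ v → σ.clu (0, v, 0) = σ₀.clu (0, v, 0)

open Linkage in
theorem emitStep_emitStore {σ₀ σ : Store k} {X : ℕ → Finset (Pt k)} {n i t s : ℕ} {b : ℕ → ℕ}
    (hn : σ.nat (0, 0, 0) = n) (hi : σ.nat (20, 0, 0) = i) (h15 : σ.nat (15, 0, 0) = t + s)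
    (h17 : σ.nat (17, 0, 0) = s) (hb : σ.nat (6, i, s) = b s) (hbi : b s ≠ i)
    (hnode : σ₀.nat (4, i, 0) < n + t) (hnodeb : σ₀.nat (4, b s, 0) < n + t)
    (hclu : σ₀.clu (0, σ₀.nat (4, i, 0), 0) = X i)
    (hclub : σ₀.clu (0, σ₀.nat (4, b s, 0), 0) = X (b s))
    (c : EmitStore σ₀ X n i t b s σ) : EmitStore σ₀ X n i t b (s + 1) (emitStep.den d σ) ∧
      (emitStep.den d σ).nat (15, 0, 0) = t + (s + 1) ∧
      (emitStep.den d σ).nat (17, 0, 0) = s + 1 := by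
  have hcur : σ.clu (0, nodeAfter n (σ₀.nat (4, i, 0)) t s, 0) = grow X i b s := by
    cases s with
    | zero => rw [nodeAfter, c.clu_ne _ (Or.inl hnode), hclu]; rfl
    | succ s => exact c.clu s (by omega)
  have hcurb : σ.clu (0, σ₀.nat (4, b s, 0), 0) = X (b s) := by
    rw [c.clu_ne _ (Or.inl hnodeb), hclub]
  have hnb : σ.nat (4, b s, 0) = σ₀.nat (4, b s, 0) := c.node_ne _ hbi
  have hden : emitStep.den d σ = { σ with
      nat := Function.update (Function.update (Function.update (Function.update (Function.update
        σ.nat (2, t + s, 0) (nodeAfter n (σ₀.nat (4, i, 0)) t s)) (2, t + s, 1)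
        (σ₀.nat (4, b s, 0))) (4, i, 0) (n + (t + s))) (15, 0, 0) (t + s + 1)) (17, 0, 0) (s + 1)
      clu := Function.update σ.clu (0, n + (t + s), 0) (grow X i b (s + 1)) } := by
    simp [emitStep, Cmd.den, vcell, scell, Cell.addr, NatExp.eval, hn, hi, h15, h17, hb, hnb,
      c.node, hcur, hcurb, grow]
  rw [hden]
  refine ⟨⟨?_, ?_, fun j hj => ?_, fun u hu => ?_, fun u hu => ?_, fun v hv e => ?_,
    fun u hu => ?_, fun v hv => ?_⟩, ?_, ?_⟩
  · exact Frame.update_clu (σ' := { σ with nat := _ })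
      (((((c.frame.update_nat (by simp)).update_nat (by simp)).update_nat
      (by simp)).update_nat (by simp)).update_nat (by simp)) (by simp)
  · simp [nodeAfter]
  · simp [hj, c.node_ne j hj]
  · rcases Nat.lt_succ_iff_lt_or_eq.1 hu with h1 | rfl
    · simp [h1.ne, c.fst u h1]
    · simp
  · rcases Nat.lt_succ_iff_lt_or_eq.1 hu with h1 | rfl
    · simp [h1.ne, c.snd u h1]
    · simp
  · have h1 : v ≠ t + s := by omega
    simp [h1, c.out_ne v (by omega)]
  · rcases Nat.lt_succ_iff_lt_or_eq.1 hu with h1 | rfl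
    · simp [h1.ne, c.clu u h1]
    · simp
  · have h1 : v ≠ n + (t + s) := by omega
    simp [h1, c.clu_ne v (by omega)]
  · simp; omega
  · simp

open Linkage in
/-- The number of merges of a cascade is bounded by `H`, in order that all threads have a common
running time. -/
theorem emit_runs {σ : Store k} {X : ℕ → Finset (Pt k)} {n i t h H : ℕ} {b : ℕ → ℕ}
    (hn : σ.nat (0, 0, 0) = n) (hi : σ.nat (20, 0, 0) = i) (hlen : σ.nat (7, i, 0) = h)
    (hH : h ≤ H) (ht : σ.nat (11, 0, 0) + (σ.nat (8, i, 0) - σ.nat (7, i, 0)) = t)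
    (hb : ∀ s < h, σ.nat (6, i, s) = b s) (hbi : ∀ s < h, b s ≠ i)
    (hnode : 0 < h → σ.nat (4, i, 0) < n + t ∧ σ.clu (0, σ.nat (4, i, 0), 0) = X i)
    (hnodeb : ∀ s < h, σ.nat (4, b s, 0) < n + t ∧ σ.clu (0, σ.nat (4, b s, 0), 0) = X (b s)) :
    Runs d emit σ (1 + (1 + (H * (1 + 6) + 1))) (1 + (1 + (H * (1 + 6) + 1)))
      (EmitStore σ X n i t b h) := by
  refine Runs.seq (Runs.of_straight (p := .setNat (scell 17) (.lit 0)) trivial ?_)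
  refine Runs.seq (Runs.of_straight
    (p := .setNat (scell 15) (.add (sc 11) (.sub (vec 8 (sc 20)) (vec 7 (sc 20))))) trivial ?_)
  have hloop := Runs.loop (d := d) (b := .not (.natLe (vec 7 (sc 20)) (sc 17))) (p := emitStep)
    (W := 6) (T := 6)
    (fun f σ' => ∃ s, s + f = h ∧ EmitStore σ X n i t b s σ' ∧
      σ'.nat (15, 0, 0) = t + s ∧ σ'.nat (17, 0, 0) = s) ?_ h
    (Cmd.den d (.setNat (scell 15) (.add (sc 11) (.sub (vec 8 (sc 20)) (vec 7 (sc 20)))))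
      (Cmd.den d (.setNat (scell 17) (.lit 0)) σ)) ?_
  · refine (hloop.imp ?_).mono (by gcongr) (by gcongr)
    rintro σ' ⟨hc, f, s, hs, hE, h15, h17⟩
    simp only [Cond.holds, vec_eval, sc_eval, not_not, h17] at hc
    rw [hE.frame.nat 20 (by simp), hi, hE.frame.nat 7 (by simp), hlen] at hc
    rwa [show s = h by omega] at hE
  · rintro f σ' ⟨s, hs, hE, h15, h17⟩ hc
    simp only [Cond.holds, vec_eval, sc_eval, h17] at hc
    rw [hE.frame.nat 20 (by simp), hi, hE.frame.nat 7 (by simp), hlen] at hc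
    have hlt : s < h := by omega
    refine Runs.of_straight (p := emitStep) (by simp [emitStep, Cmd.Straight]) ?_
    refine ⟨f - 1, by omega, s + 1, by omega, ?_⟩
    exact emitStep_emitStore (by rw [hE.frame.nat 0 (by simp), hn])
      (by rw [hE.frame.nat 20 (by simp), hi]) h15 h17
      (by rw [hE.frame.nat 6 (by simp), hb s hlt]) (hbi s hlt) (hnode (by omega)).1 (hnodeb s hlt).1
      (hnode (by omega)).2 (hnodeb s hlt).2 hE
  · refine ⟨0, by simp, ⟨?_, ?_, fun j hj => ?_, by simp, by simp, fun v _ e => ?_, by simp,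
      fun v _ => rfl⟩, ?_, ?_⟩
    · exact ((Frame.refl _ _ _ _).update_nat (by simp [scell])).update_nat (by simp [scell])
    · simp [Cmd.den, nodeAfter]
    · simp [Cmd.den]
    · simp [Cmd.den]
    · simp [Cmd.den, NatExp.eval, hi, ht]
    · simp [Cmd.den, NatExp.eval]

end

theorem sum_range_add_le {h : ℕ → ℕ} {i j : ℕ} (hij : i < j) :
    ∑ l ∈ Finset.range i, h l + h i ≤ ∑ l ∈ Finset.range j, h l := by
  rw [← Finset.sum_range_succ]
  exact Finset.sum_le_sum_of_subset (Finset.range_subset_range.2 hij)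

theorem exists_eq_sum_range_add {h : ℕ → ℕ} {n v : ℕ} (hv : v < ∑ l ∈ Finset.range n, h l) :
    ∃ i < n, ∃ u < h i, v = ∑ l ∈ Finset.range i, h l + u := by
  induction n with
  | zero => simp at hv
  | succ n ih =>
    by_cases h1 : v < ∑ l ∈ Finset.range n, h l
    · obtain ⟨i, hi, h2⟩ := ih h1
      exact ⟨i, by omega, h2⟩
    · rw [Finset.sum_range_succ] at hv
      exact ⟨n, by omega, v - ∑ l ∈ Finset.range n, h l, by omega, by omega⟩

/-- Write the merges of all cascades to the output. -/
def emitAll : Cmd :=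
  .seq (.par 20 (sc 0) emit)
    (.setNat (scell 11) (.add (sc 11) (vec 8 (.sub (sc 0) (.lit 1)))))

section

variable {k : ℕ} {d : Linkage k}

open Linkage in
/-- The store after the merges `b i s`, `s < h i`, of all slots `i` have been written to the output,
ordered by slots. -/
structure EmitAllStore (σ₀ : Store k) (X : ℕ → Finset (Pt k)) (n cnt : ℕ) (b : ℕ → ℕ → ℕ)
    (h : ℕ → ℕ) (σ : Store k) : Prop where
  frame : Frame [2, 4, 11, 15, 17] [] [0] σ₀ σ
  count : σ.nat (11, 0, 0) = cnt + ∑ l ∈ Finset.range n, h l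
  node : ∀ i < n, σ.nat (4, i, 0) =
    nodeAfter n (σ₀.nat (4, i, 0)) (cnt + ∑ l ∈ Finset.range i, h l) (h i)
  fst : ∀ i < n, ∀ u < h i, σ.nat (2, cnt + ∑ l ∈ Finset.range i, h l + u, 0) =
    nodeAfter n (σ₀.nat (4, i, 0)) (cnt + ∑ l ∈ Finset.range i, h l) u
  snd : ∀ i < n, ∀ u < h i, σ.nat (2, cnt + ∑ l ∈ Finset.range i, h l + u, 1) =
    σ₀.nat (4, b i u, 0)
  out_ne : ∀ v < cnt, ∀ c, σ.nat (2, v, c) = σ₀.nat (2, v, c)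
  clu : ∀ i < n, ∀ u < h i, σ.clu (0, n + (cnt + ∑ l ∈ Finset.range i, h l + u), 0) =
    grow X i (b i) (u + 1)
  clu_ne : ∀ v < n + cnt, σ.clu (0, v, 0) = σ₀.clu (0, v, 0)

open Linkage in
/-- The threads write to disjoint intervals of positions, so that none of them interferes with
another. -/
theorem emitAll_runs {σ : Store k} {X : ℕ → Finset (Pt k)} {n cnt H : ℕ} {b : ℕ → ℕ → ℕ}
    {h : ℕ → ℕ} (hn : σ.nat (0, 0, 0) = n) (hn1 : 1 ≤ n) (hcnt : σ.nat (11, 0, 0) = cnt)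
    (hlen : ∀ i < n, σ.nat (7, i, 0) = h i) (hH : ∀ i, h i ≤ H)
    (hV : ∀ i < n, σ.nat (8, i, 0) = ∑ l ∈ Finset.range (i + 1), h l)
    (hb : ∀ i, ∀ s < h i, σ.nat (6, i, s) = b i s) (hbi : ∀ i, ∀ s < h i, b i s ≠ i)
    (hnode : ∀ i, 0 < h i → σ.nat (4, i, 0) < n + cnt ∧ σ.clu (0, σ.nat (4, i, 0), 0) = X i)
    (hnodeb : ∀ i, ∀ s < h i, σ.nat (4, b i s, 0) < n + cnt ∧
      σ.clu (0, σ.nat (4, b i s, 0), 0) = X (b i s)) :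
    Runs d emitAll σ (1 + n * (1 + (1 + (1 + (H * (1 + 6) + 1)))) + 1)
      (1 + Nat.clog 2 n + (1 + (1 + (H * (1 + 6) + 1))) + 1)
      (EmitAllStore σ X n cnt b h) := by
  have hpar := Runs.par (d := d) (a := 20) (m := sc 0) (σ := σ) (p := emit)
    (W := 1 + (1 + (H * (1 + 6) + 1))) (T := 1 + (1 + (H * (1 + 6) + 1)))
    (Qt := fun i τ => EmitStore (σ.thread 20 i) X n i (cnt + ∑ l ∈ Finset.range i, h l)
      (b i) (h i) τ)
    (Q := fun σ' => Runs d (.setNat (scell 11) (.add (sc 11) (vec 8 (.sub (sc 0) (.lit 1)))))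
      σ' 1 1 (EmitAllStore σ X n cnt b h)) ?_ ?_
  · rw [sc_eval, hn] at hpar
    exact Runs.seq hpar
  · intro i hi
    rw [sc_eval, hn] at hi
    have hF := Frame.thread σ 20 i
    refine emit_runs (by rw [hF.nat 0 (by simp), hn]) (by simp [Store.thread])
      (by rw [hF.nat 7 (by simp), hlen i hi]) (hH i) ?_ (fun s hs => ?_) (hbi i) (fun h0 => ?_)
      (fun s hs => ?_)
    · rw [hF.nat 11 (by simp), hF.nat 8 (by simp), hF.nat 7 (by simp), hlen i hi, hV i hi, hcnt,
        Finset.sum_range_succ]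
      omega
    · rw [hF.nat 6 (by simp), hb i s hs]
    · rw [hF.nat 4 (by simp), hF.clu 0 (by simp)]
      exact ⟨by have := (hnode i h0).1; omega, (hnode i h0).2⟩
    · rw [hF.nat 4 (by simp), hF.clu 0 (by simp)]
      exact ⟨by have := (hnodeb i s hs).1; omega, (hnodeb i s hs).2⟩
  · intro τ hτ
    rw [sc_eval, hn] at hτ ⊢
    set σ₁ := σ.join 20 n τ with hσ₁
    have hth4 : ∀ i j, (σ.thread 20 i).nat (4, j, 0) = σ.nat (4, j, 0) := fun i j =>
      (Frame.thread σ 20 i).nat 4 (by simp) _ _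
    have hF₁ : Frame [2, 4, 15, 17] [] [0] σ σ₁ := Frame.join fun i hi => (hτ i hi).frame
    -- the output ranges of different slots are disjoint
    have hsep : ∀ i j, i ≠ j → ∀ u < h i,
        cnt + ∑ l ∈ Finset.range i, h l + u < cnt + ∑ l ∈ Finset.range j, h l ∨
        cnt + ∑ l ∈ Finset.range j, h l + h j ≤ cnt + ∑ l ∈ Finset.range i, h l + u := by
      intro i j hij u hu
      rcases Nat.lt_or_gt_of_ne hij with h1 | h1
      · have := sum_range_add_le (h := h) h1; omega
      · have := sum_range_add_le (h := h) h1; omega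
    have hout : ∀ i < n, ∀ u < h i, ∀ c, σ₁.nat (2, cnt + ∑ l ∈ Finset.range i, h l + u, c) =
        (τ i).nat (2, cnt + ∑ l ∈ Finset.range i, h l + u, c) := fun i hi u hu c =>
      Store.join_nat_of_owner (by simp) hi fun j hj hji => (hτ j hj).out_ne _
        (hsep i j hji.symm u hu) c
    have hval : (Cmd.den d (.setNat (scell 11) (.add (sc 11) (vec 8 (.sub (sc 0) (.lit 1))))) σ₁) =
        { σ₁ with nat := Function.update σ₁.nat (11, 0, 0) (cnt + ∑ l ∈ Finset.range n, h l) } := by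
      simp only [Cmd.den, scell_addr, NatExp.eval, sc_eval, vec_eval, hF₁.nat 11 (by simp),
        hF₁.nat 0 (by simp), hF₁.nat 8 (by simp), hn, hcnt, hV (n - 1) (by omega),
        Nat.sub_add_cancel hn1]
    refine Runs.of_straight (p := .setNat (scell 11) (.add (sc 11) (vec 8 (.sub (sc 0) (.lit 1)))))
      trivial ?_
    rw [hval]
    have hne : ∀ a i c, a ≠ 11 → ({ σ₁ with
        nat := Function.update σ₁.nat (11, 0, 0) (cnt + ∑ l ∈ Finset.range n, h l) } : Store k).nat
        (a, i, c) = σ₁.nat (a, i, c) := fun a i c ha =>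
      Function.update_of_ne (by simp [ha]) _ _
    refine ⟨(hF₁.mono (by simp) (by simp) (by simp)).update_nat (by simp), by simp,
      fun i hi => ?_, fun i hi u hu => ?_, fun i hi u hu => ?_, fun v hv c => ?_,
      fun i hi u hu => ?_, fun v hv => ?_⟩
    · rw [hne _ _ _ (by decide), hσ₁, Store.join_nat_of_owner (by simp) hi, (hτ i hi).node, hth4]
      exact fun j hj hji => (hτ j hj).node_ne i hji.symm
    · rw [hne _ _ _ (by decide), hout i hi u hu, (hτ i hi).fst u hu, hth4]
    · rw [hne _ _ _ (by decide), hout i hi u hu, (hτ i hi).snd u hu, hth4]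
    · rw [hne _ _ _ (by decide)]
      exact Store.join_nat_of_forall fun j hj => (hτ j hj).out_ne v (Or.inl (by omega)) c
    · refine (Store.join_clu_of_owner (a := 20) hi fun j hj hji => ?_).trans ((hτ i hi).clu u hu)
      refine (hτ j hj).clu_ne _ ?_
      have := hsep i j hji.symm u hu
      omega
    · exact Store.join_clu_of_forall (a := 20) fun j hj => (hτ j hj).clu_ne v (Or.inl (by omega))

end

namespace Linkage

variable {k : ℕ} {d : Linkage k} {K : ℕ} {P : Finset (Pt k)} {L thr : ℝ} {S : Finset ℕ}
  {X : ℕ → Finset (Pt k)} {T : Finset ℕ} {b : ℕ → ℕ → ℕ} {h : ℕ → ℕ}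

/-- Each merge of a stage removes exactly one slot. -/
theorem Stage.card_remaining (hd : d.WellBehaved K) (hX : d.Clustering P L S X) (hL : 0 < L)
    (hthr : thr ≤ 2 * L) (g : d.Stage (radiusNum K k (lg P.card) * L) thr S X T b h) {n : ℕ}
    (hT : ∀ i ∈ T, i < n) :
    (remaining S b h).card + ∑ i ∈ Finset.range n, h i = S.card := by
  have h1 : S \ remaining S b h =
      (Finset.range n).biUnion fun i => (Finset.range (h i)).image (b i) := by
    ext j
    simp only [Finset.mem_sdiff, mem_remaining, Finset.mem_biUnion, Finset.mem_range,
      Finset.mem_image, not_and, not_forall, not_not]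
    constructor
    · rintro ⟨h1, h2⟩
      obtain ⟨i, s, hs, e⟩ := h2 h1
      exact ⟨i, hT i (g.mem_of_lt hs), s, hs, e⟩
    · rintro ⟨i, -, s, hs, rfl⟩
      exact ⟨(g.cascade i (g.mem_of_lt hs)).mem s hs, fun _ => ⟨i, s, hs, rfl⟩⟩
  have h2 : (S \ remaining S b h).card = ∑ i ∈ Finset.range n, h i := by
    rw [h1, Finset.card_biUnion]
    · refine Finset.sum_congr rfl fun i _ => ?_
      rw [Finset.card_image_of_injOn, Finset.card_range]
      intro s hs t ht e
      rw [Finset.coe_range, Set.mem_Iio] at hs ht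
      have hc := g.cascade i (g.mem_of_lt hs)
      rcases Nat.lt_trichotomy s t with h3 | h3 | h3
      · exact absurd e (hc.inj t ht s h3)
      · exact h3
      · exact absurd e.symm (hc.inj s hs t h3)
    · intro i _ j _ hij
      rw [Function.onFun, Finset.disjoint_left]
      intro v hv hv'
      simp only [Finset.mem_image, Finset.mem_range] at hv hv'
      obtain ⟨s, hs, rfl⟩ := hv
      obtain ⟨t, ht, e⟩ := hv'
      exact g.next_ne hd hX hL hthr hs ht hij e.symm
  have h3 := Finset.card_sdiff_add_card_eq_card (s := remaining S b h) (t := S)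
    (fun j hj => (mem_remaining.1 hj).1)
  omega

end Linkage

/-! ### The invariant of the algorithm -/

section

variable {k : ℕ} {d : Linkage k} {K : ℕ} {c : ℝ} {n : ℕ} {p : Fin n → Pt k}

/-- The merge number `t` of the output. -/
def Store.merge (σ : Store k) (t : ℕ) : Finset (Pt k) × Finset (Pt k) :=
  (σ.clu (0, σ.nat (2, t, 0), 0), σ.clu (0, σ.nat (2, t, 1), 0))

open scoped Classical in
/-- The invariant of the algorithm: the clusters of the slots that are alive are at least `L`
apart, where `L` is the scale in the real cell `0`, and the merges that have been written to the
output lead to these clusters in a `c`-approximate HAC. -/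
structure HacInv (d : Linkage k) (K : ℕ) (c : ℝ) (p : Fin n → Pt k) (σ : Store k) : Prop where
  size : σ.nat (0, 0, 0) = n
  pos : 0 < σ.real (0, 0, 0)
  radius : σ.real (2, 0, 0) = Linkage.radiusNum K k (lg n)
  count : σ.nat (11, 0, 0) + (σ.slots n 3).card = n
  nonempty : (σ.slots n 3).Nonempty
  node_lt : ∀ i ∈ σ.slots n 3, σ.nat (4, i, 0) < n + σ.nat (11, 0, 0)
  node_clu : ∀ i ∈ σ.slots n 3, σ.clu (0, σ.nat (4, i, 0), 0) = σ.slotClu i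
  input : ∀ i : Fin n, σ.clu (0, i, 0) = {p i}
  out : ∀ t < σ.nat (11, 0, 0), σ.nat (2, t, 0) < n + t ∧ σ.nat (2, t, 1) < n + t ∧
    σ.clu (0, n + t, 0) = (σ.merge t).1 ∪ (σ.merge t).2
  reach : ∀ l, ApproxHACFrom d c ((σ.slots n 3).image σ.slotClu) l →
    IsApproxHAC d c p ((List.range (σ.nat (11, 0, 0))).map σ.merge ++ l)
  clustering : d.Clustering (Finset.univ.image p) (σ.real (0, 0, 0)) (σ.slots n 3) σ.slotClu

theorem HacInv.frame {σ σ' : Store k} (I : HacInv d K c p σ) {N R C : List ℕ}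
    (hF : Frame N R C σ σ')
    (hN : 0 ∉ N ∧ 2 ∉ N ∧ 3 ∉ N ∧ 4 ∉ N ∧ 11 ∉ N) (hR : 0 ∉ R ∧ 2 ∉ R) (hC : 0 ∉ C ∧ 1 ∉ C) :
    HacInv d K c p σ' := by
  obtain ⟨n0, n2, n3, n4, n11⟩ := hN
  have hm : σ'.merge = σ.merge := by
    funext t
    simp only [Store.merge, hF.nat 2 n2, hF.clu 0 hC.1]
  refine ⟨?_, ?_, ?_, ?_, ?_, ?_, ?_, ?_, ?_, ?_, ?_⟩
  · rw [hF.nat 0 n0, I.size]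
  · rw [hF.real 0 hR.1]; exact I.pos
  · rw [hF.real 2 hR.2, I.radius]
  · rw [hF.nat 11 n11, hF.slots n n3, I.count]
  · rw [hF.slots n n3]; exact I.nonempty
  · rw [hF.nat 11 n11, hF.slots n n3]; simpa only [hF.nat 4 n4] using I.node_lt
  · rw [hF.slots n n3, hF.slotClu hC.2]; simpa only [hF.nat 4 n4, hF.clu 0 hC.1] using I.node_clu
  · simpa only [hF.clu 0 hC.1] using I.input
  · simpa only [hF.nat 11 n11, hF.nat 2 n2, hm, hF.clu 0 hC.1] using I.out
  · simpa only [hF.nat 11 n11, hm, hF.slots n n3, hF.slotClu hC.2] using I.reach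
  · rw [hF.real 0 hR.1, hF.slots n n3, hF.slotClu hC.2]; exact I.clustering

open Linkage in
open scoped Classical in
/-- The invariant survives a stage: the output is continued by the merges of its cascades in the
order of their seeds, which is a valid sequential order by `Stage.reach`. -/
theorem HacInv.of_stage {σ₀ σ₁ σ : Store k} (I : HacInv d K c p σ₀) (hp : Function.Injective p)
    (hd : d.WellBehaved K) (hc : 1 ≤ c)
    {thr : ℝ} (hLt : σ₀.real (0, 0, 0) ≤ thr) (hthr : thr ≤ 2 * σ₀.real (0, 0, 0))
    (hthr' : thr ≤ c * σ₀.real (0, 0, 0)) {T : Finset ℕ} {b : ℕ → ℕ → ℕ} {h : ℕ → ℕ}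
    (g : d.Stage (radiusNum K k (lg n) * σ₀.real (0, 0, 0)) thr (σ₀.slots n 3) σ₀.slotClu T b h)
    (hF : Frame [3, 5, 6, 7, 8, 9, 10, 15, 16, 17] [3, 4] [1] σ₀ σ₁)
    (hS : σ₁.slots n 3 = remaining (σ₀.slots n 3) b h)
    (hclu : ∀ i < n, σ₁.slotClu i = after σ₀.slotClu b h i)
    (E : EmitAllStore σ₁ σ₀.slotClu n (σ₀.nat (11, 0, 0)) b h σ) : HacInv d K c p σ := by
  have hPn : (Finset.univ.image p).card = n := by
    rw [Finset.card_image_of_injective _ hp, Finset.card_univ, Fintype.card_fin]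
  have g' : d.Stage (radiusNum K k (lg (Finset.univ.image p).card) * σ₀.real (0, 0, 0)) thr
      (σ₀.slots n 3) σ₀.slotClu T b h := by rw [hPn]; exact g
  set S := σ₀.slots n 3 with hSdef
  set X := σ₀.slotClu with hXdef
  set cnt := σ₀.nat (11, 0, 0) with hcnt
  have hX := I.clustering
  have hSn : ∀ i ∈ S, i < n := fun i hi => (Store.mem_slots.1 hi).1
  have hTn : ∀ i ∈ T, i < n := fun i hi => hSn i (g.subset hi)
  have hS' : σ.slots n 3 = remaining S b h := by rw [E.frame.slots n (by simp), hS]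
  have hclu' : ∀ i < n, σ.slotClu i = after X b h i := fun i hi => by
    rw [E.frame.slotClu (by simp), hclu i hi]
  have h4 : ∀ i, σ₁.nat (4, i, 0) = σ₀.nat (4, i, 0) := fun i => hF.nat 4 (by simp) _ _
  have hc0 : ∀ v < n + cnt, σ.clu (0, v, 0) = σ₀.clu (0, v, 0) := fun v hv => by
    rw [E.clu_ne v hv, hF.clu 0 (by simp)]
  have hL0 : σ.real (0, 0, 0) = σ₀.real (0, 0, 0) := by
    rw [E.frame.real 0 (by simp), hF.real 0 (by simp)]
  -- the nodes of the merges
  have hfst : ∀ i ∈ T, ∀ u ≤ h i,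
      nodeAfter n (σ₀.nat (4, i, 0)) (cnt + ∑ l ∈ Finset.range i, h l) u <
        n + (cnt + ∑ l ∈ Finset.range i, h l + u) ∧
      σ.clu (0, nodeAfter n (σ₀.nat (4, i, 0)) (cnt + ∑ l ∈ Finset.range i, h l) u, 0) =
        grow X i (b i) u := by
    intro i hi u hu
    cases u with
    | zero =>
      have h1 := I.node_lt i (g.subset hi)
      simp only [nodeAfter]
      refine ⟨by omega, ?_⟩
      rw [hc0 _ h1, I.node_clu i (g.subset hi)]; rfl
    | succ u =>
      simp only [nodeAfter]
      exact ⟨by omega, E.clu i (hTn i hi) u (by omega)⟩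
  have hmerge : ∀ i, ∀ u < h i, σ.merge (cnt + (∑ l ∈ Finset.range i, h l + u)) =
      (grow X i (b i) u, X (b i u)) := by
    intro i u hu
    have hi := g.mem_of_lt hu
    have hbS := (g.cascade i hi).mem u hu
    rw [Store.merge, ← add_assoc, E.fst i (hTn i hi) u hu, E.snd i (hTn i hi) u hu, h4, h4,
      (hfst i hi u hu.le).2, hc0 _ (I.node_lt _ hbS), I.node_clu _ hbS]
  have hmerge_old : ∀ t < cnt, σ.merge t = σ₀.merge t := by
    intro t ht
    obtain ⟨h1, h2, -⟩ := I.out t ht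
    rw [Store.merge, Store.merge, E.out_ne t ht, E.out_ne t ht, hF.nat 2 (by simp),
      hF.nat 2 (by simp), hc0 _ (by omega), hc0 _ (by omega)]
  refine ⟨?_, ?_, ?_, ?_, ?_, fun i hi => ?_, fun i hi => ?_, fun i => ?_, fun t ht => ?_,
    fun l hl => ?_, ?_⟩
  · rw [E.frame.nat 0 (by simp), hF.nat 0 (by simp), I.size]
  · rw [hL0]; exact I.pos
  · rw [E.frame.real 2 (by simp), hF.real 2 (by simp), I.radius]
  · have h1 := g'.card_remaining hd hX I.pos hthr hTn
    rw [E.count, hS', add_assoc, add_comm (∑ l ∈ _, _), h1, I.count]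
  · rw [hS']
    rcases T.eq_empty_or_nonempty with hT | ⟨i, hi⟩
    · obtain ⟨i, hi⟩ := I.nonempty
      refine ⟨i, mem_remaining.2 ⟨hi, fun j s hs => ?_⟩⟩
      have := g.mem_of_lt hs
      simp [hT] at this
    · exact ⟨i, mem_remaining.2 ⟨g.subset hi, fun j s hs e =>
        g'.next_notMem hd hX I.pos hthr hs (e ▸ hi)⟩⟩
  · rw [hS'] at hi
    have hiS := (mem_remaining.1 hi).1
    rw [E.node i (hSn i hiS), E.count, h4]
    by_cases hT : i ∈ T
    · have h1 := (hfst i hT (h i) le_rfl).1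
      have h2 := sum_range_add_le (h := h) (hTn i hT)
      omega
    · rw [g.length_zero i hT]
      have h1 := I.node_lt i hiS
      simp only [nodeAfter]
      omega
  · rw [hS'] at hi
    have hiS := (mem_remaining.1 hi).1
    rw [E.node i (hSn i hiS), h4, hclu' i (hSn i hiS)]
    by_cases hT : i ∈ T
    · exact (hfst i hT (h i) le_rfl).2
    · rw [g.length_zero i hT, g.after_of_notMem hT]
      simp only [nodeAfter]
      rw [hc0 _ (I.node_lt i hiS), I.node_clu i hiS]
  · rw [hc0 _ (i.2.trans_le (Nat.le_add_right _ _)), I.input i]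
  · rw [E.count] at ht
    by_cases h1 : t < cnt
    · obtain ⟨h2, h3, h5⟩ := I.out t h1
      rw [hmerge_old t h1, E.out_ne t h1, E.out_ne t h1, hF.nat 2 (by simp), hF.nat 2 (by simp),
        hc0 _ (by omega)]
      exact ⟨h2, h3, h5⟩
    · obtain ⟨i, hi, u, hu, h2⟩ := exists_eq_sum_range_add (h := h) (n := n) (v := t - cnt)
        (by omega)
      have hT := g.mem_of_lt hu
      obtain rfl : t = cnt + (∑ l ∈ Finset.range i, h l + u) := by omega
      rw [hmerge i u hu, ← add_assoc, E.fst i hi u hu, E.snd i hi u hu, h4, h4]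
      have h3 := I.node_lt _ ((g.cascade i hT).mem u hu)
      exact ⟨(hfst i hT u hu.le).1, by omega, E.clu i hi u hu⟩
  · have e : (fun i => if i < n then h i else 0) = h := by
      funext i
      split_ifs with hi
      · rfl
      · exact (g.length_zero i fun hT => hi (hTn i hT)).symm
    have hr := g'.reach hc hd hX I.pos hLt hthr hthr' (fun t => σ.merge (cnt + t)) hmerge n
    rw [e] at hr
    have h1 : (σ.slots n 3).image σ.slotClu = (remaining S b h).image (after X b h) := by
      rw [hS']
      exact Finset.image_congr fun i hi => hclu' i (hSn i (mem_remaining.1 hi).1)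
    rw [h1] at hl
    have h2 := I.reach _ (hr l hl)
    rw [E.count, List.range_add, List.map_append, List.map_map, List.append_assoc]
    rw [← show (List.range cnt).map σ.merge = (List.range cnt).map σ₀.merge from ?_] at h2
    · exact h2
    exact List.map_congr_left fun t ht => hmerge_old t (List.mem_range.1 ht)
  · have h1 := g'.clustering_after hd hX I.pos hLt hthr
    rw [hL0, hS']
    have h2 : ∀ i ∈ remaining S b h, σ.slotClu i = after X b h i := fun i hi =>
      hclu' i (hSn i (mem_remaining.1 hi).1)
    refine ⟨fun i hi => ?_, fun i hi => ?_, fun i hi j hj => ?_, fun i hi j hj => ?_⟩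
    · rw [h2 i hi]; exact h1.nonempty i hi
    · rw [h2 i hi]; exact h1.subset i hi
    · rw [h2 i hi, h2 j hj]; exact h1.disjoint i hi j hj
    · rw [h2 i hi, h2 j hj]; exact h1.le_dist i hi j hj

end

/-! ### Running a stage -/

/-- One stage: select candidates of the residue class that is given by the cells `12` and `13`, run
their cascades, and write the merges. -/
def stage (q : ℕ) : Cmd :=
  .seq markResidue (.seq markNear (.seq (.seq chooseFirst dropBlocked)
    (.seq (runCascades q) (.seq positions emitAll))))

/-- The work of a stage. -/
def stageWork (K k n : ℕ) : ℕ :=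
  1 + n * 2 + (1 + 8 * n * lg n) + (1 + n * (1 + (1 + n * (1 + 9))) +
    (1 + n * (1 + 3) + (1 + n * (1 + (1 + n * (1 + 2)))) + (1 + n * (1 + (1 + n * (1 + 4)))) +
      (1 + n * (1 + (1 + cascadeWork K k n)) + (1 + n * (1 + 1) + 8 * n * lg n +
        (1 + n * (1 + (1 + (1 + (Linkage.lengthNum K k (lg n) * (1 + 6) + 1)))) + 1)))))

/-- The depth of a stage. -/
def stageDepth (K k n : ℕ) : ℕ :=
  1 + Nat.clog 2 n + 1 + (1 + lg n * (lg n + 6)) +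
    (1 + Nat.clog 2 n + (1 + Nat.clog 2 n + 9) +
      (1 + Nat.clog 2 n + 3 + (1 + Nat.clog 2 n + (1 + Nat.clog 2 n + 2)) +
        (1 + Nat.clog 2 n + (1 + Nat.clog 2 n + 4)) +
      (1 + Nat.clog 2 n + (1 + cascadeDepth K k n) +
        (1 + Nat.clog 2 n + 1 + lg n * (lg n + 6) +
          (1 + Nat.clog 2 n + (1 + (1 + (Linkage.lengthNum K k (lg n) * (1 + 6) + 1))) + 1)))))

section

variable {k : ℕ} {d : Linkage k} {K : ℕ} {c : ℝ} {n : ℕ} {p : Fin n → Pt k}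

theorem card_image_univ (hp : Function.Injective p) [DecidableEq (Pt k)] :
    (Finset.univ.image p).card = n := by
  rw [Finset.card_image_of_injective _ hp, Finset.card_univ, Fintype.card_fin]

open Linkage in
open scoped Classical in
/-- The effect of a stage with modulus `m`, residue `r` and candidates `O`. Progress is made with
each candidate that has no rival in its residue class. -/
theorem stage_runs (hd : d.WellBehaved K) (hp : Function.Injective p) (hn1 : 1 ≤ n) (hc : 1 ≤ c)
    {σ : Store k} (I : HacInv d K c p σ) {q m r : ℕ} (hm : σ.nat (12, 0, 0) = m)
    (hr : σ.nat (13, 0, 0) = r) (hrm : r < m) (hO : σ.slots n 5 ⊆ σ.slots n 3)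
    (hLt : σ.real (0, 0, 0) ≤ σ.thr q) (hthr : σ.thr q ≤ 2 * σ.real (0, 0, 0))
    (hthr' : σ.thr q ≤ c * σ.real (0, 0, 0)) :
    Runs d (stage q) σ (stageWork K k n) (stageDepth K k n) fun σ' =>
      HacInv d K c p σ' ∧ Frame [2, 3, 4, 5, 6, 7, 8, 9, 10, 11, 15, 16, 17] [3, 4] [0, 1] σ σ' ∧
      ∃ (T : Finset ℕ) (b : ℕ → ℕ → ℕ) (h : ℕ → ℕ),
        d.Stage (radiusNum K k (lg n) * σ.real (0, 0, 0)) (σ.thr q) (σ.slots n 3) σ.slotClu T b h ∧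
        T ⊆ σ.slots n 5 ∧ σ'.slots n 3 = remaining (σ.slots n 3) b h ∧
        (∀ i < n, σ'.slotClu i = after σ.slotClu b h i) ∧
        σ'.slots n 5 = remaining (σ.slots n 5) b h \ T ∧
        ∀ i ∈ σ.slots n 5, i % m = r → (∀ j ∈ σ.slots n 3,
          d.Near (radiusNum K k (lg n) * σ.real (0, 0, 0)) σ.slotClu i j → ∀ i' ∈ σ.slots n 5,
          i' % m = r → d.Near (radiusNum K k (lg n) * σ.real (0, 0, 0)) σ.slotClu i' j → i' = i) →
          i ∈ T := by
  have hPn := card_image_univ hp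
  set O := σ.slots n 5 with hOdef
  set S := σ.slots n 3 with hSdef
  set X := σ.slotClu with hXdef
  set R : ℝ := radiusNum K k (lg n) * σ.real (0, 0, 0) with hR
  have hmemO : ∀ {i}, i < n → (i ∈ O ↔ 1 ≤ σ.nat (5, i, 0)) := fun hi => by
    rw [hOdef, Store.mem_slots, and_iff_right hi]
  have hmemS : ∀ {i}, i < n → (i ∈ S ↔ 1 ≤ σ.nat (3, i, 0)) := fun hi => by
    rw [hSdef, Store.mem_slots, and_iff_right hi]
  have hSn : ∀ {i}, i ∈ S → i < n := fun hi => (Store.mem_slots.1 hi).1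
  refine Runs.seq ((markResidue_runs I.size hn1 hm hr hrm).imp ?_)
  rintro σ₁ ⟨hF₁, h8⟩
  refine Runs.seq ((markNear_runs (by rw [hF₁.nat 0 (by simp), I.size])).imp ?_)
  rintro σ₂ ⟨hF₂, h16⟩
  have hF₂' : Frame [8, 15, 16] [4] [] σ σ₂ :=
    (hF₁.mono (by simp) (by simp) (by simp)).trans (hF₂.mono (by simp) (by simp) (by simp))
  replace h16 : ∀ {i j}, i < n → j < n → (1 ≤ σ₂.nat (16, i, j) ↔
      i ∈ O ∧ i % m = r ∧ j ∈ S ∧ d.Near R X i j) := by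
    intro i j hi hj
    rw [h16 i hi j hj, h8 i hi, hF₁.nat 5 (by simp), hF₁.nat 3 (by simp), hF₁.slotClu (by simp),
      hF₁.real 2 (by simp), hF₁.real 0 (by simp), I.radius, hmemO hi, hmemS hj]
  refine Runs.seq ((select_runs (by rw [hF₂'.nat 0 (by simp), I.size])).imp ?_)
  rintro σ₃ ⟨hF₃, h7, hT16, hTsep, hTprog⟩
  have hF₃' : Frame [7, 8, 9, 10, 15, 16] [4] [] σ σ₃ :=
    (hF₂'.mono (by simp) (by simp) (by simp)).trans (hF₃.mono (by simp) (by simp) (by simp))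
  have I₃ := I.frame hF₃' (by simp) (by simp) (by simp)
  set T := σ₃.slots n 10 with hT
  have hTn : ∀ {i}, i ∈ T → i < n := fun hi => (Store.mem_slots.1 hi).1
  have hTO : T ⊆ O := fun i hi => ((h16 (hTn hi) (hTn hi)).1 (hT16 i hi)).1
  have e3 : σ₃.slots n 3 = S := hF₃'.slots n (by simp)
  have e5 : σ₃.slots n 5 = O := hF₃'.slots n (by simp)
  have eX : σ₃.slotClu = X := hF₃'.slotClu (by simp)
  have eL : σ₃.real (0, 0, 0) = σ.real (0, 0, 0) := hF₃'.real 0 (by simp) _ _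
  have et : σ₃.thr q = σ.thr q := hF₃'.thr (by simp) q
  have hrun := runCascades_runs (q := q) hd I₃.size hn1 hPn (by rw [e3]; exact hTO.trans hO)
    I₃.pos (by rw [et, eL]; exact hthr) I₃.clustering h7
  rw [e3, e5, eX, et, ← hT] at hrun
  refine Runs.seq (hrun.imp ?_)
  rintro σ₄ ⟨hF₄, b, h, h0, hcas, hlen, hlog, hclu, hrem, hold⟩
  have hF₄' : Frame [3, 5, 6, 7, 8, 9, 10, 15, 16, 17] [3, 4] [1] σ σ₄ :=
    (hF₃'.mono (by simp) (by simp) (by simp)).trans (hF₄.mono (by simp) (by simp) (by simp))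
  have g : d.Stage R (σ.thr q) S X T b h :=
    { subset := hTO.trans hO
      length_zero := h0
      cascade := fun i hi => (hcas i hi).1
      done := fun i hi => (hcas i hi).2
      not_near := fun i hi j hj hij v hv h1 h2 => by
        have hi' := (h16 (hTn hi) (hTn hi)).1 (hT16 i hi)
        have hj' := (h16 (hTn hj) (hTn hj)).1 (hT16 j hj)
        exact hTsep i hi j hj hij v (hSn hv) ((h16 (hTn hi) (hSn hv)).2 ⟨hi'.1, hi'.2.1, hv, h1⟩)
          ((h16 (hTn hj) (hSn hv)).2 ⟨hj'.1, hj'.2.1, hv, h2⟩) }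
  have hH : ∀ i, h i ≤ lengthNum K k (lg n) := by
    intro i
    by_cases hi : i ∈ T
    · have h1 := (g.cascade i hi).length_lt hd I.clustering (g.subset hi) I.pos hthr
      rw [hPn] at h1
      exact h1.le
    · rw [h0 i hi]; exact Nat.zero_le _
  refine Runs.seq ((positions_runs (by rw [hF₄'.nat 0 (by simp), I.size]) hn1).imp ?_)
  rintro σ₅ ⟨hF₅, h8'⟩
  have hF₅' : Frame [3, 5, 6, 7, 8, 9, 10, 15, 16, 17] [3, 4] [1] σ σ₅ :=
    hF₄'.trans (hF₅.mono (by simp) (by simp) (by simp))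
  have hnode : ∀ i ∈ S, σ₅.nat (4, i, 0) < n + σ.nat (11, 0, 0) ∧
      σ₅.clu (0, σ₅.nat (4, i, 0), 0) = X i := fun i hi => by
    rw [hF₅'.nat 4 (by simp), hF₅'.clu 0 (by simp)]
    exact ⟨I.node_lt i hi, I.node_clu i hi⟩
  refine (emitAll_runs (X := X) (b := b) (h := h) (cnt := σ.nat (11, 0, 0))
    (by rw [hF₅'.nat 0 (by simp), I.size]) hn1 (hF₅'.nat 11 (by simp) _ _)
    (fun i hi => by rw [hF₅.nat 7 (by simp), hlen i hi]) hH (fun i hi => ?_)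
    (fun i s hs => by rw [hF₅.nat 6 (by simp), hlog i s hs])
    (fun i s hs => (g.cascade i (g.mem_of_lt hs)).ne s hs)
    (fun i hi => hnode i (g.subset (g.mem_of_lt hi)))
    (fun i s hs => hnode _ ((g.cascade i (g.mem_of_lt hs)).mem s hs))).imp ?_
  · rw [h8' i hi]
    exact Finset.sum_congr rfl fun l hl => hlen l (by have := Finset.mem_range.1 hl; omega)
  intro σ₆ E
  have hF₆ : Frame [2, 3, 4, 5, 6, 7, 8, 9, 10, 11, 15, 16, 17] [3, 4] [0, 1] σ σ₆ :=
    (hF₅'.mono (by simp) (by simp) (by simp)).trans (E.frame.mono (by simp) (by simp) (by simp))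
  have hclu₅ : ∀ i < n, σ₅.slotClu i = after X b h i := fun i hi => by
    rw [hF₅.slotClu (by simp), hclu i hi]
  have hrem₅ : σ₅.slots n 3 = remaining S b h := by rw [hF₅.slots n (by simp), hrem]
  refine ⟨I.of_stage hp hd hc hLt hthr hthr' g hF₅' hrem₅ hclu₅ E, hF₆, T, b, h, g, hTO, ?_,
    fun i hi => ?_, ?_, fun i hi hir hgood => ?_⟩
  · rw [E.frame.slots n (by simp), hrem₅]
  · rw [E.frame.slotClu (by simp), hclu₅ i hi]
  · rw [E.frame.slots n (by simp), hF₅.slots n (by simp), hold]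
  · have hin := hSn (hO hi)
    refine hTprog i hin ((h16 hin hin).2 ⟨hi, hir, hO hi, Or.inl rfl⟩) fun j hj h1 i' hi' h2 => ?_
    obtain ⟨-, -, h3, h4⟩ := (h16 hin hj).1 h1
    obtain ⟨h5, h6, -, h7⟩ := (h16 hi' hj).1 h2
    exact hgood j h3 h4 i' h5 h6 h7

end

/-! ### Phases: all cascades at one scale -/

namespace Linkage

variable {k : ℕ} {d : Linkage k} {K : ℕ} {P : Finset (Pt k)} {L thr : ℝ} {S S₀ O : Finset ℕ}
  {X X₀ : ℕ → Finset (Pt k)} {T : Finset ℕ} {b : ℕ → ℕ → ℕ} {h : ℕ → ℕ}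

/-- The state `S`, `X` in a phase that started from the clustering `X₀ i`, `i ∈ S₀`: the clusters of
the slots in `O` have not changed since, and all others are farther than `thr` from all clusters. -/
structure Phase (d : Linkage k) (K n : ℕ) (L thr : ℝ) (S₀ : Finset ℕ) (X₀ : ℕ → Finset (Pt k))
    (S : Finset ℕ) (X : ℕ → Finset (Pt k)) (O : Finset ℕ) : Prop where
  old_subset : O ⊆ S
  subset : S ⊆ S₀
  same : ∀ i ∈ O, X i = X₀ i
  move : ∀ i ∈ S, d.off (X₀ i) (X i) ≤ moveNum K k (lg n) * L ∧ (X₀ i).card ≤ (X i).card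
  lt_dist : ∀ i ∈ S, i ∉ O → ∀ j ∈ S, i ≠ j → thr < d.dist (X i) (X j)

theorem remaining_mono {S S' : Finset ℕ} (hS : S ⊆ S') : remaining S b h ⊆ remaining S' b h :=
  fun _ hj => mem_remaining.2 ⟨hS (mem_remaining.1 hj).1, (mem_remaining.1 hj).2⟩

theorem Phase.start (d : Linkage k) (K n : ℕ) (hL : 0 ≤ L) (thr : ℝ) (S : Finset ℕ)
    (X : ℕ → Finset (Pt k)) : d.Phase K n L thr S X S X S where
  old_subset := subset_rfl
  subset := subset_rfl
  same _ _ := rfl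
  move i _ := ⟨by rw [off_self]; positivity, le_rfl⟩
  lt_dist i hi hi' := absurd hi hi'

/-- A stage takes its seeds from `O`. Those and the absorbed slots leave `O`; each other cluster is
unchanged. -/
theorem Phase.stage {n : ℕ} (hP : P.card = n) (F : d.Phase K n L thr S₀ X₀ S X O)
    (hd : d.WellBehaved K) (hX : d.Clustering P L S X) (hL : 0 < L) (hthr : thr ≤ 2 * L)
    (g : d.Stage (radiusNum K k (lg n) * L) thr S X T b h) (hT : T ⊆ O)
    {X' : ℕ → Finset (Pt k)} (hX' : ∀ i ∈ S, X' i = after X b h i) :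
    d.Phase K n L thr S₀ X₀ (remaining S b h) X' (remaining O b h \ T) where
  old_subset := Finset.sdiff_subset.trans (remaining_mono F.old_subset)
  subset _ hi := F.subset (mem_remaining.1 hi).1
  same i hi := by
    rw [Finset.mem_sdiff, mem_remaining] at hi
    rw [hX' i (F.old_subset hi.1.1), g.after_of_notMem hi.2, F.same i hi.1.1]
  move i hi := by
    have hiS := (mem_remaining.1 hi).1
    rw [hX' i hiS]
    by_cases hiT : i ∈ T
    · rw [← F.same i (hT hiT)]
      subst hP
      exact ⟨(g.cascade i hiT).off_le hd hX hiS hL hthr le_rfl,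
        Finset.card_le_card (grow_mono (Nat.zero_le _))⟩
    · rw [g.after_of_notMem hiT]; exact F.move i hiS
  lt_dist i hi hiO j hj hij := by
    have hiS := (mem_remaining.1 hi).1
    have hjS := (mem_remaining.1 hj).1
    rw [hX' i hiS, hX' j hjS]
    by_cases hiT : i ∈ T
    · subst hP; exact g.lt_dist_after hd hX hL hthr hiT hj hij
    · have hiO' : i ∉ O := fun h1 => hiO (Finset.mem_sdiff.2
        ⟨mem_remaining.2 ⟨h1, (mem_remaining.1 hi).2⟩, hiT⟩)
      by_cases hjT : j ∈ T
      · subst hP; rw [d.symm]; exact g.lt_dist_after hd hX hL hthr hjT hi hij.symm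
      · rw [g.after_of_notMem hiT, g.after_of_notMem hjT]
        exact F.lt_dist i hiS hiO' j hjS hij

/-- Clusters that are near the same cluster at any time of a phase are within this multiple of `L`
of a common cluster at its start. -/
def conflictNum (K k l : ℕ) : ℕ := 2 * K * radiusNum K k l

/-- The slots `j` that can block slot `i` in some stage of a phase. -/
noncomputable def rivals (d : Linkage k) (R : ℝ) (S : Finset ℕ) (X : ℕ → Finset (Pt k)) (i : ℕ) :
    Finset ℕ := by
  classical
  exact S.filter fun j => j ≠ i ∧ ∃ c ∈ S, d.off (X i) (X c) ≤ R ∧ d.off (X j) (X c) ≤ R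

theorem mem_rivals {R : ℝ} {i j : ℕ} : j ∈ d.rivals R S X i ↔
    j ∈ S ∧ j ≠ i ∧ ∃ c ∈ S, d.off (X i) (X c) ≤ R ∧ d.off (X j) (X c) ≤ R := by
  classical
  simp [rivals]

/-- Apply packability twice, to the common clusters and to their neighbors. -/
theorem Clustering.card_rivals_le (hd : d.WellBehaved K) (hX : d.Clustering P L S X) (hL : 0 < L)
    {q : ℕ} (hq : 1 ≤ q) {i : ℕ} (hi : i ∈ S) :
    (d.rivals (q * L) S X i).card ≤ (packNum K k (lg P.card) q + 1) ^ 2 := by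
  classical
  have key : ∀ i ∈ S, (S.filter fun c => d.off (X i) (X c) ≤ q * L).card ≤
      packNum K k (lg P.card) q + 1 := fun i hi =>
    (hX.mono (Finset.filter_subset _ _)).card_le_off hd hL (hX.nonempty i hi) (hX.subset i hi) hq
      fun c hc => (Finset.mem_filter.1 hc).2
  have hsub : d.rivals (q * L) S X i ⊆ (S.filter fun c => d.off (X i) (X c) ≤ q * L).biUnion
      fun c => S.filter fun j => d.off (X c) (X j) ≤ q * L := by
    intro j hj
    obtain ⟨h1, -, c, hc, h2, h3⟩ := mem_rivals.1 hj
    rw [off_comm] at h3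
    exact Finset.mem_biUnion.2 ⟨c, Finset.mem_filter.2 ⟨hc, h2⟩, Finset.mem_filter.2 ⟨h1, h3⟩⟩
  rw [sq]
  exact (Finset.card_le_card hsub).trans ((Finset.card_biUnion_le_card_mul _ _ _
    fun c hc => key c (Finset.mem_filter.1 hc).1).trans (Nat.mul_le_mul_right _ (key i hi)))

/-- Candidates that compete for a cluster at any time of a phase are rivals in the clustering at its
start. The number of rivals is bounded there once and for all, although the clusters change during
the phase. -/
theorem Phase.mem_rivals_of_near {n : ℕ} (F : d.Phase K n L thr S₀ X₀ S X O)
    (hd : d.WellBehaved K) (hX : d.Clustering P L S X) (hX₀ : d.Clustering P L S₀ X₀) (hL : 0 < L)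
    {i j c : ℕ} (hi : i ∈ O) (hj : j ∈ O) (hij : j ≠ i) (hc : c ∈ S)
    (h : d.Near (radiusNum K k (lg n) * L) X i c)
    (h' : d.Near (radiusNum K k (lg n) * L) X j c) :
    j ∈ d.rivals (conflictNum K k (lg n) * L) S₀ X₀ i := by
  have hK := hd.one_le
  have key : ∀ i ∈ O, d.Near (radiusNum K k (lg n) * L) X i c →
      d.off (X₀ i) (X₀ c) ≤ conflictNum K k (lg n) * L := by
    intro i hi h
    have h1 := h.off_le (by positivity)
    obtain ⟨h2, h3⟩ := F.move c hc
    have hiS := F.old_subset hi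
    rw [F.same i hi] at h1
    rw [off_comm] at h2
    have h4 := off_triangle hK hd.approxTriangle (hX₀.nonempty i (F.subset hiS))
      (hX.nonempty c hc) (hX₀.nonempty c (F.subset hc)) ((min_le_right _ _).trans h3)
    have h5 : moveNum K k (lg n) ≤ radiusNum K k (lg n) := by
      rw [radiusNum]
      exact Nat.le_mul_of_pos_left _ (by positivity)
    have h5' : (moveNum K k (lg n) : ℝ) ≤ radiusNum K k (lg n) := by exact_mod_cast h5
    calc d.off (X₀ i) (X₀ c) ≤ K * (radiusNum K k (lg n) * L +
          radiusNum K k (lg n) * L) := h4.trans (by gcongr; exact h2.trans (by gcongr))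
      _ = _ := by rw [conflictNum]; push_cast; ring
  exact mem_rivals.2 ⟨F.subset (F.old_subset hj), hij, c, F.subset hc, key i hi h, key j hj h'⟩

/-- A bound for the moduli that are needed in a phase. -/
def modulusNum (K k l : ℕ) : ℕ := 2 * (l * (packNum K k l (conflictNum K k l) + 1) ^ 2 + 1)

end Linkage

/-- Proceed to the next residue. -/
def advance : Cmd :=
  .seq (.setNat (scell 13) (.add (sc 13) (.lit 1)))
    (.ite (.natLe (sc 12) (sc 13))
      (.seq (.setNat (scell 13) (.lit 0)) (.setNat (scell 12) (.add (sc 12) (.lit 1)))) skip)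

/-- Determine whether a cluster is left that has not been processed in the phase. -/
def checkOld : Cmd :=
  .seq (.setNat (scell 14) (.lit 0))
    (.par 20 (sc 0) (.ite (.natLe (.lit 1) (vec 5 (sc 20))) (.setNat (scell 14) (.lit 1)) skip))

/-- Prepare a phase. -/
def startPhase : Cmd :=
  .seq (.par 20 (sc 0) (.setNat (vcell 5 (sc 20)) (vec 3 (sc 20))))
    (.seq (.setNat (scell 12) (.lit 1)) (.seq (.setNat (scell 13) (.lit 0))
      (.setNat (scell 14) (.lit 1))))

/-- A phase: stages until all clusters are processed; then the scale increases. -/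
def phase (q : ℕ) : Cmd :=
  .seq startPhase
    (.seq (.loop (.natLe (.lit 1) (sc 14)) (.seq (stage q) (.seq advance checkOld)))
      (.setReal (scell 0) (thrExp q)))

/-- The work of a phase. -/
def phaseWork (K k n : ℕ) : ℕ :=
  1 + n * (1 + 1) + 3 + ((Linkage.modulusNum K k (lg n) + 1) ^ 2 *
    (1 + (stageWork K k n + (4 + (1 + (1 + n * (1 + 2)))))) + 1 + 1)

/-- The depth of a phase. -/
def phaseDepth (K k n : ℕ) : ℕ :=
  1 + Nat.clog 2 n + 1 + 3 + ((Linkage.modulusNum K k (lg n) + 1) ^ 2 *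
    (1 + (stageDepth K k n + (4 + (1 + (1 + Nat.clog 2 n + 2))))) + 1 + 1)

section

variable {k : ℕ} {d : Linkage k} {K : ℕ} {c : ℝ} {n : ℕ} {p : Fin n → Pt k}

theorem advance_den (σ : Store k) {m r : ℕ} (hm : σ.nat (12, 0, 0) = m)
    (hr : σ.nat (13, 0, 0) = r) (hrm : r < m) :
    Frame [12, 13] [] [] σ (advance.den d σ) ∧ ∃ m' r', (advance.den d σ).nat (12, 0, 0) = m' ∧
      (advance.den d σ).nat (13, 0, 0) = r' ∧ r' < m' ∧
      (m' = m ∧ r' = r + 1 ∨ m' = m + 1 ∧ r' = 0 ∧ m = r + 1) := by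
  have h : advance.den d σ = if m ≤ r + 1 then
      { σ with nat := Function.update (Function.update (Function.update σ.nat (13, 0, 0) (r + 1))
        (13, 0, 0) 0) (12, 0, 0) (m + 1) } else
      { σ with nat := Function.update σ.nat (13, 0, 0) (r + 1) } := by
    simp [advance, Cmd.den, Cond.holds, NatExp.eval, hm, hr]
  rw [h]
  split_ifs with h1
  · exact ⟨(((Frame.refl _ _ _ _).update_nat (by simp)).update_nat (by simp)).update_nat (by simp),
      m + 1, 0, by simp, by simp, by omega, Or.inr ⟨rfl, rfl, by omega⟩⟩
  · exact ⟨(Frame.refl _ _ _ _).update_nat (by simp), m, r + 1, by simp [hm], by simp, by omega,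
      Or.inl ⟨rfl, rfl⟩⟩

/-- All threads that write to the flag write the same value. -/
theorem checkOld_runs {σ : Store k} (hn : σ.nat (0, 0, 0) = n) :
    Runs d checkOld σ (1 + (1 + n * (1 + 2))) (1 + (1 + Nat.clog 2 n + 2)) fun σ' =>
      Frame [14] [] [] σ σ' ∧ (1 ≤ σ'.nat (14, 0, 0) ↔ (σ.slots n 5).Nonempty) := by
  refine Runs.seq (Runs.of_straight (p := .setNat (scell 14) (.lit 0)) trivial ?_)
  set σ₁ := Cmd.den d (.setNat (scell 14) (.lit 0)) σ with hσ₁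
  have hF₁ : Frame [14] [] [] σ σ₁ := (Frame.refl _ _ _ _).update_nat (by simp [scell])
  have h14 : σ₁.nat (14, 0, 0) = 0 := by simp [hσ₁, Cmd.den, NatExp.eval]
  clear_value σ₁
  refine Runs.par_straight
    (p := .ite (.natLe (.lit 1) (vec 5 (sc 20))) (.setNat (scell 14) (.lit 1)) skip)
    (by simp [Cmd.Straight, skip]) (by rw [hF₁.nat 0 (by simp), hn]) ?_
  have hden : ∀ i, Cmd.den d (.ite (.natLe (.lit 1) (vec 5 (sc 20))) (.setNat (scell 14) (.lit 1))
      skip) (σ₁.thread 20 i) = if 1 ≤ σ.nat (5, i, 0) then { σ₁.thread 20 i with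
        nat := Function.update (σ₁.thread 20 i).nat (14, 0, 0) 1 } else σ₁.thread 20 i := by
    intro i
    simp [Cmd.den, Cond.holds, NatExp.eval, Store.thread, hF₁.nat 5]
  simp only [hden]
  refine ⟨hF₁.trans (Frame.join fun i _ =>
    Frame.ite ((Frame.refl _ _ _ _).update_nat (by simp)) (Frame.refl _ _ _ _)), ?_⟩
  rcases Store.join_nat_cases (σ := σ₁) (a := 20) (m := n) (x := (14, 0, 0)) (τ := fun i =>
      if 1 ≤ σ.nat (5, i, 0) then { σ₁.thread 20 i with
        nat := Function.update (σ₁.thread 20 i).nat (14, 0, 0) 1 } else σ₁.thread 20 i)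
      (by simp) with ⟨h1, h2⟩ | ⟨i, hi, h1, h2⟩
  · rw [h1, h14]
    refine ⟨fun h => absurd h (by simp), ?_⟩
    rintro ⟨i, hi⟩
    rw [Store.mem_slots] at hi
    have h3 := h2 i hi.1
    rw [if_pos hi.2, h14] at h3
    simp at h3
  · rw [h1]
    split_ifs at h2 ⊢ with h3
    · simp only [Function.update_self, le_refl, true_iff]
      exact ⟨i, Store.mem_slots.2 ⟨hi, h3⟩⟩
    · exact absurd (by simp [Store.thread]) h2

theorem startPhase_runs {σ : Store k} (hn : σ.nat (0, 0, 0) = n) :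
    Runs d startPhase σ (1 + n * (1 + 1) + 3) (1 + Nat.clog 2 n + 1 + 3) fun σ' =>
      Frame [5, 12, 13, 14] [] [] σ σ' ∧ σ'.slots n 5 = σ.slots n 3 ∧
      σ'.nat (12, 0, 0) = 1 ∧ σ'.nat (13, 0, 0) = 0 ∧ σ'.nat (14, 0, 0) = 1 := by
  refine Runs.seq (Runs.par_straight (p := .setNat (vcell 5 (sc 20)) (vec 3 (sc 20))) trivial hn ?_)
  set σ₁ := σ.join 20 n fun i =>
    Cmd.den d (.setNat (vcell 5 (sc 20)) (vec 3 (sc 20))) (σ.thread 20 i) with hσ₁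
  have hF₁ : Frame [5, 12, 13, 14] [] [] σ σ₁ := Frame.join fun i _ =>
    (Frame.refl _ _ _ _).update_nat (by simp [vcell])
  have h5 : ∀ i < n, σ₁.nat (5, i, 0) = σ.nat (3, i, 0) := by
    intro i hi
    rw [hσ₁, Store.join_nat_of_owner (by simp) hi]
    · simp [Cmd.den, Store.thread]
    · intro j hj hji
      simp only [Cmd.den, vcell_addr, sc_eval, Store.thread, Function.update_self]
      rw [Function.update_of_ne]
      simpa using hji.symm
  clear_value σ₁
  refine Runs.of_straight (p := .seq (.setNat (scell 12) (.lit 1))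
    (.seq (.setNat (scell 13) (.lit 0)) (.setNat (scell 14) (.lit 1)))) (by simp [Cmd.Straight]) ?_
  simp only [Cmd.den, scell_addr, NatExp.eval]
  refine ⟨((hF₁.update_nat (by simp)).update_nat (by simp)).update_nat (by simp), ?_, by simp,
    by simp, by simp⟩
  ext i
  rw [Store.mem_slots, Store.mem_slots]
  refine and_congr_right fun hi => ?_
  simp [h5 i hi]

open Linkage in
/-- The scale may be raised when all clusters are at least as far apart as the new value. -/
theorem HacInv.setScale {σ : Store k} (I : HacInv d K c p σ) {x : ℝ} (hx : 0 < x)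
    (h : ∀ i ∈ σ.slots n 3, ∀ j ∈ σ.slots n 3, i ≠ j → x ≤ d.dist (σ.slotClu i) (σ.slotClu j)) :
    HacInv d K c p { σ with real := Function.update σ.real (0, 0, 0) x } where
  size := I.size
  pos := by simpa using hx
  radius := by simpa using I.radius
  count := I.count
  nonempty := I.nonempty
  node_lt := I.node_lt
  node_clu := I.node_clu
  input := I.input
  out := I.out
  reach := I.reach
  clustering := by
    simp only [Function.update_self]
    exact ⟨I.clustering.nonempty, I.clustering.subset, I.clustering.disjoint, h⟩

open Linkage in
/-- The pairs `(m, r)` with `r < m` are run through in lexicographic order. A candidate whose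
residue modulo a separating `m` comes up is selected, since its rivals have other residues.
Therefore no candidates are left when all moduli up to `modulusNum` have been tried. -/
theorem phase_runs (hd : d.WellBehaved K) (hp : Function.Injective p) (hn1 : 1 ≤ n) (hc : 1 ≤ c)
    {σ : Store k} (I : HacInv d K c p σ) {q : ℕ}
    (hLt : σ.real (0, 0, 0) ≤ σ.thr q) (hthr : σ.thr q ≤ 2 * σ.real (0, 0, 0))
    (hthr' : σ.thr q ≤ c * σ.real (0, 0, 0)) :
    Runs d (phase q) σ (phaseWork K k n) (phaseDepth K k n) fun σ' =>
      HacInv d K c p σ' ∧ σ'.real (0, 0, 0) = σ.thr q := by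
  classical
  have hPn := card_image_univ hp
  set L := σ.real (0, 0, 0) with hL
  set thr := σ.thr q with hthrdef
  set S₀ := σ.slots n 3 with hS₀
  set X₀ := σ.slotClu with hX₀
  set N := modulusNum K k (lg n) with hN
  have hK := hd.one_le
  have hcl₀ := I.clustering
  have hS₀n : ∀ {i}, i ∈ S₀ → i < n := fun hi => (Store.mem_slots.1 hi).1
  -- the moduli that separate a slot from its rivals
  let good : ℕ → ℕ → Prop := fun i m => 1 ≤ m ∧
    ∀ j ∈ d.rivals (conflictNum K k (lg n) * L) S₀ X₀ i, i % m ≠ j % m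
  have hgood : ∀ i ∈ S₀, ∃ m ≤ N, good i m := by
    intro i hi
    have hq : 1 ≤ conflictNum K k (lg n) := by
      have := two_le_moveNum (k := k) (K := K) (one_le_lg n)
      unfold conflictNum radiusNum
      exact Nat.mul_pos (by omega) (Nat.mul_pos (by positivity) (by omega))
    have h1 := hcl₀.card_rivals_le hd I.pos hq hi
    rw [hPn] at h1
    have hnl : n ≤ 2 ^ lg n := (le_two_pow_clog n).trans
      (Nat.pow_le_pow_right (by norm_num) (by unfold lg; omega))
    obtain ⟨m, h2, h3, h4⟩ := exists_separating_modulus hnl (hS₀n hi) _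
      (fun j hj => ⟨hS₀n (mem_rivals.1 hj).1, (mem_rivals.1 hj).2.1⟩) h1
    exact ⟨m, h3, h2, h4⟩
  refine Runs.seq ((startPhase_runs I.size).imp ?_)
  rintro σ₁ ⟨hF₁, hO₁, hm₁, hr₁, hflag₁⟩
  have I₁ := I.frame hF₁ (by simp) (by simp) (by simp)
  -- The fuel counts the positions after `(m, r)` in an enumeration in which `(m, r)` has the
  -- position `m (N + 1) + r`. As long as a candidate is left, `m` is at most a separating modulus
  -- of it, hence at most `N`; so the fuel is positive whenever the loop is entered.
  have hloop := Runs.loop (d := d) (b := .natLe (.lit 1) (sc 14))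
    (p := .seq (stage q) (.seq advance checkOld))
    (W := stageWork K k n + (4 + (1 + (1 + n * (1 + 2)))))
    (T := stageDepth K k n + (4 + (1 + (1 + Nat.clog 2 n + 2))))
    (fun f σ' => HacInv d K c p σ' ∧ σ'.real (0, 0, 0) = L ∧
      d.Phase K n L thr S₀ X₀ (σ'.slots n 3) σ'.slotClu (σ'.slots n 5) ∧
      (1 ≤ σ'.nat (14, 0, 0) → σ'.nat (12, 0, 0) ≤ N) ∧
      (¬ 1 ≤ σ'.nat (14, 0, 0) → σ'.slots n 5 = ∅) ∧
      σ'.nat (13, 0, 0) < σ'.nat (12, 0, 0) ∧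
      f = (N + 1) ^ 2 - (σ'.nat (12, 0, 0) * (N + 1) + σ'.nat (13, 0, 0)) ∧
      ∀ i ∈ σ'.slots n 5, ∀ m, good i m → σ'.nat (12, 0, 0) < m ∨
        σ'.nat (12, 0, 0) = m ∧ σ'.nat (13, 0, 0) ≤ i % m) ?_ _ σ₁
    ⟨I₁, hF₁.real 0 (by simp) _ _, ?_, fun _ => ?_, ?_, ?_, rfl, ?_⟩
  · refine Runs.seq ((hloop.mono (Nat.add_le_add_right (Nat.mul_le_mul_right _
      (Nat.sub_le _ _)) 1) (Nat.add_le_add_right (Nat.mul_le_mul_right _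
      (Nat.sub_le _ _)) 1)).imp ?_)
    rintro σ₂ ⟨hb, f, I₂, hL₂, F, -, hemp, -⟩
    simp only [Cond.holds, NatExp.eval, sc_eval] at hb
    have hO := hemp hb
    have ht : (thrExp q).eval σ₂ = thr := by
      rw [thrExp_eval, Store.thr, hL₂, hthrdef, Store.thr]
    refine Runs.of_straight (p := .setReal (scell 0) (thrExp q)) trivial ?_
    simp only [Cmd.den, scell_addr, ht, Function.update_self, and_true]
    refine I₂.setScale (I.pos.trans_le hLt) fun i hi j hj hij => ?_
    exact (F.lt_dist i hi (by rw [hO]; simp) j hj hij).le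
  · rintro f σ₂ ⟨I₂, hL₂, F, hflag, -, hrm, hf, hun⟩ hb
    simp only [Cond.holds, NatExp.eval, sc_eval] at hb
    have hmN := hflag hb
    have ht : σ₂.thr q = thr := by rw [Store.thr, hL₂, hthrdef, Store.thr]
    refine Runs.seq ((stage_runs hd hp hn1 hc I₂ (q := q) rfl rfl hrm F.old_subset
      (by rw [ht, hL₂]; exact hLt) (by rw [ht, hL₂]; exact hthr)
      (by rw [ht, hL₂]; exact hthr')).imp ?_)
    rintro σ₃ ⟨I₃, hF₃, T, b, h, g, hT, hS₃, hX₃, hO₃, hprog⟩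
    have hcl := I₂.clustering
    rw [ht, hL₂] at g
    rw [hL₂] at hprog hcl
    have F₃ : d.Phase K n L thr S₀ X₀ (σ₃.slots n 3) σ₃.slotClu (σ₃.slots n 5) := by
      rw [hS₃, hO₃]
      exact Phase.stage hPn F hd hcl I.pos hthr g hT fun i hi => hX₃ i (hS₀n (F.subset hi))
    obtain ⟨hFa, m', r', hm', hr', hrm', hstep⟩ := advance_den (d := d) σ₃
      (hF₃.nat 12 (by simp) 0 0) (hF₃.nat 13 (by simp) 0 0) hrm
    refine Runs.seq ((Runs.of_straight (p := advance) (by simp [advance, Cmd.Straight, skip])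
      ?_).mono (by decide) (by decide))
    set σ₄ := advance.den d σ₃ with hσ₄
    clear_value σ₄
    refine (checkOld_runs (by rw [hFa.nat 0 (by simp), I₃.size])).imp ?_
    rintro σ₅ ⟨hF₅, hflag₅⟩
    have hF₅' : Frame [12, 13, 14] [] [] σ₃ σ₅ :=
      (hFa.mono (by simp) (by simp) (by simp)).trans (hF₅.mono (by simp) (by simp) (by simp))
    have e3 : σ₅.slots n 3 = σ₃.slots n 3 := hF₅'.slots n (by simp)
    have e5 : σ₅.slots n 5 = σ₃.slots n 5 := hF₅'.slots n (by simp)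
    have eX : σ₅.slotClu = σ₃.slotClu := hF₅'.slotClu (by simp)
    have e12 : σ₅.nat (12, 0, 0) = m' := by rw [hF₅.nat 12 (by simp), hm']
    have e13 : σ₅.nat (13, 0, 0) = r' := by rw [hF₅.nat 13 (by simp), hr']
    rw [hFa.slots n (by simp)] at hflag₅
    rw [e3, e5, eX, e12, e13]
    have hun' : ∀ i ∈ σ₃.slots n 5, ∀ m, good i m → m' < m ∨ m' = m ∧ r' ≤ i % m := by
      intro i hi m hg
      rw [hO₃, Finset.mem_sdiff, mem_remaining] at hi
      have hiO := hi.1.1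
      -- a candidate that is left over did not have the current residue modulo a separating number
      have h1 : ¬ (σ₂.nat (12, 0, 0) = m ∧ i % m = σ₂.nat (13, 0, 0)) := by
        rintro ⟨rfl, h2⟩
        refine hi.2 (hprog i hiO h2 fun j hj h3 i' hi' h4 h5 => ?_)
        by_contra hne
        exact hg.2 i' (F.mem_rivals_of_near hd hcl hcl₀ I.pos hiO hi' hne hj h3 h5)
          (h2.trans h4.symm)
      have h2 := Nat.mod_lt i hg.1
      rcases hun i hiO m hg with h3 | ⟨h3, h4⟩
      · omega
      · rcases hstep with ⟨h5, h6⟩ | ⟨h5, h6, h7⟩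
        · right
          refine ⟨by omega, ?_⟩
          have : i % m ≠ σ₂.nat (13, 0, 0) := fun h => h1 ⟨h3, h⟩
          omega
        · exfalso
          have : i % m ≠ σ₂.nat (13, 0, 0) := fun h => h1 ⟨h3, h⟩
          omega
    refine ⟨(N + 1) ^ 2 - (m' * (N + 1) + r'), ?_, I₃.frame hF₅' (by simp) (by simp) (by simp), ?_,
      F₃, fun h1 => ?_, fun h1 => ?_, hrm', rfl, hun'⟩
    · have h1 : σ₂.nat (12, 0, 0) * (N + 1) ≤ N * (N + 1) := Nat.mul_le_mul_right _ hmN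
      have h2 : (N + 1) ^ 2 = N * (N + 1) + N + 1 := by ring
      rw [hf]
      rcases hstep with ⟨h5, h6⟩ | ⟨h5, h6, h7⟩
      · rw [h5, h6]; omega
      · rw [h5, h6, add_mul]; omega
    · rw [hF₅'.real 0 (by simp), hF₃.real 0 (by simp), hL₂]
    · obtain ⟨i, hi⟩ := hflag₅.1 h1
      obtain ⟨m, hm, hg⟩ := hgood i (F₃.subset (F₃.old_subset hi))
      rcases hun' i hi m hg with h2 | h2 <;> omega
    · rw [hflag₅] at h1
      exact Finset.not_nonempty_iff_eq_empty.1 h1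
  · rw [hF₁.slots n (by simp), hO₁, hF₁.slotClu (by simp)]
    exact Phase.start d K n I.pos.le thr S₀ X₀
  · rw [hm₁, hN, modulusNum]; omega
  · exact fun h => absurd hflag₁.ge h
  · rw [hm₁, hr₁]; exact one_pos
  · rintro i - m hg
    rw [hm₁, hr₁]
    have := hg.1
    rcases Nat.lt_or_ge 1 m with h | h
    · exact Or.inl h
    · exact Or.inr ⟨by omega, Nat.zero_le _⟩

end

/-! ### The algorithm -/

/-- Powers of an expression. -/
def RealExp.pow (e : RealExp) : ℕ → RealExp
  | 0 => .ofNat (.lit 1)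
  | m + 1 => .mul (e.pow m) e

/-- The expression for a natural number. -/
def RealExp.lit (m : ℕ) : RealExp := .ofNat (.lit m)

/-- Make every point a cluster. -/
def initSlots : Cmd :=
  .par 20 (sc 0) (.seq (.setNat (vcell 3 (sc 20)) (.lit 1))
    (.seq (.setNat (vcell 4 (sc 20)) (sc 20))
    (.union (vcell 1 (sc 20)) (vcell 0 (sc 20)) (vcell 0 (sc 20)))))

/-- The initial scale is a lower bound for all linkage values of points. -/
def initScale (a : ℕ) : Cmd :=
  .seq (.linkage (scell 4) (vcell 0 (.lit 0)) (vcell 0 (.lit 1)))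
    (.setReal (scell 0) (.div (.get (scell 4)) ((RealExp.ofNat (sc 0)).pow a)))

/-- Store `lg n` in the cell `18`. -/
def initLog : Cmd :=
  .seq (.seq (.setNat (scell 18) (.lit 1)) (.setNat (scell 19) (.lit 1)))
    (.loop (.not (.natLe (sc 0) (sc 19)))
      (.seq (.setNat (scell 19) (.add (sc 19) (sc 19)))
        (.setNat (scell 18) (.add (sc 18) (.lit 1)))))

/-- Store `b ^ k` in the real cell `5`. A loop is needed since `k` is part of the input and not of
the program. -/
def initPow (b : ℕ) : Cmd :=
  .seq (.seq (.setReal (scell 5) (.lit 1)) (.setNat (scell 17) (.lit 0)))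
    (.loop (.not (.natLe (sc 1) (sc 17)))
      (.seq (.setReal (scell 5) (.mul (.get (scell 5)) (.lit b)))
        (.setNat (scell 17) (.add (sc 17) (.lit 1)))))

/-- The expression for `runNum`. -/
def runExp (K : ℕ) : RealExp :=
  .add (.mul (.mul (.lit K) ((RealExp.ofNat (sc 18)).pow K)) (.get (scell 5))) (.lit 1)

/-- The expression for `lengthNum`. -/
def lengthExp (K : ℕ) : RealExp :=
  .mul (runExp K) (.mul (.mul (.lit 2) ((RealExp.mul (.lit 2) (runExp K)).pow (2 * K)))
    (.ofNat (sc 18)))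

/-- The expression for `radiusNum`. -/
def radiusExp (K : ℕ) : RealExp :=
  .mul (.lit (3 * K ^ 2)) (.mul ((RealExp.mul (.lit 2) (lengthExp K)).pow (2 * K)) (.lit 2))

/-- The initialization. -/
def init (K a : ℕ) : Cmd :=
  .seq initSlots (.seq (initScale a) (.seq initLog (.seq (initPow ((2 * (3 * K)) ^ K))
    (.setReal (scell 2) (radiusExp K)))))

/-- The algorithm: phases until `n - 1` merges have been written. It depends on `K`, `a` and `q`
only. -/
def hac (K a q : ℕ) : Cmd :=
  .seq (init K a) (.loop (.not (.natLe (sc 0) (.add (sc 11) (.lit 1)))) (phase q))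

/-- A bound for the number of phases. -/
def phaseNum (K a q l : ℕ) : ℕ := q * (2 * K * (l + 2) * l + 2 * a * l + 1)

/-- The work of the algorithm. -/
def hacWork (K a q k n : ℕ) : ℕ :=
  1 + n * (1 + 3) + (2 + (2 + (Nat.clog 2 n * (1 + 2) + 1) + (2 + (k * (1 + 2) + 1) + 1))) +
    (phaseNum K a q (lg n) * (1 + phaseWork K k n) + 1)

/-- The depth of the algorithm. -/
def hacDepth (K a q k n : ℕ) : ℕ :=
  1 + Nat.clog 2 n + 3 + (2 + (2 + (Nat.clog 2 n * (1 + 2) + 1) + (2 + (k * (1 + 2) + 1) + 1))) +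
    (phaseNum K a q (lg n) * (1 + phaseDepth K k n) + 1)

section

variable {k : ℕ} {d : Linkage k} {K : ℕ} {c : ℝ} {n : ℕ} {p : Fin n → Pt k}

theorem RealExp.pow_eval (e : RealExp) (m : ℕ) (σ : Store k) : (e.pow m).eval σ = e.eval σ ^ m := by
  induction m with
  | zero => simp [pow, eval, NatExp.eval]
  | succ m ih => rw [pow, eval, ih, pow_succ]

@[simp] theorem RealExp.lit_eval (m : ℕ) (σ : Store k) : (RealExp.lit m).eval σ = m := rfl

theorem initSlots_runs {σ : Store k} (hn : σ.nat (0, 0, 0) = n) :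
    Runs d initSlots σ (1 + n * (1 + 3)) (1 + Nat.clog 2 n + 3) fun σ' =>
      Frame [3, 4] [] [1] σ σ' ∧ ∀ i < n, σ'.nat (3, i, 0) = 1 ∧ σ'.nat (4, i, 0) = i ∧
        σ'.slotClu i = σ.clu (0, i, 0) := by
  refine Runs.par_straight (p := .seq (.setNat (vcell 3 (sc 20)) (.lit 1))
    (.seq (.setNat (vcell 4 (sc 20)) (sc 20))
    (.union (vcell 1 (sc 20)) (vcell 0 (sc 20)) (vcell 0 (sc 20))))) (by simp [Cmd.Straight]) hn ?_
  have hden : ∀ i, Cmd.den d (.seq (.setNat (vcell 3 (sc 20)) (.lit 1))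
      (.seq (.setNat (vcell 4 (sc 20)) (sc 20))
      (.union (vcell 1 (sc 20)) (vcell 0 (sc 20)) (vcell 0 (sc 20))))) (σ.thread 20 i) =
      { σ.thread 20 i with
        nat := Function.update (Function.update (σ.thread 20 i).nat (3, i, 0) 1) (4, i, 0) i
        clu := Function.update σ.clu (1, i, 0) (σ.clu (0, i, 0)) } := by
    intro i
    simp [Cmd.den, NatExp.eval, Store.thread]
  simp only [hden]
  refine ⟨Frame.join fun i _ => Frame.update_clu (σ' := { σ.thread 20 i with nat := _ })
    (((Frame.refl _ _ _ (σ.thread 20 i)).update_nat (a := 3) (by simp)).update_nat (a := 4)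
      (by simp)) (a := 1) (by simp), fun i hi => ?_⟩
  refine ⟨?_, ?_, ?_⟩
  · rw [Store.join_nat_of_owner (by simp) hi]
    · simp
    · intro j hj hji
      simp [hji.symm]
  · rw [Store.join_nat_of_owner (by simp) hi]
    · simp
    · intro j hj hji
      simp [hji.symm]
  · refine (Store.join_clu_of_owner (a := 20) hi fun j hj hji => ?_).trans ?_
    · simp [hji.symm]
    · simp

/-- The linkage value of the first two points, divided by a bound for the aspect ratio. -/
theorem initScale_den (σ : Store k) (a : ℕ) :
    Frame [] [0, 4] [] σ ((initScale a).den d σ) ∧ ((initScale a).den d σ).real (0, 0, 0) =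
      d.dist (σ.clu (0, 0, 0)) (σ.clu (0, 1, 0)) / (σ.nat (0, 0, 0) : ℝ) ^ a := by
  refine ⟨((Frame.refl _ _ _ _).update_real (by simp [scell])).update_real (by simp [scell]), ?_⟩
  simp [initScale, Cmd.den, RealExp.eval, RealExp.pow_eval, NatExp.eval]

theorem initLog_runs {σ : Store k} (hn : σ.nat (0, 0, 0) = n) :
    Runs d initLog σ (2 + (Nat.clog 2 n * (1 + 2) + 1)) (2 + (Nat.clog 2 n * (1 + 2) + 1)) fun σ' =>
      Frame [18, 19] [] [] σ σ' ∧ σ'.nat (18, 0, 0) = lg n := by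
  refine Runs.seq (Runs.of_straight
    (p := .seq (.setNat (scell 18) (.lit 1)) (.setNat (scell 19) (.lit 1))) ⟨trivial, trivial⟩ ?_)
  refine (Runs.loop (W := 2) (T := 2) (fun f σ' => Frame [18, 19] [] [] σ σ' ∧
    ∃ e, e + f = Nat.clog 2 n ∧ σ'.nat (19, 0, 0) = 2 ^ e ∧ σ'.nat (18, 0, 0) = e + 1) ?_
    (Nat.clog 2 n) _ ?_).imp ?_
  · rintro f σ' ⟨hF, e, he, h19, h18⟩ hb
    simp only [Cond.holds, sc_eval, hF.nat 0 (show 0 ∉ [18, 19] by simp), hn, h19, not_le] at hb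
    have hlt : e < Nat.clog 2 n := by
      rwa [Nat.lt_clog_iff_pow_lt one_lt_two]
    refine Runs.of_straight (p := .seq (.setNat (scell 19) (.add (sc 19) (sc 19)))
      (.setNat (scell 18) (.add (sc 18) (.lit 1)))) ⟨trivial, trivial⟩ ?_
    simp only [Cmd.den, scell_addr, NatExp.eval, sc_eval]
    refine ⟨f - 1, by omega, (hF.update_nat (by simp)).update_nat (by simp), e + 1, by omega,
      ?_, ?_⟩
    · simp [h19]; ring
    · simp [h18]
  · simp only [Cmd.den, scell_addr, NatExp.eval]
    exact ⟨((Frame.refl _ _ _ _).update_nat (by simp)).update_nat (by simp), 0, by simp, by simp,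
      by simp⟩
  · rintro σ' ⟨hb, f, hF, e, he, h19, h18⟩
    simp only [Cond.holds, sc_eval, hF.nat 0 (show 0 ∉ [18, 19] by simp), hn, h19, not_not] at hb
    refine ⟨hF, ?_⟩
    have := Nat.clog_le_of_le_pow hb
    rw [h18, lg]; omega

theorem initPow_runs {σ : Store k} (hk : σ.nat (1, 0, 0) = k) (b : ℕ) :
    Runs d (initPow b) σ (2 + (k * (1 + 2) + 1)) (2 + (k * (1 + 2) + 1)) fun σ' =>
      Frame [17] [5] [] σ σ' ∧ σ'.real (5, 0, 0) = (b : ℝ) ^ k := by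
  refine Runs.seq (Runs.of_straight
    (p := .seq (.setReal (scell 5) (.lit 1)) (.setNat (scell 17) (.lit 0))) ⟨trivial, trivial⟩ ?_)
  refine (Runs.loop (W := 2) (T := 2) (fun f σ' => Frame [17] [5] [] σ σ' ∧
    ∃ e, e + f = k ∧ σ'.nat (17, 0, 0) = e ∧ σ'.real (5, 0, 0) = (b : ℝ) ^ e) ?_ k _ ?_).imp ?_
  · rintro f σ' ⟨hF, e, he, h17, h5⟩ hb
    simp only [Cond.holds, sc_eval, hF.nat 1 (show 1 ∉ [17] by simp), hk, h17, not_le] at hb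
    refine Runs.of_straight (p := .seq (.setReal (scell 5) (.mul (.get (scell 5)) (.lit b)))
      (.setNat (scell 17) (.add (sc 17) (.lit 1)))) ⟨trivial, trivial⟩ ?_
    simp only [Cmd.den, scell_addr, NatExp.eval, RealExp.eval, sc_eval, RealExp.lit_eval]
    refine ⟨f - 1, by omega, Frame.update_nat (σ' := { σ' with real := _ })
      (hF.update_real (by simp)) (by simp), e + 1, by omega, by simp [h17], ?_⟩
    simp [h5, pow_succ]
  · simp only [Cmd.den, scell_addr, NatExp.eval, RealExp.lit_eval]
    exact ⟨Frame.update_nat (σ' := { σ with real := _ })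
      ((Frame.refl _ _ _ _).update_real (by simp)) (by simp), 0, by simp, by simp, by simp⟩
  · rintro σ' ⟨hb, f, hF, e, he, h17, h5⟩
    simp only [Cond.holds, sc_eval, hF.nat 1 (show 1 ∉ [17] by simp), hk, h17, not_not] at hb
    refine ⟨hF, ?_⟩
    rw [h5, show e = k by omega]

open Linkage in
theorem radiusExp_eval {σ : Store k} {l : ℕ} (hl : σ.nat (18, 0, 0) = l)
    (h5 : σ.real (5, 0, 0) = (((2 * (3 * K)) ^ K : ℕ) : ℝ) ^ k) :
    (radiusExp K).eval σ = radiusNum K k l := by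
  have h1 : (runExp K).eval σ = runNum K k l := by
    simp only [runExp, RealExp.eval, RealExp.pow_eval, RealExp.lit_eval, sc_eval, scell_addr, hl,
      h5, runNum, packNum]
    push_cast
    rw [pow_mul]
  have h2 : (lengthExp K).eval σ = lengthNum K k l := by
    simp only [lengthExp, RealExp.eval, RealExp.pow_eval, RealExp.lit_eval, sc_eval, hl, h1,
      lengthNum, growthNum]
    push_cast; ring
  simp only [radiusExp, RealExp.eval, RealExp.pow_eval, RealExp.lit_eval, h2, radiusNum, moveNum]
  push_cast; ring

open Linkage in
open scoped Classical in
/-- The initial scale is positive and a lower bound for all linkage values of points because of the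
bound for the aspect ratio. -/
theorem init_runs (hp : Function.Injective p) (hn2 : 2 ≤ n) {a : ℕ}
    (hr : d.AspectRatioLE p ((n : ℝ) ^ a)) (c : ℝ) :
    Runs d (init K a) (Store.input p)
      (1 + n * (1 + 3) + (2 + (2 + (Nat.clog 2 n * (1 + 2) + 1) + (2 + (k * (1 + 2) + 1) + 1))))
      (1 + Nat.clog 2 n + 3 +
        (2 + (2 + (Nat.clog 2 n * (1 + 2) + 1) + (2 + (k * (1 + 2) + 1) + 1)))) fun σ =>
      HacInv d K c p σ ∧
      σ.real (0, 0, 0) = d.pt (p ⟨0, by omega⟩) (p ⟨1, by omega⟩) / (n : ℝ) ^ a := by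
  set σ₀ := Store.input p with hσ₀
  have hn₀ : σ₀.nat (0, 0, 0) = n := by simp [hσ₀, Store.input]
  have hk₀ : σ₀.nat (1, 0, 0) = k := by simp [hσ₀, Store.input]
  have h11₀ : σ₀.nat (11, 0, 0) = 0 := by simp [hσ₀, Store.input]
  have hc₀ : ∀ i (hi : i < n), σ₀.clu (0, i, 0) = {p ⟨i, hi⟩} := fun i hi => by
    simp [hσ₀, Store.input, hi]
  clear_value σ₀
  refine Runs.seq ((initSlots_runs hn₀).imp ?_)
  rintro σ₁ ⟨hF₁, h₁⟩
  refine Runs.seq (Runs.of_straight (p := initScale a) ⟨trivial, trivial⟩ ?_)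
  obtain ⟨hF₂, hL⟩ := initScale_den (d := d) σ₁ a
  rw [hF₁.clu 0 (by simp), hF₁.clu 0 (by simp), hF₁.nat 0 (by simp), hn₀, hc₀ 0 (by omega),
    hc₀ 1 (by omega)] at hL
  set σ₂ := (initScale a).den d σ₁ with hσ₂
  clear_value σ₂
  have hF₂' : Frame [3, 4] [0, 4] [1] σ₀ σ₂ :=
    (hF₁.mono (by simp) (by simp) (by simp)).trans (hF₂.mono (by simp) (by simp) (by simp))
  refine Runs.seq ((initLog_runs (by rw [hF₂'.nat 0 (by simp), hn₀])).imp ?_)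
  rintro σ₃ ⟨hF₃, h18⟩
  refine Runs.seq ((initPow_runs (by rw [hF₃.nat 1 (by simp), hF₂'.nat 1 (by simp), hk₀]) _).imp ?_)
  rintro σ₄ ⟨hF₄, h5⟩
  refine Runs.of_straight (p := .setReal (scell 2) (radiusExp K)) trivial ?_
  simp only [Cmd.den, scell_addr]
  rw [radiusExp_eval (by rw [hF₄.nat 18 (by simp), h18]) h5]
  have hF : Frame [17, 18, 19] [2, 5] [] σ₂ { σ₄ with
      real := Function.update σ₄.real (2, 0, 0) ((radiusNum K k (lg n) : ℕ) : ℝ) } :=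
    ((hF₃.mono (by simp) (by simp) (by simp)).trans
      (hF₄.mono (by simp) (by simp) (by simp))).update_real (by simp)
  set σ : Store k := { σ₄ with
      real := Function.update σ₄.real (2, 0, 0) ((radiusNum K k (lg n) : ℕ) : ℝ) } with hσ
  have hrad : σ.real (2, 0, 0) = radiusNum K k (lg n) := by simp [hσ]
  change HacInv d K c p σ ∧ σ.real (0, 0, 0) = _
  clear_value σ
  have hslots : σ.slots n 3 = Finset.range n := by
    ext i
    rw [Store.mem_slots, hF.nat 3 (by simp), hF₂.nat 3 (by simp), Finset.mem_range]
    exact ⟨fun h => h.1, fun h => ⟨h, (h₁ i h).1.ge⟩⟩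
  have h11 : σ.nat (11, 0, 0) = 0 := by
    rw [hF.nat 11 (by simp), hF₂'.nat 11 (by simp), h11₀]
  have h4 : ∀ i < n, σ.nat (4, i, 0) = i := fun i hi => by
    rw [hF.nat 4 (by simp), hF₂.nat 4 (by simp), (h₁ i hi).2.1]
  have hclu : ∀ i (hi : i < n), σ.clu (0, i, 0) = {p ⟨i, hi⟩} := fun i hi => by
    rw [hF.clu 0 (by simp), hF₂'.clu 0 (by simp), hc₀ i hi]
  have hX : ∀ i (hi : i < n), σ.slotClu i = {p ⟨i, hi⟩} := fun i hi => by
    rw [hF.slotClu (by simp), hF₂.slotClu (by simp), (h₁ i hi).2.2, hc₀ i hi]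
  have hL' : σ.real (0, 0, 0) = d.pt (p ⟨0, by omega⟩) (p ⟨1, by omega⟩) / (n : ℝ) ^ a := by
    rw [hF.real 0 (by simp), hL]; rfl
  have hn0 : (0 : ℝ) < (n : ℝ) ^ a := by
    have : (0 : ℝ) < n := by exact_mod_cast (by omega : 0 < n)
    positivity
  have h01 : (⟨0, by omega⟩ : Fin n) ≠ ⟨1, by omega⟩ := by simp
  refine ⟨⟨?_, ?_, hrad, ?_, ?_, ?_, ?_, ?_, ?_, ?_, ?_⟩, hL'⟩
  · rw [hF.nat 0 (by simp), hF₂'.nat 0 (by simp), hn₀]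
  · rw [hL']; exact div_pos (hr _ _ _ _ h01 h01).1 hn0
  · rw [hslots, h11]; simp
  · rw [hslots]; exact ⟨0, by simp; omega⟩
  · rw [hslots, h11]
    intro i hi
    rw [Finset.mem_range] at hi
    rw [h4 i hi]; omega
  · rw [hslots]
    intro i hi
    rw [Finset.mem_range] at hi
    rw [h4 i hi, hclu i hi, hX i hi]
  · intro i; exact hclu i i.2
  · rw [h11]; intro t ht; omega
  · intro l hl
    rw [h11]
    have e : (σ.slots n 3).image σ.slotClu = Finset.univ.image fun i => {p i} := by
      rw [hslots]
      ext A
      simp only [Finset.mem_image, Finset.mem_range, Finset.mem_univ, true_and]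
      constructor
      · rintro ⟨i, hi, rfl⟩; exact ⟨⟨i, hi⟩, (hX i hi).symm⟩
      · rintro ⟨i, rfl⟩; exact ⟨i, i.2, hX i i.2⟩
    rw [e] at hl
    simpa [IsApproxHAC] using hl
  · rw [hslots]
    refine ⟨fun i hi => ?_, fun i hi => ?_, fun i hi j hj hij => ?_, fun i hi j hj hij => ?_⟩
    all_goals rw [Finset.mem_range] at hi
    · rw [hX i hi]; simp
    · rw [hX i hi]; simp
    · rw [Finset.mem_range] at hj
      rw [hX i hi, hX j hj, Finset.disjoint_singleton]
      intro e
      have := hp e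
      simp at this
      exact hij this
    · rw [Finset.mem_range] at hj
      rw [hX i hi, hX j hj, hL', div_le_iff₀ hn0]
      obtain ⟨h1, h2⟩ := hr ⟨0, by omega⟩ ⟨1, by omega⟩ ⟨i, hi⟩ ⟨j, hj⟩ h01 (by simpa using hij)
      rw [div_le_iff₀ h1] at h2
      rw [mul_comm]
      exact h2

open Linkage in
open scoped Classical in
/-- At scales above a quasipolynomial multiple of the initial one, a single cluster is left. -/
theorem HacInv.scale_le (hd : d.WellBehaved K) (hp : Function.Injective p) (hn2 : 2 ≤ n) {a : ℕ}
    (hr : d.AspectRatioLE p ((n : ℝ) ^ a)) {σ : Store k} (I : HacInv d K c p σ)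
    (hcnt : σ.nat (11, 0, 0) + 1 < n) :
    σ.real (0, 0, 0) ≤ 2 ^ (2 * K * (lg n + 2) * lg n + 2 * a * lg n) *
      (d.pt (p ⟨0, by omega⟩) (p ⟨1, by omega⟩) / (n : ℝ) ^ a) := by
  have hPn := card_image_univ hp
  have hcard : 1 < (σ.slots n 3).card := by have := I.count; omega
  obtain ⟨i, hi, j, hj, hij⟩ := Finset.one_lt_card.1 hcard
  have hX := I.clustering
  have h01 : (⟨0, by omega⟩ : Fin n) ≠ ⟨1, by omega⟩ := by simp
  set D := d.pt (p ⟨0, by omega⟩) (p ⟨1, by omega⟩) with hD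
  have hD0 : 0 < D := (hr _ _ _ _ h01 h01).1
  have hn0 : (0 : ℝ) < n := by exact_mod_cast (by omega : 0 < n)
  have h1 := hd.dist_le (P := Finset.univ.image p) (D := (n : ℝ) ^ a * D) (by positivity) ?_
    (hX.nonempty i hi) (hX.nonempty j hj) (hX.subset i hi) (hX.subset j hj)
    (hX.disjoint i hi j hj hij)
  · rw [hPn] at h1
    refine (hX.le_dist i hi j hj hij).trans (h1.trans ?_)
    have h2 : (n : ℝ) ≤ 2 ^ lg n := by
      exact_mod_cast (le_two_pow_clog n).trans (Nat.pow_le_pow_right (by norm_num)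
        (by unfold lg; omega))
    have h3 : (n : ℝ) ^ (2 * a) ≤ 2 ^ (2 * a * lg n) := by
      calc (n : ℝ) ^ (2 * a) ≤ (2 ^ lg n) ^ (2 * a) := by gcongr
        _ = _ := by rw [← pow_mul]; ring_nf
    have h4 : (n : ℝ) ^ a * D = (n : ℝ) ^ (2 * a) * (D / (n : ℝ) ^ a) := by
      rw [two_mul, pow_add]; field_simp
    rw [h4, pow_add _ (2 * K * (lg n + 2) * lg n), mul_assoc (2 ^ _)]
    gcongr
  · simp only [Finset.mem_image, Finset.mem_univ, true_and, forall_exists_index]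
    rintro _ u rfl _ v rfl huv
    obtain ⟨-, h2⟩ := hr u v _ _ (fun e => huv (by rw [e])) h01
    rwa [div_le_iff₀ hD0] at h2

open Linkage in
open scoped Classical in
theorem HacInv.outputs {σ : Store k} (I : HacInv d K c p σ) (hcnt : n ≤ σ.nat (11, 0, 0) + 1) :
    σ.OutputsApproxHAC d c p := by
  have h1 := I.count
  have h2 := I.nonempty.card_pos
  have h3 : σ.nat (11, 0, 0) = n - 1 := by omega
  refine ⟨fun v => σ.clu (0, v, 0), I.input, fun t ht => I.out t (by omega), ?_⟩
  obtain ⟨i, hi⟩ := Finset.card_eq_one.1 (show (σ.slots n 3).card = 1 by omega)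
  have h4 := I.reach [] (by rw [hi, Finset.image_singleton]; exact ApproxHACFrom.done _)
  rw [h3, List.append_nil] at h4
  exact h4

open Linkage in
/-- Each phase multiplies the scale by `θ = 1 + 1 / q`, and `θ ^ q ≥ 2`; hence the scale exceeds the
bound of `HacInv.scale_le` after `phaseNum` phases. -/
theorem hac_runs (hd : d.WellBehaved K) (hp : Function.Injective p) (hn2 : 2 ≤ n) {a : ℕ}
    (hr : d.AspectRatioLE p ((n : ℝ) ^ a)) {q : ℕ} (hq : 1 ≤ q) {ε : ℝ}
    (hε : 1 / (q : ℝ) ≤ ε) :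
    Runs d (hac K a q) (Store.input p) (hacWork K a q k n) (hacDepth K a q k n) fun σ =>
      σ.OutputsApproxHAC d (1 + ε) p := by
  have hq0 : (0 : ℝ) < q := by exact_mod_cast hq
  set θ : ℝ := ((q + 1 : ℕ) : ℝ) / (q : ℕ) with hθ
  have hθ' : θ = 1 + 1 / q := by rw [hθ]; push_cast; field_simp
  have hθ1 : 1 ≤ θ := by rw [hθ']; have : 0 < 1 / (q : ℝ) := by positivity
                         linarith
  have hθ2 : θ ≤ 2 := by
    have : 1 / (q : ℝ) ≤ 1 := by rw [div_le_one hq0]; exact_mod_cast hq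
    linarith
  have hθε : θ ≤ 1 + ε := by linarith
  have hθq : 2 ≤ θ ^ q := by
    have h1 := one_add_mul_le_pow (a := 1 / (q : ℝ)) (by have : 0 < 1 / (q : ℝ) := by positivity
                                                         linarith) q
    rw [← hθ', mul_one_div_cancel hq0.ne'] at h1
    linarith
  set E := 2 * K * (lg n + 2) * lg n + 2 * a * lg n with hE
  set L₀ := d.pt (p ⟨0, by omega⟩) (p ⟨1, by omega⟩) / (n : ℝ) ^ a with hL₀
  refine Runs.seq ((init_runs hp hn2 hr (1 + ε)).imp ?_)
  rintro σ₁ ⟨I₁, hL₁⟩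
  have hL₀pos : 0 < L₀ := by rw [hL₀, ← hL₁]; exact I₁.pos
  refine (Runs.loop (fun f σ => HacInv d K (1 + ε) p σ ∧ ∃ t, t + f = phaseNum K a q (lg n) ∧
    σ.real (0, 0, 0) = L₀ * θ ^ t) ?_ (phaseNum K a q (lg n)) σ₁
    ⟨I₁, 0, by simp, by simpa using hL₁⟩).imp ?_
  · rintro f σ ⟨I, t, htf, hL⟩ hb
    simp only [Cond.holds, sc_eval, NatExp.eval, I.size, not_le] at hb
    have hlt : t < phaseNum K a q (lg n) := by
      by_contra hcon
      have h1 := I.scale_le hd hp hn2 hr hb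
      rw [← hE, ← hL₀, hL, mul_comm] at h1
      have h2 : θ ^ t ≤ 2 ^ E := le_of_mul_le_mul_right h1 hL₀pos
      have h3 : (2 : ℝ) ^ (E + 1) ≤ θ ^ t := by
        calc (2 : ℝ) ^ (E + 1) ≤ (θ ^ q) ^ (E + 1) := by gcongr
          _ = θ ^ phaseNum K a q (lg n) := by rw [← pow_mul, phaseNum]
          _ ≤ _ := pow_le_pow_right₀ hθ1 (not_lt.1 hcon)
      -- at this point the scale would exceed the bound for two clusters that still exist
      have h4 : (2 : ℝ) ^ E < 2 ^ (E + 1) := pow_lt_pow_right₀ one_lt_two (by omega)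
      linarith
    have hpos := I.pos
    have ht : σ.thr q = σ.real (0, 0, 0) * θ := rfl
    refine (phase_runs hd hp (by omega) (by linarith) I (q := q) ?_ ?_ ?_).imp ?_
    · rw [ht]; exact le_mul_of_one_le_right hpos.le hθ1
    · rw [ht, mul_comm]; gcongr
    · rw [ht, mul_comm]; gcongr
    · rintro σ' ⟨I', hL'⟩
      refine ⟨f - 1, by omega, I', t + 1, by omega, ?_⟩
      rw [hL', ht, hL, pow_succ]; ring
  · rintro σ ⟨hb, f, I, -⟩
    simp only [Cond.holds, sc_eval, NatExp.eval, I.size, not_not] at hb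
    exact I.outputs hb

end

/-! ### Growth of the bounds -/

/-- The function of the dimension `k` and the number `n` of points is at most `n ^ j * (2 ^ k * lg
n) ^ O(k ^ e)`, where the constant of `O` is uniform in `k ≥ 1` and `n ≥ 2`. -/
def Growth (j e : ℕ) (F : ℕ → ℕ → ℕ) : Prop :=
  ∃ c, ∀ k n, 1 ≤ k → 2 ≤ n → F k n ≤ n ^ j * (2 ^ k * lg n) ^ (c * k ^ e)

namespace Growth

variable {j e : ℕ} {F G : ℕ → ℕ → ℕ}

theorem two_le_base {k n : ℕ} (hk : 1 ≤ k) : 2 ≤ 2 ^ k * lg n := by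
  have h1 : 2 ^ 1 ≤ 2 ^ k := Nat.pow_le_pow_right (by norm_num) hk
  have h2 : 1 ≤ lg n := by unfold lg; omega
  nlinarith

theorem mono {j' e' : ℕ} (h : Growth j e F) (hj : j ≤ j') (he : e ≤ e') : Growth j' e' F := by
  obtain ⟨c, h⟩ := h
  refine ⟨c, fun k n hk hn => (h k n hk hn).trans ?_⟩
  have := two_le_base (n := n) hk
  gcongr <;> omega

theorem of_le (h : Growth j e G) (hFG : ∀ k n, 1 ≤ k → 2 ≤ n → F k n ≤ G k n) : Growth j e F := by
  obtain ⟨c, h⟩ := h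
  exact ⟨c, fun k n hk hn => (hFG k n hk hn).trans (h k n hk hn)⟩

theorem base (j e : ℕ) : Growth j e fun k n => 2 ^ k * lg n := by
  refine ⟨1, fun k n hk hn => ?_⟩
  have h1 := two_le_base (n := n) hk
  have h2 : 1 ≤ n ^ j := Nat.one_le_pow _ _ (by omega)
  have h3 : 1 ≤ k ^ e := Nat.one_le_pow _ _ hk
  calc 2 ^ k * lg n = 1 * (2 ^ k * lg n) ^ 1 := by ring
    _ ≤ _ := by gcongr <;> omega

theorem const (j e m : ℕ) : Growth j e fun _ _ => m := by
  refine ⟨m, fun k n hk hn => ?_⟩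
  have h1 := two_le_base (n := n) hk
  have h2 : 1 ≤ n ^ j := Nat.one_le_pow _ _ (by omega)
  have h3 : 1 ≤ k ^ e := Nat.one_le_pow _ _ hk
  calc m ≤ 2 ^ m := Nat.lt_two_pow_self.le
    _ = 1 * 2 ^ (m * 1) := by ring
    _ ≤ _ := by gcongr; omega

theorem lg (j e : ℕ) : Growth j e fun _ n => lg n :=
  (base j e).of_le fun _ _ _ _ => Nat.le_mul_of_pos_left _ (by positivity)

theorem clog (j e : ℕ) : Growth j e fun _ n => Nat.clog 2 n :=
  (lg j e).of_le fun _ _ _ _ => Nat.le_succ _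

theorem dim (j e : ℕ) : Growth j e fun k _ => k :=
  (base j e).of_le fun k n _ _ => Nat.lt_two_pow_self.le.trans
    (Nat.le_mul_of_pos_right _ (by unfold _root_.lg; omega))

theorem mul {j' : ℕ} (hF : Growth j e F) (hG : Growth j' e G) :
    Growth (j + j') e fun k n => F k n * G k n := by
  obtain ⟨c, hF⟩ := hF
  obtain ⟨c', hG⟩ := hG
  refine ⟨c + c', fun k n hk hn => (Nat.mul_le_mul (hF k n hk hn) (hG k n hk hn)).trans ?_⟩
  rw [add_mul, pow_add, pow_add]
  exact le_of_eq (by ring)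

theorem mul_zero (hF : Growth 0 e F) (hG : Growth j e G) : Growth j e fun k n => F k n * G k n := by
  simpa using hF.mul hG

theorem size_mul (hF : Growth j e F) : Growth (j + 1) e fun k n => n * F k n := by
  obtain ⟨c, hF⟩ := hF
  refine ⟨c, fun k n hk hn => (Nat.mul_le_mul_left n (hF k n hk hn)).trans ?_⟩
  rw [pow_succ]
  exact le_of_eq (by ring)

theorem add (hF : Growth j e F) (hG : Growth j e G) : Growth j e fun k n => F k n + G k n := by
  obtain ⟨c, hF⟩ := hF
  obtain ⟨c', hG⟩ := hG
  refine ⟨c + c' + 1, fun k n hk hn => (Nat.add_le_add (hF k n hk hn) (hG k n hk hn)).trans ?_⟩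
  set M := 2 ^ k * _root_.lg n
  have h1 : 2 ≤ M := two_le_base hk
  have h3 : 1 ≤ k ^ e := Nat.one_le_pow _ _ hk
  have h4 : 1 ≤ M ^ (c * k ^ e) := Nat.one_le_pow _ _ (by omega)
  have h5 : 1 ≤ M ^ (c' * k ^ e) := Nat.one_le_pow _ _ (by omega)
  have h6 : M ≤ M ^ k ^ e := Nat.le_self_pow (by omega) M
  have h7 : M ^ (c * k ^ e) + M ^ (c' * k ^ e) ≤ M ^ ((c + c' + 1) * k ^ e) := by
    rw [add_mul, add_mul, pow_add, pow_add, one_mul]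
    calc M ^ (c * k ^ e) + M ^ (c' * k ^ e) ≤ M ^ (c * k ^ e) * M ^ (c' * k ^ e) * 2 := by nlinarith
      _ ≤ _ := by gcongr; omega
  rw [← mul_add]
  gcongr

theorem pow (hF : Growth 0 e F) (m : ℕ) : Growth 0 e fun k n => F k n ^ m := by
  induction m with
  | zero => simpa using const 0 e 1
  | succ m ih => simpa only [pow_succ] using ih.mul_zero hF

theorem pow_dim (hF : Growth 0 e F) (m : ℕ) : Growth 0 (e + 1) fun k n => F k n ^ (m * k) := by
  obtain ⟨c, hF⟩ := hF
  refine ⟨c * m, fun k n hk hn => (Nat.pow_le_pow_left (hF k n hk hn) _).trans ?_⟩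
  rw [pow_zero, one_mul, one_mul, ← pow_mul]
  exact le_of_eq (by ring)

theorem const_pow_dim (b m : ℕ) : Growth 0 0 fun k _ => b ^ (m * k) := by
  refine of_le (((base 0 0).pow (b * m))) fun k n hk hn => ?_
  have h : 1 ≤ _root_.lg n := by unfold _root_.lg; omega
  calc b ^ (m * k) ≤ (2 ^ b) ^ (m * k) := Nat.pow_le_pow_left Nat.lt_two_pow_self.le _
    _ = (2 ^ k * 1) ^ (b * m) := by rw [mul_one, ← pow_mul, ← pow_mul]; ring
    _ ≤ _ := by gcongr

end Growth

section

theorem growth_packNum_const (K q : ℕ) :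
    Growth 0 0 fun k n => Linkage.packNum K k (lg n) q := by
  simp only [Linkage.packNum]
  exact ((Growth.const 0 0 K).mul_zero ((Growth.lg 0 0).pow K)).mul_zero (Growth.const_pow_dim _ _)

/-- For a radius that is itself `(2 ^ k * lg n) ^ O(1)`, as opposed to a constant one, the exponent
`K k` of the packing bound leads to `e = 1`. -/
theorem growth_packNum (K : ℕ) {F : ℕ → ℕ → ℕ} (hF : Growth 0 0 F) :
    Growth 0 1 fun k n => Linkage.packNum K k (lg n) (F k n) := by
  simp only [Linkage.packNum]
  exact ((Growth.const 0 1 K).mul_zero ((Growth.lg 0 1).pow K)).mul_zero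
    (((Growth.const 0 0 2).mul_zero hF).pow_dim K)

theorem growth_lengthNum (K : ℕ) : Growth 0 0 fun k n => Linkage.lengthNum K k (lg n) := by
  have h1 : Growth 0 0 fun k n => Linkage.runNum K k (lg n) :=
    (growth_packNum_const K _).add (Growth.const 0 0 1)
  exact h1.mul_zero (((Growth.const 0 0 2).mul_zero
    (((Growth.const 0 0 2).mul_zero h1).pow _)).mul_zero (Growth.lg 0 0))

theorem growth_modulusNum (K : ℕ) : Growth 0 1 fun k n => Linkage.modulusNum K k (lg n) := by
  have h1 : Growth 0 0 fun k n => Linkage.moveNum K k (lg n) :=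
    (((Growth.const 0 0 2).mul_zero (growth_lengthNum K)).pow _).mul_zero (Growth.const 0 0 2)
  have h2 : Growth 0 0 fun k n => Linkage.conflictNum K k (lg n) :=
    (Growth.const 0 0 (2 * K)).mul_zero ((Growth.const 0 0 (3 * K ^ 2)).mul_zero h1)
  exact (Growth.const 0 1 2).mul_zero (((Growth.lg 0 1).mul_zero
    (((growth_packNum K h2).add (Growth.const 0 1 1)).pow 2)).add (Growth.const 0 1 1))

theorem growth_phaseNum (K a q : ℕ) : Growth 0 1 fun _ n => phaseNum K a q (lg n) := by
  unfold phaseNum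
  have hl := Growth.lg 0 1
  exact (Growth.const 0 1 q).mul_zero (((((Growth.const 0 1 (2 * K)).mul_zero
    (hl.add (Growth.const 0 1 2))).mul_zero hl).add
    ((Growth.const 0 1 (2 * a)).mul_zero hl)).add (Growth.const 0 1 1))

theorem growth_hacDepth (K a q : ℕ) : Growth 0 1 fun k n => hacDepth K a q k n := by
  have hH := (growth_lengthNum K).mono le_rfl (Nat.zero_le 1)
  have hN := growth_modulusNum K
  have hF := growth_phaseNum K a q
  unfold hacDepth phaseDepth stageDepth cascadeDepth
  repeat' with_reducible first
    | exact hH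
    | exact hN
    | exact hF
    | exact Growth.const _ _ _
    | exact Growth.lg _ _
    | exact Growth.clog _ _
    | exact Growth.dim _ _
    | apply Growth.add
    | apply Growth.mul_zero
    | apply Growth.pow

theorem growth_hacWork (K a q : ℕ) : Growth 2 1 fun k n => hacWork K a q k n := by
  have hH := (growth_lengthNum K).mono le_rfl (Nat.zero_le 1)
  have hN := growth_modulusNum K
  have hF := growth_phaseNum K a q
  have h8 : ∀ j, Growth (j + 1) 1 fun _ n => 8 * n * lg n := fun j =>
    ((Growth.const 0 1 8).mul_zero (Growth.lg j 1)).size_mul.of_le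
      fun k n _ _ => le_of_eq (by ring)
  unfold hacWork phaseWork stageWork cascadeWork
  repeat' with_reducible first
    | exact hH
    | exact hN
    | exact hF
    | exact h8 _
    | exact Growth.const _ _ _
    | exact Growth.lg _ _
    | exact Growth.clog _ _
    | exact Growth.dim _ _
    | apply Growth.add
    | apply Growth.size_mul
    | apply Growth.mul_zero
    | apply Growth.pow

end

/-! ### Comparison with the logarithm to base two -/

theorem lg_le_three_mul_logb {n : ℕ} (hn : 2 ≤ n) : (lg n : ℝ) ≤ 3 * Real.logb 2 n := by
  have h0 : (0 : ℝ) < n := by exact_mod_cast (by omega : 0 < n)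
  have h1 : 1 ≤ Real.logb 2 n := by
    rw [Real.le_logb_iff_rpow_le one_lt_two h0, Real.rpow_one]; exact_mod_cast hn
  have h2 : (Nat.clog 2 n : ℝ) ≤ Real.logb 2 n + 1 := by
    have h3 : (2 : ℝ) ^ Nat.clog 2 n ≤ 2 * n := by exact_mod_cast two_pow_clog_le (by omega)
    have h4 : (Nat.clog 2 n : ℝ) ≤ Real.logb 2 (2 * n) := by
      rw [Real.le_logb_iff_rpow_le one_lt_two (by positivity), Real.rpow_natCast]
      exact h3
    rw [Real.logb_mul (by norm_num) h0.ne', Real.logb_self_eq_one one_lt_two] at h4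
    linarith
  unfold lg; push_cast; linarith

/-- For `k ≥ 2` the factor `2 ^ O(k ^ 2)` is absorbed by `k ^ O(k ^ 2)`, and for `k = 1` it is
bounded. -/
theorem two_pow_mul_lg_pow_le (c : ℕ) {k n C : ℕ} (hk : 1 ≤ k) (hn : 2 ≤ n) (hC : 3 * c ≤ C)
    (hC' : 6 ^ c ≤ C) :
    (((2 ^ k * lg n) ^ (c * k) : ℕ) : ℝ) ≤
      C * ((k : ℝ) ^ (C * k ^ 2) * Real.logb 2 n ^ (C * k)) * Real.logb 2 n ^ C := by
  set y := Real.logb 2 n with hy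
  have hy1 : 1 ≤ y := by
    rw [hy, Real.le_logb_iff_rpow_le one_lt_two (by exact_mod_cast (by omega : 0 < n)),
      Real.rpow_one]
    exact_mod_cast hn
  have hl : (lg n : ℝ) ≤ 3 * y := lg_le_three_mul_logb hn
  have hC1 : (1 : ℝ) ≤ C := by exact_mod_cast (Nat.one_le_pow _ _ (by norm_num)).trans hC'
  have hk1 : (1 : ℝ) ≤ k := by exact_mod_cast hk
  have key : (2 : ℝ) ^ (c * k ^ 2) * 3 ^ (c * k) ≤ C * (k : ℝ) ^ (C * k ^ 2) := by
    rcases Nat.lt_or_ge k 2 with h | h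
    · obtain rfl : k = 1 := by omega
      simp only [one_pow, mul_one, Nat.cast_one]
      rw [← mul_pow]
      norm_num
      exact_mod_cast hC'
    · have hk2 : (2 : ℝ) ≤ k := by exact_mod_cast h
      have h1 : c * k ^ 2 + 2 * (c * k) ≤ C * k ^ 2 := by
        calc c * k ^ 2 + 2 * (c * k) ≤ c * k ^ 2 + 2 * (c * k ^ 2) := by
              gcongr; exact Nat.le_self_pow (by norm_num) k
          _ = 3 * c * k ^ 2 := by ring
          _ ≤ _ := by gcongr
      calc (2 : ℝ) ^ (c * k ^ 2) * 3 ^ (c * k) ≤ 2 ^ (c * k ^ 2) * (2 ^ 2) ^ (c * k) := by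
            gcongr; norm_num
        _ = 2 ^ (c * k ^ 2 + 2 * (c * k)) := by rw [pow_add, pow_mul 2 2]
        _ ≤ 2 ^ (C * k ^ 2) := pow_le_pow_right₀ one_le_two h1
        _ ≤ (k : ℝ) ^ (C * k ^ 2) := by gcongr
        _ ≤ _ := le_mul_of_one_le_left (by positivity) hC1
  have hcC : c * k ≤ C * k := Nat.mul_le_mul_right _ (by omega)
  push_cast
  calc ((2 : ℝ) ^ k * lg n) ^ (c * k) ≤ (2 ^ k * (3 * y)) ^ (c * k) := by gcongr
    _ = 2 ^ (c * k ^ 2) * 3 ^ (c * k) * y ^ (c * k) := by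
        rw [mul_pow, mul_pow, ← pow_mul]; ring_nf
    _ ≤ C * (k : ℝ) ^ (C * k ^ 2) * y ^ (C * k) :=
        mul_le_mul key (pow_le_pow_right₀ hy1 hcC) (by positivity) (by positivity)
    _ = C * ((k : ℝ) ^ (C * k ^ 2) * y ^ (C * k)) * 1 := by ring
    _ ≤ _ := by gcongr; exact one_le_pow₀ hy1

theorem mainTheorem8 (K a : ℕ) (ε : ℝ) (hε : 0 < ε) :
    ∃ (prog : Cmd) (C : ℕ), ∀ (k n : ℕ) (d : Linkage k) (p : Fin n → Pt k),
      d.WellBehaved K → 2 ≤ n → Function.Injective p → d.AspectRatioLE p ((n : ℝ) ^ a) →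
      ∃ (σ : Store k) (work depth : ℕ),
        Exec d prog (Store.input p) σ work depth ∧
        σ.OutputsApproxHAC d (1 + ε) p ∧
        (work : ℝ) ≤
          C * ((n : ℝ) ^ 2 * (k : ℝ) ^ (C * k ^ 2) * (Real.logb 2 n) ^ (C * k)) *
            (Real.logb 2 n) ^ C ∧
        (depth : ℝ) ≤
          C * ((k : ℝ) ^ (C * k ^ 2) * (Real.logb 2 n) ^ (C * k)) * (Real.logb 2 n) ^ C := by
  -- scales increase by the factor `1 + 1 / q` with `1 / q < ε`
  obtain ⟨q₀, hq₀⟩ := exists_nat_one_div_lt hε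
  set q := q₀ + 1 with hq
  obtain ⟨c₁, h₁⟩ := growth_hacWork K a q
  obtain ⟨c₂, h₂⟩ := growth_hacDepth K a q
  -- `3 * c` absorbs the powers of two and three for `k ≥ 2`, and `6 ^ c` their values for `k = 1`
  set C := 3 * (c₁ + c₂) + 6 ^ (c₁ + c₂) with hC
  refine ⟨hac K a q, C, fun k n d p hd hn hp hr => ?_⟩
  -- there are not two points in dimension zero
  have hk : 1 ≤ k := by
    rcases Nat.eq_zero_or_pos k with rfl | h
    · have := hp (Subsingleton.elim (p ⟨0, by omega⟩) (p ⟨1, by omega⟩))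
      simp at this
    · exact h
  obtain ⟨σ, ⟨w, t, hex, hw, ht⟩, hout⟩ := hac_runs hd hp hn hr (q := q) (by omega) (ε := ε)
    (by rw [hq]; push_cast; exact hq₀.le)
  have hle : ∀ c, c ≤ c₁ + c₂ → 3 * c ≤ C ∧ 6 ^ c ≤ C := fun c hc =>
    ⟨(Nat.mul_le_mul_left 3 hc).trans (Nat.le_add_right _ _),
      (Nat.pow_le_pow_right (by norm_num) hc).trans (Nat.le_add_left _ _)⟩
  have hC₁ := hle c₁ (Nat.le_add_right _ _)
  have hC₂ := hle c₂ (Nat.le_add_left _ _)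
  refine ⟨σ, w, t, hex, hout, ?_, ?_⟩
  · have h3 : w ≤ n ^ 2 * (2 ^ k * lg n) ^ (c₁ * k) := by
      simpa only [pow_one] using hw.trans (h₁ k n hk hn)
    have h4 := two_pow_mul_lg_pow_le c₁ hk hn hC₁.1 hC₁.2
    calc (w : ℝ) ≤ (n : ℝ) ^ 2 * (((2 ^ k * lg n) ^ (c₁ * k) : ℕ) : ℝ) := by exact_mod_cast h3
      _ ≤ _ := (mul_le_mul_of_nonneg_left h4 (by positivity)).trans (le_of_eq (by ring))
  · have h3 : t ≤ (2 ^ k * lg n) ^ (c₂ * k) := by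
      simpa only [pow_one, pow_zero, one_mul] using ht.trans (h₂ k n hk hn)
    exact (by exact_mod_cast h3 : (t : ℝ) ≤ (((2 ^ k * lg n) ^ (c₂ * k) : ℕ) : ℝ)).trans
      (two_pow_mul_lg_pow_le c₂ hk hn hC₂.1 hC₂.2)
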